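/- Let $\mathbb K$ be a field of characteristic zero and $c,d\in\mathbb Z$. **Graph complexes.** Graphs are finite; multiple edges and tadpoles are allowed. The valence of a vertex is the number of half-edges at it. Let $\mathbf{GC}_d$ be the graph complex spanned (as a product over the numbers of vertices and edges) by connected graphs $\Gamma$ all of whose vertices are at least bivalent, with vertices $V(\Gamma)$ and edges $E(\Gamma)$ numbered and edges directed, modulo renumbering and flipping of edges up to sign: for $d$ even, edges are odd, vertices are even and flips act trivially; for $d$ odd, vertices are odd, edges are even and a flip of an edge acts by $-1$. The degree of $\Gamma$ is $d(\#V(\Gamma)-1)-(d-1)\#E(\Gamma)$. The differential $\delta$ is the sum over all splittings of a vertex into two vertices joined by a new edge, with all reattachments of the half-edges that create no univalent vertex. **Entangled graphs.** Let $\mathbf{fcGC}_{c,d}$ be spanned (again as a product) by pairs $(\Gamma_1,\Gamma_2)$ of such labelled graphs, of any valences and each with at least one vertex, where in addition every edge of $\Gamma_2$ is attached as a hair to one vertex of $\Gamma_1$ and every edge of $\Gamma_1$ is attached as a hair to one vertex of $\Gamma_2$. The pair is required to be connected as a whole, when every edge is regarded as joining its two ends and the vertex carrying it as a hair. Relabellings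 of $\Gamma_1$ act by the signs of $\mathbf{GC}_c$ and those of $\Gamma_2$ by the signs of $\mathbf{GC}_d$, and the degree is $|\Gamma_1|+|\Gamma_2|$ with the degrees of $\mathbf{GC}_c$ and $\mathbf{GC}_d$. Put $\delta=\delta'+(-1)^{|\Gamma_1|}\delta''$, where $\delta'$ is the sum over $v\in V(\Gamma_1)$ and $w\in V(\Gamma_2)$ of all splittings of $v$ (with all reattachments of its half-edges and hairs to the two new vertices) minus the terms attaching a univalent vertex without hairs to $v$, taken twice, where in each case the new edge is attached as a hair to $w$; $\delta''$ is the same with the roles of $\Gamma_1,\Gamma_2$ exchanged. Let $\mathbf{GC}^1_{c,d}$ be the $\delta$-stable subspace spanned by the pairs with at least one univalent vertex (hairs do not count towards the valence), and let $\mathbf{GC}^{\ge2}_{c,d}=\mathbf{fcGC}_{c,d}/\mathbf{GC}^1_{c,d}$ with the induced differential. **Proposition.** $\mathbf{GC}_c$, $\mathbf{GC}_d$ and $\mathbf{GC}^{\ge2}_{c,d}$ are cochain complexes, and the sum over all hair attachments $$\mathbf{Sym}\colon \mathbf{GC}_c\otimes\mathbf{GC}_d\longrightarrow\mathbf{GC}^{\ge2}_{c,d},\qquad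 \Gamma_1\otimes\Gamma_2\longmapsto\sum_{\substack{f_1\colon E(\Gamma_2)\to V(\Gamma_1)\\ f_2\colon E(\Gamma_1)\to V(\Gamma_2)}}(\Gamma_1^{f_1},\Gamma_2^{f_2}),$$ where $\Gamma_i^{f_i}$ is $\Gamma_i$ with the hairs attached according to $f_i$, is an injective map of cochain complexes of degree zero. Its image is a direct summand: there is a subcomplex $C$ with $\mathbf{GC}^{\ge2}_{c,d}=\mathbf{Sym}(\mathbf{GC}_c\otimes\mathbf{GC}_d)\oplus C$. In particular $\mathbf{Sym}$ induces an injection $$H(\mathbf{GC}_c)\otimes H(\mathbf{GC}_d)\longrightarrow H(\mathbf{GC}^{\ge2}_{c,d}).$$ -/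

import Mathlib

/-!
Graph complexes.

Graphs have vertex set `Fin v` and edge set `Fin e`; every edge has a direction.  Multiple edges and
tadpoles are allowed.  Graph complexes are built from the spaces of coinvariants of such labelled
graphs under renumbering of vertices, renumbering of edges and flipping of edges, twisted by signs.
-/

open scoped TensorProduct DirectSum

noncomputable section

namespace GraphCplx

/-! ### Coinvariants and linear maps given by equivariant matrices -/

section Coinvariants

variable (K : Type*) [Field K] {X Y R S : Type}

/-- The relations `r • x = s(r) x`, for a family `act` of relabellings with signs `s`. -/
def relations (act : R → X → X) (s : R → ℤˣ) : Submodule K (X →₀ K) :=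
  Submodule.span K {z | ∃ (r : R) (x : X),
    z = Finsupp.single (act r x) 1 - (((s r : ℤˣ) : ℤ) : K) • Finsupp.single x 1}

/-- The linear map `x ↦ ∑ y, w x y • y` on free vector spaces. -/
def matMap [Fintype Y] (w : X → Y → ℤ) : (X →₀ K) →ₗ[K] (Y →₀ K) :=
  Finsupp.linearCombination K fun x => ∑ y, (w x y : K) • Finsupp.single y (1 : K)

theorem matMap_single [Fintype Y] (w : X → Y → ℤ) (x : X) :
    matMap K w (Finsupp.single x 1) = ∑ y, (w x y : K) • Finsupp.single y (1 : K) := by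
  simp [matMap]

/-- A matrix that is invariant under relabellings descends to coinvariants. -/
theorem relations_le_comap [Fintype Y] {act : R → X → X} {s : R → ℤˣ}
    {act' : S → Y → Y} {s' : S → ℤˣ} (w : X → Y → ℤ)
    (h : ∀ r, ∃ r', s' r' = s r ∧ Function.Injective (act' r') ∧
      ∀ x y, w (act r x) (act' r' y) = w x y) :
    relations K act s ≤ (relations K act' s').comap (matMap K w) := by
  unfold relations
  rw [Submodule.span_le]
  rintro z ⟨r, x, rfl⟩
  obtain ⟨r', hs, hinj, hw⟩ := h r
  have hbij : Function.Bijective (act' r') := Finite.injective_iff_bijective.mp hinj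
  rw [SetLike.mem_coe, Submodule.mem_comap, map_sub, map_smul, matMap_single, matMap_single,
    ← (Equiv.ofBijective _ hbij).sum_comp, Finset.smul_sum, ← Finset.sum_sub_distrib]
  refine Submodule.sum_mem _ fun y _ => ?_
  have : (w (act r x) (Equiv.ofBijective _ hbij y) : K) •
        Finsupp.single (Equiv.ofBijective _ hbij y) (1 : K)
      - (((s r : ℤˣ) : ℤ) : K) • ((w x y : K) • Finsupp.single y (1 : K))
      = (w x y : K) • (Finsupp.single (act' r' y) 1
          - (((s' r' : ℤˣ) : ℤ) : K) • Finsupp.single y (1 : K)) := by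
    rw [Equiv.ofBijective_apply, hw, hs, smul_sub, smul_comm]
  rw [this]
  exact Submodule.smul_mem _ _ (Submodule.subset_span ⟨r', y, rfl⟩)

end Coinvariants

/-! ### Graphs and relabellings -/

/-- Graphs with vertices `Fin v` and edges `Fin e`: edge `i` runs from `(Γ i).1` to `(Γ i).2`. -/
abbrev Graph (v e : ℕ) : Type := Fin e → Fin v × Fin v

/-- The valence of a vertex: the number of half-edges at it (hairs are never counted). -/
def valence {v e : ℕ} (Γ : Graph v e) (x : Fin v) : ℕ :=
  ∑ i, ((if (Γ i).1 = x then 1 else 0) + (if (Γ i).2 = x then 1 else 0))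

/-- Connectedness (in particular there is at least one vertex). -/
def IsConn {v e : ℕ} (Γ : Graph v e) : Prop :=
  (SimpleGraph.fromRel fun a b => ∃ i, Γ i = (a, b)).Connected

/-- A renumbering of the vertices, a renumbering of the edges and a set of edges to be flipped. -/
structure Relabel (v e : ℕ) : Type where
  vert : Equiv.Perm (Fin v)
  edge : Equiv.Perm (Fin e)
  flip : Fin e → Bool

/-- Swap the two ends of an edge if `b` is true. -/
def flipIf {α : Type} (b : Bool) (p : α × α) : α × α := if b then p.swap else p

def relabel {v e : ℕ} (r : Relabel v e) (Γ : Graph v e) : Graph v e :=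
  fun i => flipIf (r.flip i) (Prod.map r.vert r.vert (Γ (r.edge i)))

/-- The sign of a relabelling.  For even `d` edges are odd, vertices are even, and flips act
trivially; for odd `d` edges are even, vertices are odd, and a flip acts by `-1`. -/
def relabelSign (d : ℤ) {v e : ℕ} (r : Relabel v e) : ℤˣ :=
  open Classical in
  if Even d then Equiv.Perm.sign r.edge
  else Equiv.Perm.sign r.vert * ∏ i, if r.flip i then -1 else 1

/-! ### Splitting a vertex

Splitting the vertex `u` of a graph with vertices `Fin v` and edges `Fin e` creates a new vertex
`Fin.last v` and a new edge `Fin.last e` from `u` to the new vertex; each half-edge (and each hair)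
at `u` is attached to `u` or to the new vertex.  With the new vertex and the new edge put last, all
signs are `+1`. -/

/-- The map that merges the new vertex into `u`. -/
def collapse {v : ℕ} (u : Fin v) (x : Fin (v + 1)) : Fin v :=
  Fin.lastCases (motive := fun _ => Fin v) u id x

/-- `Γ'` is one of the graphs obtained from `Γ` by splitting `u`. -/
def SplitsAt {v e : ℕ} (u : Fin v) (Γ : Graph v e) (Γ' : Graph (v + 1) (e + 1)) : Prop :=
  Γ' (Fin.last e) = (u.castSucc, Fin.last v) ∧
    ∀ i : Fin e, Prod.map (collapse u) (collapse u) (Γ' i.castSucc) = Γ i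

/-! ### Invariance under relabellings -/

section Invariance

theorem ite_of_iff {p q : Prop} {i : Decidable p} {j : Decidable q} (h : p ↔ q) (a b : ℤ) :
    @ite ℤ p i a b = @ite ℤ q j a b := by
  by_cases hq : q
  · rw [if_pos hq, if_pos (h.2 hq)]
  · rw [if_neg hq, if_neg fun hp => hq (h.1 hp)]

theorem flipIf_injective {α : Type} (b : Bool) :
    Function.Injective (flipIf b : α × α → α × α) := by
  cases b
  · intro p q h; simpa [flipIf] using h
  · intro p q h; simpa [flipIf] using h

theorem flipIf_map {α β : Type} (b : Bool) (f : α → β) (p : α × α) :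
    Prod.map f f (flipIf b p) = flipIf b (Prod.map f f p) := by
  cases b <;> simp [flipIf, Prod.map, Prod.swap]

theorem relabel_injective {v e : ℕ} (r : Relabel v e) : Function.Injective (relabel r) := by
  intro Γ Γ' h
  funext i
  have := congrFun h (r.edge.symm i)
  simp only [relabel, Equiv.apply_symm_apply] at this
  exact (r.vert.injective.prodMap r.vert.injective) (flipIf_injective _ this)

theorem valence_relabel {v e : ℕ} (r : Relabel v e) (Γ : Graph v e) (x : Fin v) :
    valence (relabel r Γ) (r.vert x) = valence Γ x := by
  unfold valence
  rw [← Equiv.sum_comp r.edge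
    (fun i => ((if (Γ i).1 = x then 1 else 0) + (if (Γ i).2 = x then 1 else 0)))]
  refine Finset.sum_congr rfl fun i _ => ?_
  cases h : r.flip i <;> simp [relabel, flipIf, h, add_comm]

theorem forall_valence_relabel {v e : ℕ} (r : Relabel v e) (Γ : Graph v e) (p : ℕ → Prop) :
    (∀ x, p (valence (relabel r Γ) x)) ↔ ∀ x, p (valence Γ x) := by
  rw [← r.vert.forall_congr_right]
  simp [valence_relabel]

theorem isConn_relabel {v e : ℕ} (r : Relabel v e) (Γ : Graph v e) :
    IsConn (relabel r Γ) ↔ IsConn Γ := by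
  have key : ∀ a b, ((∃ i, relabel r Γ i = (r.vert a, r.vert b)) ∨
      (∃ i, relabel r Γ i = (r.vert b, r.vert a))) ↔
      ((∃ i, Γ i = (a, b)) ∨ (∃ i, Γ i = (b, a))) := by
    intro a b
    rw [← exists_or, ← exists_or, ← r.edge.exists_congr_right (q := fun i => Γ i = (a, b) ∨ Γ i = (b, a))]
    refine exists_congr fun i => ?_
    rcases hp : Γ (r.edge i) with ⟨p, q⟩
    cases h : r.flip i <;> (simp [relabel, flipIf, h, hp]; try tauto)
  refine (SimpleGraph.Iso.connected_iff (?_ : _ ≃g _)).symm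
  refine ⟨r.vert, ?_⟩
  intro a b
  simp only [SimpleGraph.fromRel_adj, ne_eq, EmbeddingLike.apply_eq_iff_eq, key]

/-- Extend a permutation by fixing the last element. -/
def extPerm {n : ℕ} (σ : Equiv.Perm (Fin n)) : Equiv.Perm (Fin (n + 1)) :=
  (finSuccEquivLast.symm).permCongr σ.optionCongr

@[simp] theorem extPerm_last {n : ℕ} (σ : Equiv.Perm (Fin n)) :
    extPerm σ (Fin.last n) = Fin.last n := by
  simp [extPerm, Equiv.permCongr_apply]

@[simp] theorem extPerm_castSucc {n : ℕ} (σ : Equiv.Perm (Fin n)) (i : Fin n) :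
    extPerm σ i.castSucc = (σ i).castSucc := by
  simp [extPerm, Equiv.permCongr_apply]

theorem sign_extPerm {n : ℕ} (σ : Equiv.Perm (Fin n)) :
    Equiv.Perm.sign (extPerm σ) = Equiv.Perm.sign σ := by
  simp [extPerm]

/-- Extend a relabelling by fixing the new vertex and the new edge. -/
def extRelabel {v e : ℕ} (r : Relabel v e) : Relabel (v + 1) (e + 1) where
  vert := extPerm r.vert
  edge := extPerm r.edge
  flip := Fin.snoc (α := fun _ => Bool) r.flip false

theorem relabelSign_ext (d : ℤ) {v e : ℕ} (r : Relabel v e) :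
    relabelSign d (extRelabel r) = relabelSign d r := by
  simp [relabelSign, extRelabel, sign_extPerm, Fin.prod_univ_castSucc]

@[simp] theorem collapse_last {v : ℕ} (u : Fin v) : collapse u (Fin.last v) = u := by
  simp [collapse]

@[simp] theorem collapse_castSucc {v : ℕ} (u x : Fin v) : collapse u x.castSucc = x := by
  simp [collapse]

theorem collapse_ext {v : ℕ} (σ : Equiv.Perm (Fin v)) (u : Fin v) (x : Fin (v + 1)) :
    collapse (σ u) (extPerm σ x) = σ (collapse u x) := by
  induction x using Fin.lastCases <;> simp

@[simp] theorem relabel_ext_last {v e : ℕ} (r : Relabel v e) (Γ : Graph (v + 1) (e + 1)) :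
    relabel (extRelabel r) Γ (Fin.last e)
      = Prod.map (extPerm r.vert) (extPerm r.vert) (Γ (Fin.last e)) := by
  simp [relabel, extRelabel, flipIf]

@[simp] theorem relabel_ext_castSucc {v e : ℕ} (r : Relabel v e) (Γ : Graph (v + 1) (e + 1))
    (i : Fin e) :
    relabel (extRelabel r) Γ i.castSucc
      = flipIf (r.flip i) (Prod.map (extPerm r.vert) (extPerm r.vert)
          (Γ (r.edge i).castSucc)) := by
  simp [relabel, extRelabel]

theorem newEdge_ext {v e : ℕ} (r : Relabel v e) (u : Fin v) (Γ' : Graph (v + 1) (e + 1)) :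
    relabel (extRelabel r) Γ' (Fin.last e) = ((r.vert u).castSucc, Fin.last v) ↔
      Γ' (Fin.last e) = (u.castSucc, Fin.last v) := by
  rw [relabel_ext_last, ← extPerm_castSucc]
  conv_lhs => rhs; rw [← extPerm_last r.vert]
  rw [← Prod.map_apply (extPerm r.vert) (extPerm r.vert)]
  exact ((extPerm r.vert).injective.prodMap (extPerm r.vert).injective).eq_iff

theorem splitsAt_relabel {v e : ℕ} (r : Relabel v e) (u : Fin v) (Γ : Graph v e)
    (Γ' : Graph (v + 1) (e + 1)) :
    SplitsAt (r.vert u) (relabel r Γ) (relabel (extRelabel r) Γ') ↔ SplitsAt u Γ Γ' := by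
  unfold SplitsAt
  rw [newEdge_ext]
  refine and_congr Iff.rfl ?_
  rw [← r.edge.forall_congr_right (q := fun i =>
    Prod.map (collapse u) (collapse u) (Γ' i.castSucc) = Γ i)]
  refine forall_congr' fun i => ?_
  rw [relabel_ext_castSucc, flipIf_map, relabel, (flipIf_injective _).eq_iff, Prod.map_map]
  have : collapse (r.vert u) ∘ extPerm r.vert = r.vert ∘ collapse u := by
    funext x; exact collapse_ext _ _ _
  rw [this, ← Prod.map_map,
    (r.vert.injective.prodMap r.vert.injective).eq_iff]

end Invariance

/-! ### The graph complex `GC_d` -/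

/-- The degree of a graph: `d` for every vertex but one, `1 - d` for every edge. -/
def deg (d : ℤ) (v e : ℕ) : ℤ := d * ((v : ℤ) - 1) - (d - 1) * (e : ℤ)

/-- Connected graphs all of whose vertices are at least bivalent. -/
def GCGen (v e : ℕ) : Type := {Γ : Graph v e // IsConn Γ ∧ ∀ x, 2 ≤ valence Γ x}

instance (v e : ℕ) : Fintype (GCGen v e) :=
  haveI : Finite (GCGen v e) := Subtype.finite
  Fintype.ofFinite _

def gcAct {v e : ℕ} (r : Relabel v e) (Γ : GCGen v e) : GCGen v e :=
  ⟨relabel r Γ.1, (isConn_relabel r Γ.1).2 Γ.2.1,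
    (forall_valence_relabel r Γ.1 fun n => 2 ≤ n).2 Γ.2.2⟩

theorem gcAct_injective {v e : ℕ} (r : Relabel v e) :
    Function.Injective (gcAct r : GCGen v e → GCGen v e) :=
  fun _ _ h => Subtype.ext (relabel_injective r (congrArg Subtype.val h))

/-- The part of `GC_d` spanned by graphs with `v` vertices and `e` edges: coinvariants of labelled
graphs. -/
abbrev GCComp (K : Type*) [Field K] (d : ℤ) (v e : ℕ) : Type _ :=
  (GCGen v e →₀ K) ⧸ relations K (gcAct (v := v) (e := e)) (relabelSign d)

/-- The graph complex `GC_d`, as the product over all numbers of vertices and edges. -/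
def GC (K : Type*) [Field K] (d : ℤ) : Type _ := (v e : ℕ) → GCComp K d v e

instance (K : Type*) [Field K] (d : ℤ) : AddCommGroup (GC K d) :=
  inferInstanceAs (AddCommGroup ((v e : ℕ) → GCComp K d v e))

instance (K : Type*) [Field K] (d : ℤ) : Module K (GC K d) :=
  inferInstanceAs (Module K ((v e : ℕ) → GCComp K d v e))

theorem GC.add_apply {K : Type*} [Field K] {d : ℤ} (x y : GC K d) (v e : ℕ) :
    (x + y) v e = x v e + y v e := rfl

theorem GC.smul_apply {K : Type*} [Field K] {d : ℤ} (a : K) (x : GC K d) (v e : ℕ) :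
    (a • x) v e = a • x v e := rfl

/-- The coefficient of `Γ'` in the differential of `Γ`: the differential is the sum over all
splittings of all vertices that create no univalent vertex. -/
def gcCoeff {v e : ℕ} (Γ : GCGen v e) (Γ' : GCGen (v + 1) (e + 1)) : ℤ :=
  open Classical in if ∃ u, SplitsAt u Γ.1 Γ'.1 then 1 else 0

theorem exists_splitsAt_relabel {v e : ℕ} (r : Relabel v e) (Γ : Graph v e)
    (Γ' : Graph (v + 1) (e + 1)) :
    (∃ u, SplitsAt u (relabel r Γ) (relabel (extRelabel r) Γ')) ↔ ∃ u, SplitsAt u Γ Γ' := by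
  rw [← r.vert.exists_congr_right]
  exact exists_congr fun u => splitsAt_relabel r u Γ Γ'

/-- The differential on graphs with `v` vertices and `e` edges. -/
def gcDComp (K : Type*) [Field K] (d : ℤ) (v e : ℕ) :
    GCComp K d v e →ₗ[K] GCComp K d (v + 1) (e + 1) :=
  Submodule.mapQ _ _ (matMap K gcCoeff) <|
    relations_le_comap K _ fun r => ⟨extRelabel r, relabelSign_ext d r, gcAct_injective _,
      fun Γ Γ' => by
        have := exists_splitsAt_relabel r Γ.1 Γ'.1
        unfold gcCoeff
        exact ite_of_iff this _ _⟩

/-- The differential of `GC_d`. -/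
def gcD (K : Type*) [Field K] (d : ℤ) : GC K d →ₗ[K] GC K d where
  toFun x := fun v e => match v, e with
    | v + 1, e + 1 => gcDComp K d v e (x v e)
    | 0, _ => 0
    | _ + 1, 0 => 0
  map_add' x y := by
    funext v e
    rcases v with _ | v
    · exact (add_zero _).symm
    rcases e with _ | e
    · exact (add_zero _).symm
    exact map_add _ _ _
  map_smul' a x := by
    funext v e
    rcases v with _ | v
    · exact (smul_zero a).symm
    rcases e with _ | e
    · exact (smul_zero a).symm
    exact map_smul (gcDComp K d v e) a _

/-- The homogeneous part of degree `n` of `GC_d`. -/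
def gcDeg (K : Type*) [Field K] (d n : ℤ) : Submodule K (GC K d) where
  carrier := {x | ∀ v e, deg d v e ≠ n → x v e = 0}
  zero_mem' := fun _ _ _ => rfl
  add_mem' := fun hx hy v e h => by simp [GC.add_apply, hx v e h, hy v e h]
  smul_mem' := fun a x hx v e h => by simp [GC.smul_apply, hx v e h]

/-! ### Entangled graphs -/

/-- Graphs with vertices `Fin v`, edges `Fin e` and hairs `Fin k`; hair `j` is at `G.2 j`. -/
abbrev Hairy (v e k : ℕ) : Type := Graph v e × (Fin k → Fin v)

/-- Pairs `(Γ₁, Γ₂)` of hairy graphs, where the hairs of `Γ₁` are labelled by the edges of `Γ₂` and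
the hairs of `Γ₂` are labelled by the edges of `Γ₁`. -/
abbrev Ent (v₁ e₁ v₂ e₂ : ℕ) : Type := Hairy v₁ e₁ e₂ × Hairy v₂ e₂ e₁

section Ent

variable {v₁ e₁ v₂ e₂ : ℕ}

/-- The vertices that an edge of `Γ₁` meets: its two ends in `Γ₁` and the vertex of `Γ₂` at which
the hair labelled by it sits. -/
def star₁ (P : Ent v₁ e₁ v₂ e₂) (i : Fin e₁) : Set (Fin v₁ ⊕ Fin v₂) :=
  {Sum.inl (P.1.1 i).1, Sum.inl (P.1.1 i).2, Sum.inr (P.2.2 i)}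

/-- The vertices that an edge of `Γ₂` meets. -/
def star₂ (P : Ent v₁ e₁ v₂ e₂) (j : Fin e₂) : Set (Fin v₁ ⊕ Fin v₂) :=
  {Sum.inr (P.2.1 j).1, Sum.inr (P.2.1 j).2, Sum.inl (P.1.2 j)}

/-- The pair is connected as a whole, and both graphs have at least one vertex.  The two graphs
need not be connected separately. -/
def EntConn (P : Ent v₁ e₁ v₂ e₂) : Prop :=
  0 < v₁ ∧ 0 < v₂ ∧
    (SimpleGraph.fromRel fun a b : Fin v₁ ⊕ Fin v₂ =>
      (∃ i, a ∈ star₁ P i ∧ b ∈ star₁ P i) ∨ ∃ j, a ∈ star₂ P j ∧ b ∈ star₂ P j).Connected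

/-- Some vertex of `Γ₁` or of `Γ₂` is univalent (hairs do not count). -/
def HasUnivalent (P : Ent v₁ e₁ v₂ e₂) : Prop :=
  (∃ x, valence P.1.1 x = 1) ∨ ∃ y, valence P.2.1 y = 1

/-- Relabellings of the two graphs; the hairs follow the edges that label them. -/
def relabelEnt (r : Relabel v₁ e₁ × Relabel v₂ e₂) (P : Ent v₁ e₁ v₂ e₂) : Ent v₁ e₁ v₂ e₂ :=
  ((relabel r.1 P.1.1, fun j => r.1.vert (P.1.2 (r.2.edge j))),
    (relabel r.2 P.2.1, fun i => r.2.vert (P.2.2 (r.1.edge i))))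

def entSign (c d : ℤ) (r : Relabel v₁ e₁ × Relabel v₂ e₂) : ℤˣ :=
  relabelSign c r.1 * relabelSign d r.2

theorem relabelEnt_injective (r : Relabel v₁ e₁ × Relabel v₂ e₂) :
    Function.Injective (relabelEnt r : Ent v₁ e₁ v₂ e₂ → Ent v₁ e₁ v₂ e₂) := by
  rintro ⟨⟨Γ₁, h₁⟩, Γ₂, h₂⟩ ⟨⟨Γ₁', h₁'⟩, Γ₂', h₂'⟩ h
  simp only [relabelEnt, Prod.mk.injEq] at h
  obtain ⟨⟨a, b⟩, a', b'⟩ := h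
  have hb : h₁ = h₁' := by
    funext j
    simpa using congrFun b (r.2.edge.symm j)
  have hb' : h₂ = h₂' := by
    funext j
    simpa using congrFun b' (r.1.edge.symm j)
  rw [relabel_injective _ a, relabel_injective _ a', hb, hb']

theorem star₁_relabelEnt (r : Relabel v₁ e₁ × Relabel v₂ e₂) (P : Ent v₁ e₁ v₂ e₂) (i : Fin e₁)
    (a : Fin v₁ ⊕ Fin v₂) :
    Equiv.sumCongr r.1.vert r.2.vert a ∈ star₁ (relabelEnt r P) i ↔
      a ∈ star₁ P (r.1.edge i) := by
  rcases a with a | a <;> cases h : r.1.flip i <;>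
    simp [star₁, relabelEnt, relabel, flipIf, h, or_comm]

theorem star₂_relabelEnt (r : Relabel v₁ e₁ × Relabel v₂ e₂) (P : Ent v₁ e₁ v₂ e₂) (j : Fin e₂)
    (a : Fin v₁ ⊕ Fin v₂) :
    Equiv.sumCongr r.1.vert r.2.vert a ∈ star₂ (relabelEnt r P) j ↔
      a ∈ star₂ P (r.2.edge j) := by
  rcases a with a | a <;> cases h : r.2.flip j <;>
    simp [star₂, relabelEnt, relabel, flipIf, h, or_comm]

theorem entConn_relabel (r : Relabel v₁ e₁ × Relabel v₂ e₂) (P : Ent v₁ e₁ v₂ e₂) :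
    EntConn (relabelEnt r P) ↔ EntConn P := by
  refine and_congr Iff.rfl (and_congr Iff.rfl ?_)
  have key₁ : ∀ a b, (∃ i, Equiv.sumCongr r.1.vert r.2.vert a ∈ star₁ (relabelEnt r P) i ∧
      Equiv.sumCongr r.1.vert r.2.vert b ∈ star₁ (relabelEnt r P) i) ↔
      ∃ i, a ∈ star₁ P i ∧ b ∈ star₁ P i := by
    intro a b
    simp only [star₁_relabelEnt]
    exact r.1.edge.exists_congr_right (q := fun i => a ∈ star₁ P i ∧ b ∈ star₁ P i)
  have key₂ : ∀ a b, (∃ i, Equiv.sumCongr r.1.vert r.2.vert a ∈ star₂ (relabelEnt r P) i ∧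
      Equiv.sumCongr r.1.vert r.2.vert b ∈ star₂ (relabelEnt r P) i) ↔
      ∃ i, a ∈ star₂ P i ∧ b ∈ star₂ P i := by
    intro a b
    simp only [star₂_relabelEnt]
    exact r.2.edge.exists_congr_right (q := fun i => a ∈ star₂ P i ∧ b ∈ star₂ P i)
  refine (SimpleGraph.Iso.connected_iff (?_ : _ ≃g _)).symm
  refine ⟨Equiv.sumCongr r.1.vert r.2.vert, ?_⟩
  intro a b
  simp only [SimpleGraph.fromRel_adj, ne_eq, EmbeddingLike.apply_eq_iff_eq, key₁, key₂]

end Ent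

/-- Connected pairs of entangled graphs. -/
def EntGen (v₁ e₁ v₂ e₂ : ℕ) : Type := {P : Ent v₁ e₁ v₂ e₂ // EntConn P}

instance (v₁ e₁ v₂ e₂ : ℕ) : Fintype (EntGen v₁ e₁ v₂ e₂) :=
  haveI : Finite (EntGen v₁ e₁ v₂ e₂) := Subtype.finite
  Fintype.ofFinite _

def entAct {v₁ e₁ v₂ e₂ : ℕ} (r : Relabel v₁ e₁ × Relabel v₂ e₂) (P : EntGen v₁ e₁ v₂ e₂) :
    EntGen v₁ e₁ v₂ e₂ :=
  ⟨relabelEnt r P.1, (entConn_relabel r P.1).2 P.2⟩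

theorem entAct_injective {v₁ e₁ v₂ e₂ : ℕ} (r : Relabel v₁ e₁ × Relabel v₂ e₂) :
    Function.Injective (entAct r : EntGen v₁ e₁ v₂ e₂ → EntGen v₁ e₁ v₂ e₂) :=
  fun _ _ h => Subtype.ext (relabelEnt_injective r (congrArg Subtype.val h))

/-- The part of `fcGC_{c,d}` spanned by pairs with given numbers of vertices and edges. -/
abbrev FcGCComp (K : Type*) [Field K] (c d : ℤ) (v₁ e₁ v₂ e₂ : ℕ) : Type _ :=
  (EntGen v₁ e₁ v₂ e₂ →₀ K) ⧸
    relations K (entAct (v₁ := v₁) (e₁ := e₁) (v₂ := v₂) (e₂ := e₂)) (entSign c d)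

/-- The space `fcGC_{c,d}` of entangled graphs, as the product over all numbers of vertices and
edges. -/
def FcGC (K : Type*) [Field K] (c d : ℤ) : Type _ :=
  (v₁ e₁ v₂ e₂ : ℕ) → FcGCComp K c d v₁ e₁ v₂ e₂

instance (K : Type*) [Field K] (c d : ℤ) : AddCommGroup (FcGC K c d) :=
  inferInstanceAs (AddCommGroup ((v₁ e₁ v₂ e₂ : ℕ) → FcGCComp K c d v₁ e₁ v₂ e₂))

instance (K : Type*) [Field K] (c d : ℤ) : Module K (FcGC K c d) :=
  inferInstanceAs (Module K ((v₁ e₁ v₂ e₂ : ℕ) → FcGCComp K c d v₁ e₁ v₂ e₂))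

theorem FcGC.add_apply {K : Type*} [Field K] {c d : ℤ} (x y : FcGC K c d) (v₁ e₁ v₂ e₂ : ℕ) :
    (x + y) v₁ e₁ v₂ e₂ = x v₁ e₁ v₂ e₂ + y v₁ e₁ v₂ e₂ := rfl

theorem FcGC.smul_apply {K : Type*} [Field K] {c d : ℤ} (a : K) (x : FcGC K c d)
    (v₁ e₁ v₂ e₂ : ℕ) : (a • x) v₁ e₁ v₂ e₂ = a • x v₁ e₁ v₂ e₂ := rfl

/-! ### The differential on entangled graphs -/

/-- `G'` is obtained from the hairy graph `G` by splitting `u`, where the half-edges and the hairs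
at `u` are distributed over `u` and the new vertex. -/
def HairySplitsAt {v e k : ℕ} (u : Fin v) (G : Hairy v e k) (G' : Hairy (v + 1) (e + 1) k) : Prop :=
  SplitsAt u G.1 G'.1 ∧ ∀ j, collapse u (G'.2 j) = G.2 j

/-- `G'` is obtained from the hairy graph `G` by attaching a univalent vertex without hairs to `u`. -/
def AttachesAt {v e k : ℕ} (u : Fin v) (G : Hairy v e k) (G' : Hairy (v + 1) (e + 1) k) : Prop :=
  G'.1 (Fin.last e) = (u.castSucc, Fin.last v) ∧
    (∀ i : Fin e, G'.1 i.castSucc = Prod.map Fin.castSucc Fin.castSucc (G.1 i)) ∧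
    ∀ j, G'.2 j = (G.2 j).castSucc

/-- `G'` is obtained from `G` by attaching one more hair to some vertex. -/
def AddsHair {v e k : ℕ} (G : Hairy v e k) (G' : Hairy v e (k + 1)) : Prop :=
  G'.1 = G.1 ∧ ∀ j : Fin k, G'.2 j.castSucc = G.2 j

/-- The coefficient of `P'` in `δ' P`.  Here `δ' P` is the sum, over all vertices of `Γ₁` and all
vertices of `Γ₂`, of all splittings of the former with the hair labelled by the new edge attached to
the latter, minus the terms in which a univalent vertex without hairs is attached.  The latter occur
twice, once for each end of the new edge. -/
def entCoeff₁ {v₁ e₁ v₂ e₂ : ℕ} (P : Ent v₁ e₁ v₂ e₂) (P' : Ent (v₁ + 1) (e₁ + 1) v₂ e₂) : ℤ :=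
  open Classical in
  (if (∃ u, HairySplitsAt u P.1 P'.1) ∧ AddsHair P.2 P'.2 then 1 else 0)
    - 2 * (if (∃ u, AttachesAt u P.1 P'.1) ∧ AddsHair P.2 P'.2 then 1 else 0)

/-- The coefficient of `P'` in `δ'' P`, where the roles of `Γ₁` and `Γ₂` are exchanged. -/
def entCoeff₂ {v₁ e₁ v₂ e₂ : ℕ} (P : Ent v₁ e₁ v₂ e₂) (P' : Ent v₁ e₁ (v₂ + 1) (e₂ + 1)) : ℤ :=
  entCoeff₁ P.swap P'.swap

section DiffInvariance

variable {v₁ e₁ v₂ e₂ : ℕ}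

theorem exists_hairySplitsAt_relabel (r : Relabel v₁ e₁) (τ : Equiv.Perm (Fin e₂))
    (G : Hairy v₁ e₁ e₂) (G' : Hairy (v₁ + 1) (e₁ + 1) e₂) :
    (∃ u, HairySplitsAt u (relabel r G.1, fun j => r.vert (G.2 (τ j)))
      (relabel (extRelabel r) G'.1, fun j => (extRelabel r).vert (G'.2 (τ j)))) ↔
    ∃ u, HairySplitsAt u G G' := by
  rw [← r.vert.exists_congr_right]
  refine exists_congr fun u => and_congr (splitsAt_relabel r u _ _) ?_
  simp only [extRelabel, collapse_ext, EmbeddingLike.apply_eq_iff_eq]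
  exact τ.forall_congr_right (q := fun j => collapse u (G'.2 j) = G.2 j)

theorem exists_attachesAt_relabel (r : Relabel v₁ e₁) (τ : Equiv.Perm (Fin e₂))
    (G : Hairy v₁ e₁ e₂) (G' : Hairy (v₁ + 1) (e₁ + 1) e₂) :
    (∃ u, AttachesAt u (relabel r G.1, fun j => r.vert (G.2 (τ j)))
      (relabel (extRelabel r) G'.1, fun j => (extRelabel r).vert (G'.2 (τ j)))) ↔
    ∃ u, AttachesAt u G G' := by
  rw [← r.vert.exists_congr_right]
  refine exists_congr fun u => and_congr (newEdge_ext r u _) (and_congr ?_ ?_)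
  · rw [← r.edge.forall_congr_right (q := fun i =>
      G'.1 i.castSucc = Prod.map Fin.castSucc Fin.castSucc (G.1 i))]
    refine forall_congr' fun i => ?_
    dsimp only
    have : Fin.castSucc ∘ r.vert = extPerm r.vert ∘ Fin.castSucc := by
      funext x; simp
    rw [relabel_ext_castSucc, relabel, flipIf_map, (flipIf_injective _).eq_iff, Prod.map_map, this,
      ← Prod.map_map,
      ((extPerm r.vert).injective.prodMap (extPerm r.vert).injective).eq_iff]
  · simp only [extRelabel, ← extPerm_castSucc, EmbeddingLike.apply_eq_iff_eq]
    exact τ.forall_congr_right (q := fun j => G'.2 j = (G.2 j).castSucc)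

theorem addsHair_relabel (r : Relabel v₂ e₂) (τ : Equiv.Perm (Fin e₁))
    (G : Hairy v₂ e₂ e₁) (G' : Hairy v₂ e₂ (e₁ + 1)) :
    AddsHair (relabel r G.1, fun i => r.vert (G.2 (τ i)))
      (relabel r G'.1, fun i => r.vert (G'.2 (extPerm τ i))) ↔ AddsHair G G' := by
  refine and_congr (relabel_injective r).eq_iff ?_
  simp only [extPerm_castSucc, EmbeddingLike.apply_eq_iff_eq]
  exact τ.forall_congr_right (q := fun j => G'.2 j.castSucc = G.2 j)

theorem entCoeff₁_relabel (r : Relabel v₁ e₁ × Relabel v₂ e₂) (P : Ent v₁ e₁ v₂ e₂)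
    (P' : Ent (v₁ + 1) (e₁ + 1) v₂ e₂) :
    entCoeff₁ (relabelEnt r P) (relabelEnt (extRelabel r.1, r.2) P') = entCoeff₁ P P' := by
  have h₁ := exists_hairySplitsAt_relabel r.1 r.2.edge P.1 P'.1
  have h₂ := exists_attachesAt_relabel r.1 r.2.edge P.1 P'.1
  have h₃ := addsHair_relabel r.2 r.1.edge P.2 P'.2
  unfold entCoeff₁
  exact congrArg₂ (fun a b : ℤ => a - 2 * b) (ite_of_iff (and_congr h₁ h₃) _ _)
    (ite_of_iff (and_congr h₂ h₃) _ _)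

theorem entCoeff₂_relabel (r : Relabel v₁ e₁ × Relabel v₂ e₂) (P : Ent v₁ e₁ v₂ e₂)
    (P' : Ent v₁ e₁ (v₂ + 1) (e₂ + 1)) :
    entCoeff₂ (relabelEnt r P) (relabelEnt (r.1, extRelabel r.2) P') = entCoeff₂ P P' :=
  entCoeff₁_relabel r.swap P.swap P'.swap

end DiffInvariance

def entDComp₁ (K : Type*) [Field K] (c d : ℤ) (v₁ e₁ v₂ e₂ : ℕ) :
    FcGCComp K c d v₁ e₁ v₂ e₂ →ₗ[K] FcGCComp K c d (v₁ + 1) (e₁ + 1) v₂ e₂ :=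
  Submodule.mapQ _ _ (matMap K fun P P' => entCoeff₁ P.1 P'.1) <|
    relations_le_comap K _ fun r => ⟨(extRelabel r.1, r.2), by simp [entSign, relabelSign_ext],
      entAct_injective _, fun P P' => entCoeff₁_relabel r P.1 P'.1⟩

def entDComp₂ (K : Type*) [Field K] (c d : ℤ) (v₁ e₁ v₂ e₂ : ℕ) :
    FcGCComp K c d v₁ e₁ v₂ e₂ →ₗ[K] FcGCComp K c d v₁ e₁ (v₂ + 1) (e₂ + 1) :=
  Submodule.mapQ _ _ (matMap K fun P P' => entCoeff₂ P.1 P'.1) <|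
    relations_le_comap K _ fun r => ⟨(r.1, extRelabel r.2), by simp [entSign, relabelSign_ext],
      entAct_injective _, fun P P' => entCoeff₂_relabel r P.1 P'.1⟩

/-- The part `δ'` of the differential. -/
def entD₁ (K : Type*) [Field K] (c d : ℤ) : FcGC K c d →ₗ[K] FcGC K c d where
  toFun x := fun v₁ e₁ v₂ e₂ => match v₁, e₁ with
    | v₁ + 1, e₁ + 1 => entDComp₁ K c d v₁ e₁ v₂ e₂ (x v₁ e₁ v₂ e₂)
    | 0, _ => 0
    | _ + 1, 0 => 0
  map_add' x y := by
    funext v₁ e₁ v₂ e₂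
    rcases v₁ with _ | v₁
    · exact (add_zero _).symm
    rcases e₁ with _ | e₁
    · exact (add_zero _).symm
    exact map_add _ _ _
  map_smul' a x := by
    funext v₁ e₁ v₂ e₂
    rcases v₁ with _ | v₁
    · exact (smul_zero a).symm
    rcases e₁ with _ | e₁
    · exact (smul_zero a).symm
    exact map_smul (entDComp₁ K c d v₁ e₁ v₂ e₂) a _

/-- The part `δ''` of the differential, with the sign `(-1)^{|Γ₁|}`. -/
def entD₂ (K : Type*) [Field K] (c d : ℤ) : FcGC K c d →ₗ[K] FcGC K c d where
  toFun x := fun v₁ e₁ v₂ e₂ => match v₂, e₂ with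
    | v₂ + 1, e₂ + 1 =>
        (((deg c v₁ e₁).negOnePow : ℤˣ) : ℤ) • entDComp₂ K c d v₁ e₁ v₂ e₂ (x v₁ e₁ v₂ e₂)
    | 0, _ => 0
    | _ + 1, 0 => 0
  map_add' x y := by
    funext v₁ e₁ v₂ e₂
    rcases v₂ with _ | v₂
    · exact (add_zero _).symm
    rcases e₂ with _ | e₂
    · exact (add_zero _).symm
    exact (congrArg (fun z => (((deg c v₁ e₁).negOnePow : ℤˣ) : ℤ) • z) (map_add _ _ _)).trans
      (smul_add _ _ _)
  map_smul' a x := by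
    funext v₁ e₁ v₂ e₂
    rcases v₂ with _ | v₂
    · exact (smul_zero a).symm
    rcases e₂ with _ | e₂
    · exact (smul_zero a).symm
    exact (congrArg (fun z => (((deg c v₁ e₁).negOnePow : ℤˣ) : ℤ) • z)
      (map_smul (entDComp₂ K c d v₁ e₁ v₂ e₂) a _)).trans (smul_comm _ a _)

/-- The differential of `fcGC_{c,d}`. -/
def fcGCD (K : Type*) [Field K] (c d : ℤ) : FcGC K c d →ₗ[K] FcGC K c d :=
  entD₁ K c d + entD₂ K c d

/-- The homogeneous part of degree `n` of `fcGC_{c,d}`; the degree of `(Γ₁, Γ₂)` is the sum of the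
degrees of `Γ₁` (in `GC_c`) and `Γ₂` (in `GC_d`). -/
def fcGCDeg (K : Type*) [Field K] (c d n : ℤ) : Submodule K (FcGC K c d) where
  carrier := {x | ∀ v₁ e₁ v₂ e₂, deg c v₁ e₁ + deg d v₂ e₂ ≠ n → x v₁ e₁ v₂ e₂ = 0}
  zero_mem' := fun _ _ _ _ _ => rfl
  add_mem' := fun hx hy v₁ e₁ v₂ e₂ h => by
    simp [FcGC.add_apply, hx v₁ e₁ v₂ e₂ h, hy v₁ e₁ v₂ e₂ h]
  smul_mem' := fun a x hx v₁ e₁ v₂ e₂ h => by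
    simp [FcGC.smul_apply, hx v₁ e₁ v₂ e₂ h]

/-! ### The subcomplex of pairs with a univalent vertex, and the quotient `GC^{≥2}_{c,d}` -/

/-- The span of the pairs with a univalent vertex, for given numbers of vertices and edges. -/
def univalentSpan (K : Type*) [Field K] (c d : ℤ) (v₁ e₁ v₂ e₂ : ℕ) :
    Submodule K (FcGCComp K c d v₁ e₁ v₂ e₂) :=
  Submodule.span K {z | ∃ P : EntGen v₁ e₁ v₂ e₂, HasUnivalent P.1 ∧
    z = Submodule.Quotient.mk (Finsupp.single P 1)}

/-- The subspace `GC^1_{c,d}` of `fcGC_{c,d}` spanned by pairs with at least one univalent vertex. It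
is stable under the differential (`GC1_le_comap`). -/
def GC1 (K : Type*) [Field K] (c d : ℤ) : Submodule K (FcGC K c d) where
  carrier := {x | ∀ v₁ e₁ v₂ e₂, x v₁ e₁ v₂ e₂ ∈ univalentSpan K c d v₁ e₁ v₂ e₂}
  zero_mem' := fun _ _ _ _ => Submodule.zero_mem _
  add_mem' := fun hx hy v₁ e₁ v₂ e₂ => Submodule.add_mem _ (hx v₁ e₁ v₂ e₂) (hy v₁ e₁ v₂ e₂)
  smul_mem' := fun a _ hx v₁ e₁ v₂ e₂ => Submodule.smul_mem _ a (hx v₁ e₁ v₂ e₂)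

theorem collapse_eq_iff {v : ℕ} {u x : Fin v} (h : x ≠ u) (y : Fin (v + 1)) :
    collapse u y = x ↔ y = x.castSucc := by
  induction y using Fin.lastCases with
  | last => simp [Ne.symm h, (Fin.castSucc_ne_last x).symm]
  | cast y => simp

theorem collapse_ite {v : ℕ} (u : Fin v) (y : Fin (v + 1)) :
    (if collapse u y = u then 1 else 0 : ℕ) =
      (if y = u.castSucc then 1 else 0) + (if y = Fin.last v then 1 else 0) := by
  induction y using Fin.lastCases with
  | last => simp [(Fin.castSucc_ne_last u).symm]
  | cast y => simp [Fin.castSucc_ne_last y]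

theorem univalent_of_splitsAt {v e : ℕ} {u : Fin v} {Γ : Graph v e} {Γ' : Graph (v + 1) (e + 1)}
    (h : SplitsAt u Γ Γ') (hx : ∃ x, valence Γ x = 1) : ∃ x, valence Γ' x = 1 := by
  obtain ⟨x, hx⟩ := hx
  obtain ⟨hl, hc⟩ := h
  by_cases hxu : x = u
  · subst hxu
    have h1 : valence Γ x + 2 = valence Γ' x.castSucc + valence Γ' (Fin.last v) := by
      unfold valence
      rw [Fin.sum_univ_castSucc, Fin.sum_univ_castSucc, hl]
      simp only [Fin.castSucc_ne_last, (Fin.castSucc_ne_last x).symm, if_true, if_false]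
      have : ∀ i, ((if (Γ i).1 = x then 1 else 0) + (if (Γ i).2 = x then 1 else 0) : ℕ) =
          ((if (Γ' i.castSucc).1 = x.castSucc then 1 else 0)
            + (if (Γ' i.castSucc).2 = x.castSucc then 1 else 0))
          + ((if (Γ' i.castSucc).1 = Fin.last v then 1 else 0)
            + (if (Γ' i.castSucc).2 = Fin.last v then 1 else 0)) := by
        intro i
        rw [← hc i, Prod.map_fst, Prod.map_snd, collapse_ite, collapse_ite]
        ring
      rw [Finset.sum_congr rfl fun i _ => this i, Finset.sum_add_distrib]
      ring
    have h2 : 1 ≤ valence Γ' x.castSucc := by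
      unfold valence
      rw [Fin.sum_univ_castSucc, hl]
      simp only [if_true]
      omega
    have h3 : 1 ≤ valence Γ' (Fin.last v) := by
      unfold valence
      rw [Fin.sum_univ_castSucc, hl]
      simp only [if_true]
      omega
    by_cases h4 : valence Γ' x.castSucc = 1
    · exact ⟨_, h4⟩
    · exact ⟨Fin.last v, by omega⟩
  · refine ⟨x.castSucc, ?_⟩
    refine Eq.trans ?_ hx
    unfold valence
    rw [Fin.sum_univ_castSucc, hl]
    have hxu' : u.castSucc ≠ x.castSucc := fun h => hxu (Fin.castSucc_injective _ h).symm
    simp only [hxu', (Fin.castSucc_ne_last x).symm, if_false, add_zero]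
    refine Finset.sum_congr rfl fun i _ => ?_
    rw [← hc i]
    simp only [Prod.map_fst, Prod.map_snd, collapse_eq_iff hxu]

theorem splits_of_attaches {v e k : ℕ} {u : Fin v} {G : Hairy v e k}
    {G' : Hairy (v + 1) (e + 1) k} (h : AttachesAt u G G') : HairySplitsAt u G G' := by
  refine ⟨⟨h.1, fun i => ?_⟩, fun j => ?_⟩
  · rw [h.2.1 i]; simp [Prod.map]
  · rw [h.2.2 j]; simp

theorem hasUnivalent_of_entCoeff₁ {v₁ e₁ v₂ e₂ : ℕ} {P : Ent v₁ e₁ v₂ e₂}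
    {P' : Ent (v₁ + 1) (e₁ + 1) v₂ e₂} (h : entCoeff₁ P P' ≠ 0) (hP : HasUnivalent P) :
    HasUnivalent P' := by
  have hs : (∃ u, HairySplitsAt u P.1 P'.1) ∧ AddsHair P.2 P'.2 := by
    by_contra hs
    have ha : ¬ ((∃ u, AttachesAt u P.1 P'.1) ∧ AddsHair P.2 P'.2) := fun ha =>
      hs ⟨ha.1.imp fun u hu => splits_of_attaches hu, ha.2⟩
    exact h (by simp [entCoeff₁, hs, ha])
  obtain ⟨⟨u, hu⟩, hh⟩ := hs
  rcases hP with hP | hP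
  · exact Or.inl (univalent_of_splitsAt hu.1 hP)
  · refine Or.inr ?_
    rwa [hh.1]

theorem hasUnivalent_swap {v₁ e₁ v₂ e₂ : ℕ} (P : Ent v₁ e₁ v₂ e₂) :
    HasUnivalent P.swap ↔ HasUnivalent P := or_comm

theorem entDComp₁_mem (K : Type*) [Field K] (c d : ℤ) (v₁ e₁ v₂ e₂ : ℕ) :
    univalentSpan K c d v₁ e₁ v₂ e₂ ≤
      (univalentSpan K c d (v₁ + 1) (e₁ + 1) v₂ e₂).comap (entDComp₁ K c d v₁ e₁ v₂ e₂) := by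
  conv_lhs => unfold univalentSpan
  rw [Submodule.span_le]
  rintro _ ⟨P, hP, rfl⟩
  rw [SetLike.mem_coe, Submodule.mem_comap, entDComp₁, Submodule.mapQ_apply, matMap_single,
    ← Submodule.mkQ_apply, map_sum]
  refine Submodule.sum_mem _ fun P' _ => ?_
  rw [map_smul]
  by_cases h : entCoeff₁ P.1 P'.1 = 0
  · simp [h]
  · exact Submodule.smul_mem _ _
      (Submodule.subset_span ⟨P', hasUnivalent_of_entCoeff₁ h hP, rfl⟩)

theorem entDComp₂_mem (K : Type*) [Field K] (c d : ℤ) (v₁ e₁ v₂ e₂ : ℕ) :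
    univalentSpan K c d v₁ e₁ v₂ e₂ ≤
      (univalentSpan K c d v₁ e₁ (v₂ + 1) (e₂ + 1)).comap (entDComp₂ K c d v₁ e₁ v₂ e₂) := by
  conv_lhs => unfold univalentSpan
  rw [Submodule.span_le]
  rintro _ ⟨P, hP, rfl⟩
  rw [SetLike.mem_coe, Submodule.mem_comap, entDComp₂, Submodule.mapQ_apply, matMap_single,
    ← Submodule.mkQ_apply, map_sum]
  refine Submodule.sum_mem _ fun P' _ => ?_
  rw [map_smul]
  by_cases h : entCoeff₂ P.1 P'.1 = 0
  · simp [h]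
  · exact Submodule.smul_mem _ _ (Submodule.subset_span
      ⟨P', (hasUnivalent_swap P'.1).1
        (hasUnivalent_of_entCoeff₁ h ((hasUnivalent_swap P.1).2 hP)), rfl⟩)

theorem GC1_le_comap (K : Type*) [Field K] (c d : ℤ) :
    GC1 K c d ≤ (GC1 K c d).comap (fcGCD K c d) := by
  intro x hx
  refine Submodule.add_mem (GC1 K c d) ?_ ?_
  · intro v₁ e₁ v₂ e₂
    rcases v₁ with _ | v₁
    · exact Submodule.zero_mem _
    rcases e₁ with _ | e₁
    · exact Submodule.zero_mem _
    exact entDComp₁_mem K c d v₁ e₁ v₂ e₂ (hx v₁ e₁ v₂ e₂)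
  · intro v₁ e₁ v₂ e₂
    rcases v₂ with _ | v₂
    · exact Submodule.zero_mem _
    rcases e₂ with _ | e₂
    · exact Submodule.zero_mem _
    exact zsmul_mem (K := univalentSpan K c d v₁ e₁ (v₂ + 1) (e₂ + 1)) (entDComp₂_mem K c d v₁ e₁ v₂ e₂ (hx v₁ e₁ v₂ e₂)) _

/-- The quotient `GC^{≥2}_{c,d} = fcGC_{c,d} / GC^1_{c,d}`. -/
abbrev GCge2 (K : Type*) [Field K] (c d : ℤ) : Type _ := FcGC K c d ⧸ GC1 K c d

/-- The induced differential on `GC^{≥2}_{c,d}`. -/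
def gcge2D (K : Type*) [Field K] (c d : ℤ) : GCge2 K c d →ₗ[K] GCge2 K c d :=
  Submodule.mapQ _ _ (fcGCD K c d) (GC1_le_comap K c d)

/-- The homogeneous part of degree `n` of `GC^{≥2}_{c,d}`. -/
def gcge2Deg (K : Type*) [Field K] (c d n : ℤ) : Submodule K (GCge2 K c d) :=
  (fcGCDeg K c d n).map (GC1 K c d).mkQ

/-! ### The map `Sym` -/

/-- The indicator of: `P` is the pair `(Γ₁, Γ₂)` with some attachment of hairs.  (A pair of graphs in
`GC_c` and `GC_d` has an edge and is connected for every attachment of hairs, so all attachments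
occur.) -/
def symCoeff {v₁ e₁ v₂ e₂ : ℕ} (Γ₁ : GCGen v₁ e₁) (Γ₂ : GCGen v₂ e₂) (P : EntGen v₁ e₁ v₂ e₂) : ℤ :=
  open Classical in if P.1.1.1 = Γ₁.1 ∧ P.1.2.1 = Γ₂.1 then 1 else 0

theorem symCoeff_relabel {v₁ e₁ v₂ e₂ : ℕ} (r : Relabel v₁ e₁ × Relabel v₂ e₂) (Γ₁ : GCGen v₁ e₁)
    (Γ₂ : GCGen v₂ e₂) (P : EntGen v₁ e₁ v₂ e₂) :
    symCoeff (gcAct r.1 Γ₁) (gcAct r.2 Γ₂) (entAct r P) = symCoeff Γ₁ Γ₂ P := by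
  unfold symCoeff
  simp only [gcAct, entAct, relabelEnt, (relabel_injective _).eq_iff]

/-- The relabelling that changes nothing. -/
def Relabel.id (v e : ℕ) : Relabel v e := ⟨1, 1, fun _ => false⟩

theorem gcAct_id {v e : ℕ} (Γ : GCGen v e) : gcAct (Relabel.id v e) Γ = Γ := by
  refine Subtype.ext (funext fun i => ?_)
  simp [gcAct, relabel, Relabel.id, flipIf, Prod.map]

theorem relabelSign_id (d : ℤ) (v e : ℕ) : relabelSign d (Relabel.id v e) = 1 := by
  simp [relabelSign, Relabel.id]

/-- `Γ₁ ⊗ Γ₂ ↦ ∑ (Γ₁ with hairs, Γ₂ with hairs)`, the sum over all attachments of the hairs, on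
labelled graphs. -/
def symFree (K : Type*) [Field K] (c d : ℤ) (v₁ e₁ v₂ e₂ : ℕ) :
    (GCGen v₁ e₁ →₀ K) →ₗ[K] (GCGen v₂ e₂ →₀ K) →ₗ[K] FcGCComp K c d v₁ e₁ v₂ e₂ :=
  (Finsupp.linearCombination K fun Γ₁ : GCGen v₁ e₁ =>
    matMap K (symCoeff (v₂ := v₂) (e₂ := e₂) Γ₁)).compr₂ (Submodule.mkQ _)

theorem symFree_left (K : Type*) [Field K] (c d : ℤ) (v₁ e₁ v₂ e₂ : ℕ) :
    relations K (gcAct (v := v₁) (e := e₁)) (relabelSign c) ≤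
      LinearMap.ker (symFree K c d v₁ e₁ v₂ e₂) := by
  intro z hz
  rw [LinearMap.mem_ker]
  refine Finsupp.lhom_ext' fun Γ₂ => LinearMap.ext_ring ?_
  have := relations_le_comap K (act := gcAct (v := v₁) (e := e₁)) (s := relabelSign c)
    (act' := entAct (v₁ := v₁) (e₁ := e₁) (v₂ := v₂) (e₂ := e₂)) (s' := entSign c d)
    (fun Γ₁ P => symCoeff Γ₁ Γ₂ P) (fun r => ⟨(r, Relabel.id v₂ e₂),
      by simp [entSign, relabelSign_id], entAct_injective _, fun Γ₁ P => by
        conv_lhs => rw [← gcAct_id Γ₂]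
        exact symCoeff_relabel (r, Relabel.id v₂ e₂) Γ₁ Γ₂ P⟩) hz
  have hz' : symFree K c d v₁ e₁ v₂ e₂ z (Finsupp.single Γ₂ 1) =
      Submodule.Quotient.mk (matMap K (fun Γ₁ P => symCoeff Γ₁ Γ₂ P) z) := by
    clear this hz
    induction z using Finsupp.induction_linear with
    | zero => simp
    | add f g hf hg => simp [hf, hg]
    | single Γ₁ a =>
      rw [← mul_one a, ← smul_eq_mul, ← Finsupp.smul_single, map_smul, map_smul, LinearMap.smul_apply]
      simp [symFree, matMap, ← Submodule.mkQ_apply, map_sum]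
  simpa [hz'] using this

theorem symFree_right (K : Type*) [Field K] (c d : ℤ) (v₁ e₁ v₂ e₂ : ℕ) (Γ₁ : GCGen v₁ e₁) :
    relations K (gcAct (v := v₂) (e := e₂)) (relabelSign d) ≤
      LinearMap.ker (symFree K c d v₁ e₁ v₂ e₂ (Finsupp.single Γ₁ 1)) := by
  intro z hz
  rw [LinearMap.mem_ker]
  have := relations_le_comap K (act := gcAct (v := v₂) (e := e₂)) (s := relabelSign d)
    (act' := entAct (v₁ := v₁) (e₁ := e₁) (v₂ := v₂) (e₂ := e₂)) (s' := entSign c d)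
    (fun Γ₂ P => symCoeff Γ₁ Γ₂ P) (fun r => ⟨(Relabel.id v₁ e₁, r),
      by simp [entSign, relabelSign_id], entAct_injective _, fun Γ₂ P => by
        conv_lhs => rw [← gcAct_id Γ₁]
        exact symCoeff_relabel (Relabel.id v₁ e₁, r) Γ₁ Γ₂ P⟩) hz
  simpa [symFree] using this

/-- The map `Sym` for given numbers of vertices and edges. -/
def symComp (K : Type*) [Field K] (c d : ℤ) (v₁ e₁ v₂ e₂ : ℕ) :
    GCComp K c v₁ e₁ →ₗ[K] GCComp K d v₂ e₂ →ₗ[K] FcGCComp K c d v₁ e₁ v₂ e₂ :=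
  (Submodule.liftQ _ ((Submodule.liftQ _ (symFree K c d v₁ e₁ v₂ e₂)
    (symFree_left K c d v₁ e₁ v₂ e₂)).flip) (by
      intro z hz
      rw [LinearMap.mem_ker]
      refine Submodule.linearMap_qext _ (Finsupp.lhom_ext' fun Γ₁ => LinearMap.ext_ring ?_)
      simpa using symFree_right K c d v₁ e₁ v₂ e₂ Γ₁ hz)).flip

/-- The bilinear map `Sym : GC_c × GC_d → GC^{≥2}_{c,d}`, the sum over all hair attachments. -/
def Sym (K : Type*) [Field K] (c d : ℤ) : GC K c →ₗ[K] GC K d →ₗ[K] GCge2 K c d :=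
  (LinearMap.mk₂ K (fun (x : GC K c) (y : GC K d) =>
      (fun v₁ e₁ v₂ e₂ => symComp K c d v₁ e₁ v₂ e₂ (x v₁ e₁) (y v₂ e₂) : FcGC K c d))
    (fun _ _ _ => by funext v₁ e₁ v₂ e₂; exact LinearMap.map_add₂ _ _ _ _)
    (fun _ _ _ => by funext v₁ e₁ v₂ e₂; exact LinearMap.map_smul₂ _ _ _ _)
    (fun _ _ _ => by funext v₁ e₁ v₂ e₂; exact map_add _ _ _)
    (fun _ _ _ => by funext v₁ e₁ v₂ e₂; exact map_smul (symComp K c d v₁ e₁ v₂ e₂ _) _ _)).compr₂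
    (GC1 K c d).mkQ

/-- The degree `n` part of the graded tensor product `GC_c ⊗ GC_d`. -/
abbrev TensorDeg (K : Type*) [Field K] (c d n : ℤ) : Type _ :=
  ⨁ i : ℤ, (gcDeg K c i ⊗[K] gcDeg K d (n - i))

/-- The map `Sym` on the degree `n` part of `GC_c ⊗ GC_d`. -/
def symDeg (K : Type*) [Field K] (c d n : ℤ) : TensorDeg K c d n →ₗ[K] GCge2 K c d :=
  DirectSum.toModule K ℤ _ fun i =>
    TensorProduct.lift ((Sym K c d).domRestrict₁₂ (gcDeg K c i) (gcDeg K d (n - i)))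

/-! ### Cohomology of a differential `δ` on a space with homogeneous parts `A n` -/

section Cohomology

variable {K M : Type*} [Field K] [AddCommGroup M] [Module K M]

/-- `δ` has degree one and squares to zero. -/
def IsCochainComplex (δ : M →ₗ[K] M) (A : ℤ → Submodule K M) : Prop :=
  (∀ n, ∀ x ∈ A n, δ x ∈ A (n + 1)) ∧ ∀ x, δ (δ x) = 0

def cocycles (δ : M →ₗ[K] M) (A : ℤ → Submodule K M) (n : ℤ) : Submodule K M :=
  A n ⊓ LinearMap.ker δ

def coboundaries (δ : M →ₗ[K] M) (A : ℤ → Submodule K M) (n : ℤ) : Submodule K M :=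
  (A (n - 1)).map δ

/-- The cohomology in degree `n`. -/
abbrev Cohomology (δ : M →ₗ[K] M) (A : ℤ → Submodule K M) (n : ℤ) : Type _ :=
  cocycles δ A n ⧸ (coboundaries δ A n).submoduleOf (cocycles δ A n)

/-- The class of a cocycle. -/
def cls (δ : M →ₗ[K] M) (A : ℤ → Submodule K M) (n : ℤ) :
    cocycles δ A n →ₗ[K] Cohomology δ A n :=
  Submodule.mkQ _

end Cohomology

end GraphCplx

end

open GraphCplx

/-! The proof works with functionals. A functional on a component of `FcGC` that kills the pairs
with a univalent vertex is the same as a function on labelled pairs that transforms by the signs and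
vanishes on such pairs (`AntiInv`, `NoUnivalent`, `evalFun`). Such functions do not see the
subtracted terms of the differential, so the transpose of the differential is the plain sum over
splittings, `dst`. That the differentials square to zero comes from a sign-reversing involution on
double splittings (`dst_dst`). That `Sym` is a chain map comes from the compatibility of `dst` with
summation over all hair attachments (`fiberSum_dst`).

The main point is that an element of the image of `Sym` that is a coboundary in `GC^{≥2}_{c,d}` is
already the image of a coboundary. Dually, if functionals `f` and `g` vanish on coboundaries, then
their product extends along `Sym` to a functional vanishing on coboundaries
(`exists_closed_functional`). In characteristic zero coinvariants and anti-invariant functions are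
identified by `orb`, and `dst` becomes twice the contraction of edges `bd` (`dst_orb`). The dual of
`Sym` forgets the hair attachments. Its kernel consists of differences of pairs with changed
attachments of the edges of `Γ₁` (`colorDiff`) or of `Γ₂` (`hairDiff`). The product of `f` and `g`
defines chains that are closed modulo these differences, and they can be corrected to closed ones
because the differences are acyclic.

Acyclicity comes from a homotopy `sd`: subdivide an edge of `Γ₁` by a bivalent vertex without hairs
and attach the hair of the new half to all vertices of `Γ₂` in turn. Contracting the new half gives
the pair back. Contracting the old half gives minus the pair with the hair of the subdivided edge
moved. Contractions of other edges anticommute with subdivision. Hence `bd ∘ sd + sd ∘ bd` is the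
sum over edges and vertices of twice (identity minus moving the hair), see `bd_sd_add_sd_bd`. An
averaging argument shows that this operator `lap` is invertible on the differences (`exists_lap_eq`,
`mem_of_lap_mem`). The correction runs through the double complex of `bd` and `bd₂` in two passes of
a staircase argument (`exists_lift`, `exists_closed`): one removes the error in `hairDiff`, the
other the error in `colorDiff`.

The rest is linear algebra. A homotopy on the tensor product turns the extension of functionals into
an explicit primitive (`eq_dT_hT`), and a subcomplex that meets the coboundaries only in its own
coboundaries has a complement (`exists_compl_subcomplex`). Injectivity of `Sym` and of the induced
map on cohomology follows because products of functionals separate tensors. -/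

noncomputable section

namespace GraphCplx

/-! ### The group of relabellings -/

section RelabelGroup

variable {v e : ℕ}

theorem Relabel.ext' {r s : Relabel v e} (h₁ : r.vert = s.vert) (h₂ : r.edge = s.edge)
    (h₃ : ∀ i, r.flip i = s.flip i) : r = s := by
  cases r; cases s
  simp only at h₁ h₂ h₃
  subst h₁ h₂
  rw [funext h₃]

/-- The edge permutations multiply in reverse order because `relabel` precomposes with them, and the
flips of the second factor are transported accordingly. With this product `relabel` is a left
action. -/
instance : Mul (Relabel v e) :=
  ⟨fun r s => ⟨r.vert * s.vert, s.edge * r.edge, fun i => xor (r.flip i) (s.flip (r.edge i))⟩⟩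

instance : One (Relabel v e) := ⟨Relabel.id v e⟩

instance : Inv (Relabel v e) :=
  ⟨fun r => ⟨r.vert⁻¹, r.edge⁻¹, fun i => r.flip (r.edge⁻¹ i)⟩⟩

@[simp] theorem Relabel.mul_vert (r s : Relabel v e) : (r * s).vert = r.vert * s.vert := rfl
@[simp] theorem Relabel.mul_edge (r s : Relabel v e) : (r * s).edge = s.edge * r.edge := rfl
@[simp] theorem Relabel.mul_flip (r s : Relabel v e) (i : Fin e) :
    (r * s).flip i = xor (r.flip i) (s.flip (r.edge i)) := rfl
@[simp] theorem Relabel.one_vert : (1 : Relabel v e).vert = 1 := rfl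
@[simp] theorem Relabel.one_edge : (1 : Relabel v e).edge = 1 := rfl
@[simp] theorem Relabel.one_flip (i : Fin e) : (1 : Relabel v e).flip i = false := rfl
@[simp] theorem Relabel.inv_vert (r : Relabel v e) : (r⁻¹).vert = r.vert⁻¹ := rfl
@[simp] theorem Relabel.inv_edge (r : Relabel v e) : (r⁻¹).edge = r.edge⁻¹ := rfl
@[simp] theorem Relabel.inv_flip (r : Relabel v e) (i : Fin e) :
    (r⁻¹).flip i = r.flip (r.edge⁻¹ i) := rfl

instance : Group (Relabel v e) :=
  Group.ofLeftAxioms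
    (fun r s t => Relabel.ext' (mul_assoc _ _ _) (mul_assoc _ _ _).symm fun i => by simp)
    (fun r => Relabel.ext' (one_mul _) (mul_one _) fun i => by simp)
    (fun r => Relabel.ext' (inv_mul_cancel _) (mul_inv_cancel _) fun i => by simp)

instance : Fintype (Relabel v e) :=
  haveI : Finite (Relabel v e) :=
    Finite.of_injective (fun r => (r.vert, r.edge, r.flip)) fun r s h => by
      simp only [Prod.mk.injEq] at h
      exact Relabel.ext' h.1 h.2.1 (congrFun h.2.2)
  Fintype.ofFinite _

theorem flipIf_flipIf {α : Type} (a b : Bool) (p : α × α) :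
    flipIf a (flipIf b p) = flipIf (xor a b) p := by
  cases a <;> cases b <;> simp [flipIf]

theorem relabel_mul (r s : Relabel v e) (Γ : Graph v e) :
    relabel (r * s) Γ = relabel r (relabel s Γ) := by
  funext i
  simp only [relabel, Relabel.mul_flip, Relabel.mul_edge, Relabel.mul_vert, flipIf_map,
    flipIf_flipIf, Prod.map_map, Equiv.Perm.coe_mul, Function.comp]

theorem relabel_one (Γ : Graph v e) : relabel 1 Γ = Γ := by
  funext i
  simp [relabel, flipIf]

theorem relabelSign_mul (d : ℤ) (r s : Relabel v e) :
    relabelSign d (r * s) = relabelSign d r * relabelSign d s := by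
  unfold relabelSign
  split_ifs
  · simp [mul_comm]
  · have h : ∏ i, (if (r * s).flip i then -1 else 1 : ℤˣ)
        = (∏ i, if r.flip i then -1 else 1) * ∏ i, if s.flip i then -1 else 1 := by
      rw [← Equiv.prod_comp r.edge (fun i => if s.flip i then (-1 : ℤˣ) else 1),
        ← Finset.prod_mul_distrib]
      refine Finset.prod_congr rfl fun i _ => ?_
      rw [Relabel.mul_flip]
      cases r.flip i <;> cases s.flip (r.edge i) <;> simp
    rw [h, Relabel.mul_vert, Equiv.Perm.sign_mul]
    exact mul_mul_mul_comm _ _ _ _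

theorem relabelSign_one (d : ℤ) : relabelSign d (1 : Relabel v e) = 1 := relabelSign_id d v e

/-- Swap two vertices and two edges. -/
def swapRelabel (x y : Fin v) (f g : Fin e) : Relabel v e :=
  ⟨Equiv.swap x y, Equiv.swap f g, fun _ => false⟩

/-- In either parity of `d` exactly one of the two transpositions counts, the one of the odd
objects. This sign makes double splittings cancel and makes subdivision anticommute with
contraction. -/
theorem relabelSign_swap (d : ℤ) {x y : Fin v} {f g : Fin e} (h : x ≠ y) (h' : f ≠ g) :
    relabelSign d (swapRelabel x y f g) = -1 := by
  simp [relabelSign, swapRelabel, Equiv.Perm.sign_swap h, Equiv.Perm.sign_swap h']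

/-- Flip the edge `i` if `b` is true. -/
def flipEdge (v : ℕ) (i : Fin e) (b : Bool) : Relabel v e :=
  ⟨1, 1, fun k => decide (k = i) && b⟩

end RelabelGroup

section EntAction

variable {v₁ e₁ v₂ e₂ : ℕ}

theorem relabelEnt_mul (r s : Relabel v₁ e₁ × Relabel v₂ e₂) (P : Ent v₁ e₁ v₂ e₂) :
    relabelEnt (r * s) P = relabelEnt r (relabelEnt s P) := by
  simp [relabelEnt, relabel_mul]

theorem relabelEnt_one (P : Ent v₁ e₁ v₂ e₂) : relabelEnt 1 P = P := by
  simp [relabelEnt, relabel_one]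

theorem entSign_mul (c d : ℤ) (r s : Relabel v₁ e₁ × Relabel v₂ e₂) :
    entSign c d (r * s) = entSign c d r * entSign c d s := by
  simp only [entSign, Prod.fst_mul, Prod.snd_mul, relabelSign_mul]
  exact mul_mul_mul_comm _ _ _ _

end EntAction

/-! ### Functions on labelled pairs and the transpose of the differential -/

section Functions

variable {v₁ e₁ v₂ e₂ : ℕ}

/-- `P'` is obtained from `P` by splitting a vertex of `Γ₁` and attaching the new edge as a hair. -/
def Spl (P : Ent v₁ e₁ v₂ e₂) (P' : Ent (v₁ + 1) (e₁ + 1) v₂ e₂) : Prop :=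
  (∃ u, HairySplitsAt u P.1 P'.1) ∧ AddsHair P.2 P'.2

/-- Merge the last vertex of `Γ₁` into `u` and remove the last edge of `Γ₁`. -/
def contr (u : Fin v₁) (P : Ent (v₁ + 1) (e₁ + 1) v₂ e₂) : Ent v₁ e₁ v₂ e₂ :=
  ((fun i => Prod.map (collapse u) (collapse u) (P.1.1 i.castSucc), fun j => collapse u (P.1.2 j)),
    (P.2.1, fun i => P.2.2 i.castSucc))

/-- A splitting is determined by its result: merging the ends of the new edge recovers the pair.
Read backwards, splitting is contraction of the last edge. -/
theorem spl_iff {P : Ent v₁ e₁ v₂ e₂} {P' : Ent (v₁ + 1) (e₁ + 1) v₂ e₂} :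
    Spl P P' ↔ ∃ u : Fin v₁, P'.1.1 (Fin.last e₁) = (u.castSucc, Fin.last v₁) ∧ P = contr u P' := by
  obtain ⟨⟨Γ, h⟩, Γ₂, k⟩ := P
  constructor
  · rintro ⟨⟨u, ⟨h₁, h₂⟩, h₃⟩, h₄, h₅⟩
    refine ⟨u, h₁, ?_⟩
    simp only [contr, Prod.mk.injEq]
    exact ⟨⟨funext fun i => (h₂ i).symm, funext fun j => (h₃ j).symm⟩, h₄.symm,
      funext fun i => (h₅ i).symm⟩
  · rintro ⟨u, h₁, h₂⟩
    rw [h₂]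
    exact ⟨⟨u, ⟨h₁, fun i => rfl⟩, fun j => rfl⟩, rfl, fun i => rfl⟩

theorem castSucc_last_inj {v : ℕ} {u w : Fin v} {x : Fin (v + 1) × Fin (v + 1)}
    (h : x = (u.castSucc, Fin.last v)) (h' : x = (w.castSucc, Fin.last v)) : u = w := by
  rw [h, Prod.mk.injEq] at h'
  exact Fin.castSucc_injective _ h'.1

theorem Spl.unique {P Q : Ent v₁ e₁ v₂ e₂} {P' : Ent (v₁ + 1) (e₁ + 1) v₂ e₂} (h : Spl P P')
    (h' : Spl Q P') : P = Q := by
  obtain ⟨u, hu, rfl⟩ := spl_iff.1 h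
  obtain ⟨w, hw, rfl⟩ := spl_iff.1 h'
  rw [castSucc_last_inj hu hw]

theorem spl_relabel (r : Relabel v₁ e₁ × Relabel v₂ e₂) (P : Ent v₁ e₁ v₂ e₂)
    (P' : Ent (v₁ + 1) (e₁ + 1) v₂ e₂) :
    Spl (relabelEnt r P) (relabelEnt (extRelabel r.1, r.2) P') ↔ Spl P P' :=
  and_congr (exists_hairySplitsAt_relabel r.1 r.2.edge P.1 P'.1)
    (addsHair_relabel r.2 r.1.edge P.2 P'.2)

variable {K : Type*} [Field K]

open Classical in
/-- The transpose of the differential `δ'` on functions of labelled pairs. -/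
def dst (a : Ent (v₁ + 1) (e₁ + 1) v₂ e₂ → K) (P : Ent v₁ e₁ v₂ e₂) : K :=
  ∑ P', if Spl P P' then a P' else 0

/-- The transpose of the differential `δ''` on functions of labelled pairs. -/
def dst₂ (a : Ent v₁ e₁ (v₂ + 1) (e₂ + 1) → K) (P : Ent v₁ e₁ v₂ e₂) : K :=
  dst (fun Q => a Q.swap) P.swap

/-- Functions that transform under relabellings by the signs. -/
def AntiInv (c d : ℤ) (a : Ent v₁ e₁ v₂ e₂ → K) : Prop :=
  ∀ r P, a (relabelEnt r P) = ((entSign c d r : ℤ) : K) * a P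

theorem entSign_swap (c d : ℤ) (r : Relabel v₁ e₁ × Relabel v₂ e₂) :
    entSign d c r.swap = entSign c d r := mul_comm _ _

theorem AntiInv.swap {c d : ℤ} {a : Ent v₁ e₁ v₂ e₂ → K} (h : AntiInv c d a) :
    AntiInv d c fun Q => a Q.swap := fun r P => by
  rw [← entSign_swap]
  exact h r.swap P.swap

open Classical in
-- The intermediate pair is determined by the result, so iterated splittings have no multiplicities.
theorem sum_spl_spl {v₁' e₁' v₂' e₂' v₁'' e₁'' v₂'' e₂'' : ℕ}
    (p : Ent v₁' e₁' v₂' e₂' → Prop)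
    (q : Ent v₁' e₁' v₂' e₂' → Ent v₁'' e₁'' v₂'' e₂'' → Prop)
    (hq : ∀ Q Q' X, q Q X → q Q' X → Q = Q') (a : Ent v₁'' e₁'' v₂'' e₂'' → K) :
    (∑ Q, if p Q then ∑ X, if q Q X then a X else 0 else 0) =
      ∑ X, if ∃ Q, p Q ∧ q Q X then a X else 0 := by
  have : ∀ Q, (if p Q then ∑ X, if q Q X then a X else 0 else 0) =
      ∑ X, if p Q ∧ q Q X then a X else 0 := by
    intro Q
    by_cases h : p Q <;> simp [h]
  rw [Finset.sum_congr rfl fun Q _ => this Q, Finset.sum_comm]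
  refine Finset.sum_congr rfl fun X _ => ?_
  by_cases h : ∃ Q, p Q ∧ q Q X
  · obtain ⟨Q, hp, hQ⟩ := h
    rw [if_pos ⟨Q, hp, hQ⟩, Finset.sum_eq_single Q, if_pos ⟨hp, hQ⟩]
    · intro Q' _ hne
      exact if_neg fun h' => hne (hq _ _ _ h'.2 hQ)
    · simp
  · rw [if_neg h]
    exact Finset.sum_eq_zero fun Q _ => if_neg fun h' => h ⟨Q, h'⟩

open Classical in
-- Splittings of the two graphs are independent, so both orders reach the same pairs.
theorem dst_dst₂ (a : Ent (v₁ + 1) (e₁ + 1) (v₂ + 1) (e₂ + 1) → K) (P : Ent v₁ e₁ v₂ e₂) :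
    dst (dst₂ a) P = dst₂ (dst a) P := by
  have h₁ : dst (dst₂ a) P = ∑ Q, if Spl P Q then
      ∑ X, if Spl Q.swap X.swap then a X else 0 else 0 := by
    refine Finset.sum_congr rfl fun Q _ => ?_
    split_ifs
    · exact Fintype.sum_equiv (Equiv.prodComm _ _) _ _ fun X => rfl
    · rfl
  have h₂ : dst₂ (dst a) P = ∑ Q : Ent v₁ e₁ (v₂ + 1) (e₂ + 1), if Spl P.swap Q.swap then
      ∑ X, if Spl Q X then a X else 0 else 0 := by
    unfold dst₂ dst
    exact Fintype.sum_equiv (Equiv.prodComm _ _) _ _ fun X => rfl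
  rw [h₁, h₂, sum_spl_spl _ _ (fun Q Q' X h h' => Prod.swap_injective (h.unique h')),
    sum_spl_spl _ _ (fun Q Q' X h h' => h.unique h')]
  refine Finset.sum_congr rfl fun X _ => if_congr ?_ rfl rfl
  constructor
  · rintro ⟨Q, hP, hQ⟩
    obtain ⟨w, hw, hQ⟩ := spl_iff.1 hQ
    obtain rfl : Q = (contr w X.swap).swap := by rw [← hQ, Prod.swap_swap]
    obtain ⟨u, hu, rfl⟩ := spl_iff.1 hP
    exact ⟨contr u X, spl_iff.2 ⟨w, hw, rfl⟩, spl_iff.2 ⟨u, hu, rfl⟩⟩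
  · rintro ⟨Q, hP, hQ⟩
    obtain ⟨u, hu, rfl⟩ := spl_iff.1 hQ
    obtain ⟨w, hw, hP⟩ := spl_iff.1 hP
    obtain rfl : P = (contr w (contr u X).swap).swap := by rw [← hP, Prod.swap_swap]
    exact ⟨(contr w X.swap).swap, spl_iff.2 ⟨u, hu, rfl⟩, spl_iff.2 ⟨w, hw, rfl⟩⟩

end Functions

end GraphCplx

end

noncomputable section

namespace GraphCplx

/-! ### Double splittings cancel in pairs -/

section DstDst

variable {v₁ e₁ v₂ e₂ : ℕ} {K : Type*} [Field K]

/-- Transport a pair along a map that sends the vertices of `Γ₁` to a smaller set, removing the last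
two edges of `Γ₁`. -/
def push (κ : Fin (v₁ + 2) → Fin v₁) (X : Ent (v₁ + 2) (e₁ + 2) v₂ e₂) : Ent v₁ e₁ v₂ e₂ :=
  ((fun i => Prod.map κ κ (X.1.1 i.castSucc.castSucc), fun j => κ (X.1.2 j)),
    (X.2.1, fun i => X.2.2 i.castSucc.castSucc))

/-- Double splittings where the new edges point to the two new vertices in order. -/
def SplOrdered (P : Ent v₁ e₁ v₂ e₂) (X : Ent (v₁ + 2) (e₁ + 2) v₂ e₂) : Prop :=
  ∃ κ x y, (∀ i : Fin v₁, κ i.castSucc.castSucc = i) ∧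
    X.1.1 (Fin.last e₁).castSucc = (x, (Fin.last v₁).castSucc) ∧
    X.1.1 (Fin.last (e₁ + 1)) = (y, Fin.last (v₁ + 1)) ∧
    κ (Fin.last v₁).castSucc = κ x ∧ κ (Fin.last (v₁ + 1)) = κ y ∧
    x ≠ (Fin.last v₁).castSucc ∧ y ≠ Fin.last (v₁ + 1) ∧
    ¬ (x = Fin.last (v₁ + 1) ∧ y = (Fin.last v₁).castSucc) ∧ P = push κ X

/-- Double splittings of `u` where both new edges point to the second new vertex. -/
def SplSink (u : Fin v₁) (P : Ent v₁ e₁ v₂ e₂) (X : Ent (v₁ + 2) (e₁ + 2) v₂ e₂) : Prop :=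
  ∃ κ, (∀ i : Fin v₁, κ i.castSucc.castSucc = i) ∧
    X.1.1 (Fin.last e₁).castSucc = (u.castSucc.castSucc, Fin.last (v₁ + 1)) ∧
    X.1.1 (Fin.last (e₁ + 1)) = ((Fin.last v₁).castSucc, Fin.last (v₁ + 1)) ∧
    κ (Fin.last v₁).castSucc = u ∧ κ (Fin.last (v₁ + 1)) = u ∧ P = push κ X

theorem collapse_eq_castSucc {v : ℕ} {u : Fin (v + 1)} {x : Fin (v + 2)} {w : Fin v}
    (h : collapse u x = w.castSucc) :
    x = w.castSucc.castSucc ∨ x = Fin.last (v + 1) ∧ u = w.castSucc := by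
  induction x using Fin.lastCases with
  | last => exact Or.inr ⟨rfl, by simpa using h⟩
  | cast x => exact Or.inl (by rw [← h, collapse_castSucc])

/-- The second new vertex can take over the head of the first new edge only if the second step
splits the first new vertex; this is `SplSink`. Otherwise each new edge points to its own new
vertex, and the description is symmetric in the two steps. -/
theorem spl_spl_iff (P : Ent v₁ e₁ v₂ e₂) (X : Ent (v₁ + 2) (e₁ + 2) v₂ e₂) :
    (∃ Q, Spl P Q ∧ Spl Q X) ↔ SplOrdered P X ∨ ∃ u, SplSink u P X := by
  constructor
  · rintro ⟨Q, hP, hQ⟩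
    obtain ⟨w, hw, rfl⟩ := spl_iff.1 hQ
    obtain ⟨u, hu, rfl⟩ := spl_iff.1 hP
    rcases hX : X.1.1 (Fin.last e₁).castSucc with ⟨x, z⟩
    simp only [contr, hX, Prod.map_apply, Prod.mk.injEq] at hu
    obtain ⟨hx, hz⟩ := hu
    -- The head `z` of the first new edge in `X` decides between the two kinds.
    induction z using Fin.lastCases with
    | cast z =>
      rw [collapse_castSucc] at hz
      subst hz
      refine Or.inl ⟨collapse u ∘ collapse w, x, w.castSucc, by simp, hX, hw, ?_, by simp, ?_,
        Fin.castSucc_ne_last _, ?_, rfl⟩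
      · simp [hx]
      · rintro rfl
        rw [collapse_castSucc] at hx
        exact Fin.castSucc_ne_last _ hx.symm
      · rintro ⟨rfl, hy⟩
        rw [collapse_last] at hx
        rw [Fin.castSucc_injective _ hy] at hx
        exact Fin.castSucc_ne_last _ hx.symm
    | last =>
      rw [collapse_last] at hz
      subst hz
      refine Or.inr ⟨u, collapse u ∘ collapse (Fin.last v₁), by simp, ?_, hw, by simp, by simp, rfl⟩
      rcases collapse_eq_castSucc hx with rfl | ⟨_, h⟩
      · exact hX
      · exact absurd h.symm (Fin.castSucc_ne_last _)
  · rintro (⟨κ, x, y, hκ, hx, hy, h₁, h₂, hx', hy', hxy, rfl⟩ | ⟨u, κ, hκ, hx, hy, h₁, h₂, rfl⟩)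
    · obtain ⟨w, rfl⟩ : ∃ w : Fin (v₁ + 1), y = w.castSucc := ⟨y.castPred hy', by simp⟩
      -- `u` is the tail of the first new edge once the second splitting is undone. It is an old
      -- vertex because the two new vertices are not the tails of each other's edges.
      obtain ⟨u, hu, hκu⟩ : ∃ u : Fin v₁, collapse w x = u.castSucc ∧ κ x = u := by
        induction x using Fin.lastCases with
        | last =>
          have hw : w ≠ Fin.last v₁ := fun h => hxy ⟨rfl, by rw [h]⟩
          refine ⟨w.castPred hw, by simp, ?_⟩
          rw [h₂]
          conv_lhs => rw [← Fin.castSucc_castPred w hw]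
          exact hκ _
        | cast x =>
          have hw : x ≠ Fin.last v₁ := fun h => hx' (by rw [h])
          refine ⟨x.castPred hw, by simp, ?_⟩
          conv_lhs => rw [← Fin.castSucc_castPred x hw]
          exact hκ _
      refine ⟨contr w X, spl_iff.2 ⟨u, ?_, ?_⟩, spl_iff.2 ⟨w, hy, rfl⟩⟩
      · simp [contr, hx, hu]
      · have : κ = collapse u ∘ collapse w := by
          funext z
          induction z using Fin.lastCases with
          | last =>
            rw [h₂]
            induction w using Fin.lastCases with
            | last => simp [h₁, hκu]
            | cast w => simp [hκ]
          | cast z =>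
            induction z using Fin.lastCases with
            | last => simp [h₁, hκu]
            | cast z => simp [hκ]
        rw [this]; rfl
    · refine ⟨contr (Fin.last v₁) X, spl_iff.2 ⟨u, ?_, ?_⟩, spl_iff.2 ⟨Fin.last v₁, hy, rfl⟩⟩
      · simp [contr, hx]
      · have : κ = collapse u ∘ collapse (Fin.last v₁) := by
          funext z
          induction z using Fin.lastCases with
          | last => simp [h₂]
          | cast z =>
            induction z using Fin.lastCases with
            | last => simp [h₁]
            | cast z => simp [hκ]
        rw [this]; rfl

theorem swapRelabel_apply {v e : ℕ} (x y : Fin v) (f g : Fin e) (Γ : Graph v e) (i : Fin e) :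
    relabel (swapRelabel x y f g) Γ i =
      Prod.map (Equiv.swap x y) (Equiv.swap x y) (Γ (Equiv.swap f g i)) := by
  simp [relabel, swapRelabel, flipIf]

theorem push_swap {κ : Fin (v₁ + 2) → Fin v₁} {x y : Fin (v₁ + 2)} (h : κ ∘ Equiv.swap x y = κ)
    (X : Ent (v₁ + 2) (e₁ + 2) v₂ e₂) :
    push κ (relabelEnt (swapRelabel x y (Fin.last e₁).castSucc (Fin.last (e₁ + 1)), 1) X)
      = push κ X := by
  have h' : ∀ z, κ (Equiv.swap x y z) = κ z := congrFun h
  have hs : ∀ i : Fin e₁, Equiv.swap (Fin.last e₁).castSucc (Fin.last (e₁ + 1))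
      i.castSucc.castSucc = i.castSucc.castSucc := fun i =>
    Equiv.swap_apply_of_ne_of_ne
      (fun h => Fin.castSucc_ne_last _ (Fin.castSucc_injective _ h)) (Fin.castSucc_ne_last _)
  simp only [push, relabelEnt, swapRelabel_apply, hs, relabel_one, Prod.map_map, h]
  simp [swapRelabel, h', hs]

theorem push_comp_swap {κ : Fin (v₁ + 2) → Fin v₁} (x y : Fin (v₁ + 2))
    (X : Ent (v₁ + 2) (e₁ + 2) v₂ e₂) :
    push (κ ∘ Equiv.swap x y)
        (relabelEnt (swapRelabel x y (Fin.last e₁).castSucc (Fin.last (e₁ + 1)), 1) X)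
      = push κ X := by
  have hs : ∀ i : Fin e₁, Equiv.swap (Fin.last e₁).castSucc (Fin.last (e₁ + 1))
      i.castSucc.castSucc = i.castSucc.castSucc := fun i =>
    Equiv.swap_apply_of_ne_of_ne
      (fun h => Fin.castSucc_ne_last _ (Fin.castSucc_injective _ h)) (Fin.castSucc_ne_last _)
  simp only [push, relabelEnt, swapRelabel_apply, hs, relabel_one, Prod.map_map]
  simp [swapRelabel, hs, Function.comp_def]

/-- The relabelling is a sign-reversing involution of the summands, so the sum equals its own
negative. -/
theorem sum_eq_zero_of_relabel [CharZero K] {c d : ℤ} {a : Ent v₁ e₁ v₂ e₂ → K}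
    (ha : AntiInv c d a) (p : Ent v₁ e₁ v₂ e₂ → Prop) [DecidablePred p]
    (r : Relabel v₁ e₁ × Relabel v₂ e₂) (hr : entSign c d r = -1) (hrr : r * r = 1)
    (hp : ∀ X, p X → p (relabelEnt r X)) : ∑ X, (if p X then a X else 0) = 0 := by
  have hinv : Function.Involutive (relabelEnt r) := fun X => by
    rw [← relabelEnt_mul, hrr, relabelEnt_one]
  have h : ∑ X, (if p X then a X else 0) = ∑ X, -(if p X then a X else 0) := by
    refine Fintype.sum_equiv (Function.Involutive.toPerm _ hinv) _ _ fun X => ?_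
    have : p (relabelEnt r X) ↔ p X := ⟨fun h => by rw [← hinv X]; exact hp _ h, hp X⟩
    change _ = -(if p (relabelEnt r X) then a (relabelEnt r X) else 0)
    rw [if_congr this rfl rfl, ha r X, hr]
    split_ifs <;> simp
  rw [Finset.sum_neg_distrib] at h
  exact self_eq_neg.1 h

theorem swapRelabel_mul_self {v e : ℕ} (x y : Fin v) (f g : Fin e) :
    swapRelabel x y f g * swapRelabel x y f g = 1 :=
  Relabel.ext' (Equiv.swap_mul_self _ _) (Equiv.swap_mul_self _ _) fun _ => rfl

theorem entSign_swapRelabel (c d : ℤ) {x y : Fin v₁} {f g : Fin e₁} (h : x ≠ y) (h' : f ≠ g) :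
    entSign c d (swapRelabel x y f g, (1 : Relabel v₂ e₂)) = -1 := by
  simp [entSign, relabelSign_swap c h h', relabelSign_one]

/-- The transpose of the differential squares to zero. -/
theorem dst_dst [CharZero K] {c d : ℤ} {a : Ent (v₁ + 2) (e₁ + 2) v₂ e₂ → K}
    (ha : AntiInv c d a) (P : Ent v₁ e₁ v₂ e₂) : dst (dst a) P = 0 := by
  classical
  have h₁ : dst (dst a) P = ∑ X, if ∃ Q, Spl P Q ∧ Spl Q X then a X else 0 := by
    refine Eq.trans ?_ (sum_spl_spl (Spl P) Spl (fun Q Q' X h h' => Spl.unique h h') a)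
    unfold dst
    exact Finset.sum_congr rfl fun Q _ => by congr
  have hne : (Fin.last v₁).castSucc ≠ Fin.last (v₁ + 1) := Fin.castSucc_ne_last _
  have hne' : (Fin.last e₁).castSucc ≠ Fin.last (e₁ + 1) := Fin.castSucc_ne_last _
  -- The two kinds exclude each other, as the heads of the first new edge differ, and in the second
  -- kind `u` is read off from `X`.
  have h₂ : ∀ X, (if ∃ Q, Spl P Q ∧ Spl Q X then a X else 0) =
      (if SplOrdered P X then a X else 0) + ∑ u, if SplSink u P X then a X else 0 := by
    intro X
    rw [if_congr (spl_spl_iff P X) rfl rfl]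
    by_cases hs : ∃ u, SplSink u P X
    · have ho : ¬ SplOrdered P X := by
        rintro ⟨_, _, _, _, h, _⟩
        obtain ⟨u, _, _, h', _⟩ := hs
        rw [h, Prod.mk.injEq] at h'
        exact hne h'.2
      obtain ⟨u, hu⟩ := hs
      rw [if_pos (Or.inr ⟨u, hu⟩), if_neg ho, zero_add, Finset.sum_eq_single u, if_pos hu]
      · intro w _ hw
        refine if_neg fun hw' => hw ?_
        obtain ⟨_, _, h, _⟩ := hu
        obtain ⟨_, _, h', _⟩ := hw'
        rw [h, Prod.mk.injEq] at h'
        exact Fin.castSucc_injective _ (Fin.castSucc_injective _ h'.1.symm)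
      · simp
    · rw [Finset.sum_eq_zero fun u _ => if_neg fun h => hs ⟨u, h⟩, add_zero]
      exact if_congr ⟨fun h => h.resolve_right hs, Or.inl⟩ rfl rfl
  rw [h₁, Finset.sum_congr rfl fun X _ => h₂ X, Finset.sum_add_distrib, Finset.sum_comm]
  -- The involution exchanges the two new vertices and the two new edges.
  have hA : ∑ X, (if SplOrdered P X then a X else 0) = 0 := by
    refine sum_eq_zero_of_relabel ha _ _ (entSign_swapRelabel c d hne hne')
      (Prod.ext (swapRelabel_mul_self _ _ _ _) (one_mul _)) ?_
    rintro X ⟨κ, x, y, hκ, hx, hy, hx₁, hy₁, hx₂, hy₂, hxy, rfl⟩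
    refine ⟨κ ∘ Equiv.swap (Fin.last v₁).castSucc (Fin.last (v₁ + 1)),
      Equiv.swap (Fin.last v₁).castSucc (Fin.last (v₁ + 1)) y,
      Equiv.swap (Fin.last v₁).castSucc (Fin.last (v₁ + 1)) x, ?_, ?_, ?_, ?_, ?_, ?_, ?_, ?_,
      (push_comp_swap _ _ X).symm⟩
    · intro i
      rw [Function.comp_apply, Equiv.swap_apply_of_ne_of_ne
        (fun h => Fin.castSucc_ne_last _ (Fin.castSucc_injective _ h)) (Fin.castSucc_ne_last _), hκ]
    · simp [relabelEnt, swapRelabel_apply, hy]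
    · simp [relabelEnt, swapRelabel_apply, hx]
    · simp [hy₁]
    · simp [hx₁]
    · rw [Ne, Equiv.swap_apply_eq_iff, Equiv.swap_apply_left]; exact hy₂
    · rw [Ne, Equiv.swap_apply_eq_iff, Equiv.swap_apply_right]; exact hx₂
    · rw [Equiv.swap_apply_eq_iff, Equiv.swap_apply_right, Equiv.swap_apply_eq_iff,
        Equiv.swap_apply_left]
      exact fun h => hxy h.symm
  rw [hA, zero_add]
  -- Here the involution exchanges the tails of the two new edges, namely `u` and the first new
  -- vertex, together with the edges. All of these vertices are merged into `u`, so `P` is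
  -- unaffected.
  refine Finset.sum_eq_zero fun u _ => ?_
  have hu : u.castSucc.castSucc ≠ (Fin.last v₁).castSucc := fun h =>
    Fin.castSucc_ne_last _ (Fin.castSucc_injective _ h)
  refine sum_eq_zero_of_relabel ha _ _ (entSign_swapRelabel c d hu hne')
    (Prod.ext (swapRelabel_mul_self _ _ _ _) (one_mul _)) ?_
  clear h₁ h₂ hA
  rintro X ⟨κ, hκ, hx, hy, hk₁, hk₂, rfl⟩
  refine ⟨κ, hκ, ?_, ?_, hk₁, hk₂, (push_swap ?_ X).symm⟩
  · simp only [relabelEnt, swapRelabel_apply, Equiv.swap_apply_left, hy, Prod.map_apply,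
      Equiv.swap_apply_right]
    rw [Equiv.swap_apply_of_ne_of_ne (Fin.castSucc_ne_last _).symm hne.symm]
  · simp only [relabelEnt, swapRelabel_apply, Equiv.swap_apply_left, hx, Prod.map_apply,
      Equiv.swap_apply_right]
    rw [Equiv.swap_apply_of_ne_of_ne (Fin.castSucc_ne_last _).symm hne.symm]
  · funext z
    rw [Function.comp_apply, Equiv.swap_apply_def]
    split_ifs with hz hz'
    · rw [hk₁, hz, hκ]
    · rw [hz', hk₁, hκ]
    · rfl

end DstDst

end GraphCplx

end

noncomputable section

namespace GraphCplx

/-! ### Chains: coinvariants of all labelled pairs, with the contraction of edges of `Γ₁` -/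

section Chain

variable (K : Type*) [Field K] (c d : ℤ) {v₁ e₁ v₂ e₂ : ℕ}

/-- The sign of a relabelling, as an element of the field. -/
def sg {v e : ℕ} (r : Relabel v e) : K := (((relabelSign c r : ℤˣ) : ℤ) : K)

/-- The sign of a pair of relabellings, as an element of the field. -/
def sgE (r : Relabel v₁ e₁ × Relabel v₂ e₂) : K := (((entSign c d r : ℤˣ) : ℤ) : K)

theorem sg_mul {v e : ℕ} (r s : Relabel v e) : sg K c (r * s) = sg K c r * sg K c s := by
  simp [sg, relabelSign_mul]

theorem sg_one {v e : ℕ} : sg K c (1 : Relabel v e) = 1 := by simp [sg, relabelSign_one]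

theorem sg_mul_self {v e : ℕ} (r : Relabel v e) : sg K c r * sg K c r = 1 := by
  rw [sg, ← Int.cast_mul, ← Units.val_mul, Int.units_mul_self]; simp

theorem sg_inv {v e : ℕ} (r : Relabel v e) : sg K c r⁻¹ = sg K c r := by
  have h : sg K c r⁻¹ * sg K c r = 1 := by rw [← sg_mul, inv_mul_cancel, sg_one]
  calc sg K c r⁻¹ = sg K c r⁻¹ * (sg K c r * sg K c r) := by rw [sg_mul_self, mul_one]
    _ = sg K c r := by rw [← mul_assoc, h, one_mul]

theorem sg_ext {v e : ℕ} (r : Relabel v e) : sg K c (extRelabel r) = sg K c r := by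
  simp [sg, relabelSign_ext]

theorem sgE_eq (r : Relabel v₁ e₁ × Relabel v₂ e₂) : sgE K c d r = sg K c r.1 * sg K d r.2 := by
  simp [sgE, sg, entSign]

theorem sgE_mul (r s : Relabel v₁ e₁ × Relabel v₂ e₂) :
    sgE K c d (r * s) = sgE K c d r * sgE K c d s := by
  simp [sgE, entSign_mul]

theorem sgE_mul_self (r : Relabel v₁ e₁ × Relabel v₂ e₂) : sgE K c d r * sgE K c d r = 1 := by
  rw [sgE, ← Int.cast_mul, ← Units.val_mul, Int.units_mul_self]; simp

theorem sgE_inv (r : Relabel v₁ e₁ × Relabel v₂ e₂) : sgE K c d r⁻¹ = sgE K c d r := by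
  rw [sgE_eq, sgE_eq, Prod.fst_inv, Prod.snd_inv, sg_inv, sg_inv]

/-- The relations between labelled pairs. -/
abbrev entRelations (v₁ e₁ v₂ e₂ : ℕ) : Submodule K (Ent v₁ e₁ v₂ e₂ →₀ K) :=
  relations K (relabelEnt (v₁ := v₁) (e₁ := e₁) (v₂ := v₂) (e₂ := e₂)) (entSign c d)

/-- Coinvariants of all labelled pairs. -/
def Chain (v₁ e₁ v₂ e₂ : ℕ) : Type _ :=
  (Ent v₁ e₁ v₂ e₂ →₀ K) ⧸ entRelations K c d v₁ e₁ v₂ e₂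

instance (v₁ e₁ v₂ e₂ : ℕ) : AddCommGroup (Chain K c d v₁ e₁ v₂ e₂) :=
  inferInstanceAs (AddCommGroup ((Ent v₁ e₁ v₂ e₂ →₀ K) ⧸ entRelations K c d v₁ e₁ v₂ e₂))

instance (v₁ e₁ v₂ e₂ : ℕ) : Module K (Chain K c d v₁ e₁ v₂ e₂) :=
  inferInstanceAs (Module K ((Ent v₁ e₁ v₂ e₂ →₀ K) ⧸ entRelations K c d v₁ e₁ v₂ e₂))

/-- The projection of the free space onto its coinvariants. -/
def Chain.mk : (Ent v₁ e₁ v₂ e₂ →₀ K) →ₗ[K] Chain K c d v₁ e₁ v₂ e₂ :=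
  (entRelations K c d v₁ e₁ v₂ e₂).mkQ

theorem Chain.mk_surjective :
    Function.Surjective (Chain.mk K c d : (Ent v₁ e₁ v₂ e₂ →₀ K) →ₗ[K] _) :=
  Submodule.mkQ_surjective _

instance (v₁ e₁ v₂ e₂ : ℕ) : Module.Finite K (Chain K c d v₁ e₁ v₂ e₂) :=
  Module.Finite.of_surjective _ (Chain.mk_surjective K c d)

/-- The class of a labelled pair. -/
def cl (P : Ent v₁ e₁ v₂ e₂) : Chain K c d v₁ e₁ v₂ e₂ := Chain.mk K c d (Finsupp.single P 1)

theorem cl_relabelEnt (r : Relabel v₁ e₁ × Relabel v₂ e₂) (P : Ent v₁ e₁ v₂ e₂) :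
    cl K c d (relabelEnt r P) = sgE K c d r • cl K c d P := by
  unfold cl
  rw [← map_smul, ← sub_eq_zero, ← map_sub]
  exact (Submodule.Quotient.mk_eq_zero _).2 (Submodule.subset_span ⟨r, P, rfl⟩)

variable {K c d} in
theorem Chain.hom_ext {U : Type*} [AddCommGroup U] [Module K U]
    {f g : Chain K c d v₁ e₁ v₂ e₂ →ₗ[K] U} (h : ∀ P, f (cl K c d P) = g (cl K c d P)) :
    f = g := by
  have h2 : f ∘ₗ Chain.mk K c d = g ∘ₗ Chain.mk K c d :=
    Finsupp.lhom_ext' fun P => LinearMap.ext_ring (h P)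
  refine LinearMap.ext fun x => ?_
  obtain ⟨x, rfl⟩ := Chain.mk_surjective K c d x
  exact LinearMap.congr_fun h2 x

variable {K c d} in
theorem Chain.span_cl : Submodule.span K (Set.range (cl K c d : Ent v₁ e₁ v₂ e₂ → _)) = ⊤ := by
  rw [eq_top_iff]
  rintro x -
  obtain ⟨x, rfl⟩ := Chain.mk_surjective K c d x
  induction x using Finsupp.induction_linear with
  | zero => rw [map_zero]; exact Submodule.zero_mem _
  | add f g hf hg => rw [map_add]; exact Submodule.add_mem _ hf hg
  | single P a =>
    have : Finsupp.single P a = a • Finsupp.single P (1 : K) := by simp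
    rw [this, map_smul]
    exact Submodule.smul_mem _ _ (Submodule.subset_span ⟨P, rfl⟩)

/-- Linear maps out of the coinvariants. -/
def Chain.lift {U : Type*} [AddCommGroup U] [Module K U] (φ : Ent v₁ e₁ v₂ e₂ → U)
    (h : ∀ r P, φ (relabelEnt r P) = sgE K c d r • φ P) : Chain K c d v₁ e₁ v₂ e₂ →ₗ[K] U :=
  Submodule.liftQ (entRelations K c d v₁ e₁ v₂ e₂) (Finsupp.linearCombination K φ) (by
    unfold entRelations relations
    rw [Submodule.span_le]
    rintro _ ⟨r, P, rfl⟩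
    have := h r P
    unfold sgE at this
    simp [this])

@[simp] theorem Chain.lift_cl {U : Type*} [AddCommGroup U] [Module K U]
    (φ : Ent v₁ e₁ v₂ e₂ → U) (h : ∀ r P, φ (relabelEnt r P) = sgE K c d r • φ P)
    (P : Ent v₁ e₁ v₂ e₂) : Chain.lift K c d φ h (cl K c d P) = φ P := by
  have : Chain.lift K c d φ h (cl K c d P)
      = Finsupp.linearCombination K φ (Finsupp.single P (1 : K)) := Submodule.liftQ_apply _ _ _
  rw [this]
  simp

/-! ### Contraction of one edge -/

/-- Relabelling the graph `Γ₁` only. -/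
abbrev relabel₁ (r : Relabel v₁ e₁) (P : Ent v₁ e₁ v₂ e₂) : Ent v₁ e₁ v₂ e₂ := relabelEnt (r, 1) P

theorem relabel₁_mul (r s : Relabel v₁ e₁) (P : Ent v₁ e₁ v₂ e₂) :
    relabel₁ (r * s) P = relabel₁ r (relabel₁ s P) := by
  rw [relabel₁, relabel₁, relabel₁, ← relabelEnt_mul]
  rfl

theorem cl_relabel₁ (r : Relabel v₁ e₁) (P : Ent v₁ e₁ v₂ e₂) :
    cl K c d (relabel₁ r P) = sg K c r • cl K c d P := by
  rw [relabel₁, cl_relabelEnt, sgE_eq, sg_one, mul_one]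

/-- The relabelling `r` brings the edge `f` to the last position, running from `u` to the last
vertex. -/
def Brings (f : Fin (e₁ + 1)) (Γ : Graph (v₁ + 1) (e₁ + 1)) (r : Relabel (v₁ + 1) (e₁ + 1))
    (u : Fin v₁) : Prop :=
  r.edge (Fin.last e₁) = f ∧ relabel r Γ (Fin.last e₁) = (u.castSucc, Fin.last v₁)

theorem exists_extPerm {n : ℕ} {σ : Equiv.Perm (Fin (n + 1))} (h : σ (Fin.last n) = Fin.last n) :
    ∃ τ, extPerm τ = σ := by
  have hne : ∀ i : Fin n, σ i.castSucc ≠ Fin.last n := fun i hi =>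
    Fin.castSucc_ne_last i (σ.injective (hi.trans h.symm))
  have hinj : Function.Injective fun i : Fin n => (σ i.castSucc).castPred (hne i) := by
    intro i j hij
    simp only [Fin.castPred_inj] at hij
    exact Fin.castSucc_injective _ (σ.injective hij)
  refine ⟨Equiv.ofBijective _ (Finite.injective_iff_bijective.1 hinj), Equiv.ext fun i => ?_⟩
  induction i using Fin.lastCases with
  | last => rw [extPerm_last, h]
  | cast i => simp

theorem exists_extRelabel {v e : ℕ} {r : Relabel (v + 1) (e + 1)}
    (h₁ : r.vert (Fin.last v) = Fin.last v) (h₂ : r.edge (Fin.last e) = Fin.last e)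
    (h₃ : r.flip (Fin.last e) = false) : ∃ s, extRelabel s = r := by
  obtain ⟨σ, hσ⟩ := exists_extPerm h₁
  obtain ⟨τ, hτ⟩ := exists_extPerm h₂
  refine ⟨⟨σ, τ, fun i => r.flip i.castSucc⟩, Relabel.ext' hσ hτ fun i => ?_⟩
  induction i using Fin.lastCases with
  | last => simp [extRelabel, h₃]
  | cast i => simp [extRelabel]

theorem contr_ext (r : Relabel v₁ e₁) (s : Relabel v₂ e₂) (u : Fin v₁)
    (X : Ent (v₁ + 1) (e₁ + 1) v₂ e₂) :
    contr (r.vert u) (relabelEnt (extRelabel r, s) X) = relabelEnt (r, s) (contr u X) := by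
  have h : ∀ x, collapse (r.vert u) (extPerm r.vert x) = r.vert (collapse u x) := fun x =>
    collapse_ext _ _ _
  have h' : collapse (r.vert u) ∘ extPerm r.vert = r.vert ∘ collapse u := funext h
  simp only [contr, relabelEnt, relabel_ext_castSucc, flipIf_map, Prod.map_map, h']
  refine Prod.ext (Prod.ext (funext fun i => ?_) (funext fun j => h _)) (Prod.ext rfl ?_)
  · simp [relabel, Prod.map_map]
  · funext i
    simp [extRelabel]

/-- Reverse the last edge and exchange its two ends. -/
def reverseLast (u : Fin v₁) : Relabel (v₁ + 1) (e₁ + 1) :=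
  ⟨Equiv.swap u.castSucc (Fin.last v₁), 1, fun i => decide (i = Fin.last e₁)⟩

/-- For odd `c` the transposition of vertices and the flip contribute `-1` each; for even `c`
neither counts. -/
theorem sg_reverseLast (u : Fin v₁) : sg K c (reverseLast (e₁ := e₁) u) = 1 := by
  simp [sg, relabelSign, reverseLast, Equiv.Perm.sign_swap (Fin.castSucc_ne_last u)]

theorem collapse_swap {v : ℕ} (u : Fin v) (x : Fin (v + 1)) :
    collapse u (Equiv.swap u.castSucc (Fin.last v) x) = collapse u x := by
  rw [Equiv.swap_apply_def]
  split_ifs with h h'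
  · simp [h]
  · simp [h']
  · rfl

theorem contr_reverseLast (u : Fin v₁) (X : Ent (v₁ + 1) (e₁ + 1) v₂ e₂) :
    contr u (relabel₁ (reverseLast u) X) = contr u X := by
  have h : collapse u ∘ Equiv.swap u.castSucc (Fin.last v₁) = collapse u :=
    funext (collapse_swap u)
  simp only [contr, relabelEnt, relabel_one]
  simp [reverseLast, relabel, flipIf, Prod.map_map, h, collapse_swap, Fin.castSucc_ne_last]

/-- The contraction of an edge is well defined. Two relabellings that bring `f` into standard
position differ by one that fixes the last edge. If it does not flip that edge, it comes from a
relabelling of the contracted graph; if it does, the same holds after splitting off `reverseLast`,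
which has sign `1` and does not affect the contraction. -/
theorem brings_unique {f : Fin (e₁ + 1)} {X : Ent (v₁ + 1) (e₁ + 1) v₂ e₂}
    {r s : Relabel (v₁ + 1) (e₁ + 1)} {u w : Fin v₁} (hr : Brings f X.1.1 r u)
    (hs : Brings f X.1.1 s w) :
    sg K c r • cl K c d (contr u (relabel₁ r X)) =
      sg K c s • cl K c d (contr w (relabel₁ s X)) := by
  have key : ∀ (Y : Ent (v₁ + 1) (e₁ + 1) v₂ e₂) (m : Relabel (v₁ + 1) (e₁ + 1)),
      Y.1.1 (Fin.last e₁) = (u.castSucc, Fin.last v₁) →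
      relabel m Y.1.1 (Fin.last e₁) = (w.castSucc, Fin.last v₁) →
      m.edge (Fin.last e₁) = Fin.last e₁ → m.flip (Fin.last e₁) = false →
      cl K c d (contr w (relabel₁ m Y)) = sg K c m • cl K c d (contr u Y) := by
    intro Y m hY hm he hf
    simp only [relabel, he, hf, hY, flipIf, Prod.map_apply, Bool.false_eq_true, if_false,
      Prod.mk.injEq] at hm
    obtain ⟨m, rfl⟩ := exists_extRelabel hm.2 he hf
    have hw : w = m.vert u := by
      have := hm.1
      rw [extRelabel, extPerm_castSucc] at this
      exact (Fin.castSucc_injective _ this).symm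
    rw [hw, relabel₁, contr_ext, cl_relabelEnt, sgE_eq, sg_one, mul_one, sg_ext]
  obtain ⟨m, rfl⟩ : ∃ m, s = m * r := ⟨s * r⁻¹, by simp⟩
  obtain ⟨hr₁, hr₂⟩ := hr
  obtain ⟨hs₁, hs₂⟩ := hs
  have he : m.edge (Fin.last e₁) = Fin.last e₁ := r.edge.injective (by
    rw [hr₁]; exact hs₁)
  have hs₂' : relabel m (relabel₁ r X).1.1 (Fin.last e₁) = (w.castSucc, Fin.last v₁) := by
    rw [← hs₂, relabel_mul]; rfl
  rw [relabel₁_mul, sg_mul]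
  cases hf : m.flip (Fin.last e₁) with
  | false =>
    rw [key _ m hr₂ hs₂' he hf, smul_smul, mul_right_comm, sg_mul_self, one_mul]
  | true =>
    obtain ⟨n, rfl⟩ : ∃ n, m = n * reverseLast u := ⟨m * (reverseLast u)⁻¹, by simp⟩
    have hY : (relabel₁ (reverseLast u) (relabel₁ r X)).1.1 (Fin.last e₁) =
        (u.castSucc, Fin.last v₁) := by
      change relabel (reverseLast u) (relabel r X.1.1) (Fin.last e₁) = _
      rw [relabel]
      simp [hr₂, flipIf, reverseLast]
    have he' : n.edge (Fin.last e₁) = Fin.last e₁ := by simpa [reverseLast] using he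
    rw [relabel₁_mul, key _ n hY ?_ he' ?_, contr_reverseLast, sg_mul, sg_reverseLast, mul_one,
      smul_smul, mul_right_comm, sg_mul_self, one_mul]
    · rw [← hs₂', relabel_mul]; rfl
    · simpa [reverseLast, he'] using hf

open Classical in
/-- The contraction of the edge `f` of `Γ₁`. -/
def edgeTerm (f : Fin (e₁ + 1)) (X : Ent (v₁ + 1) (e₁ + 1) v₂ e₂) : Chain K c d v₁ e₁ v₂ e₂ :=
  if h : ∃ ru : Relabel (v₁ + 1) (e₁ + 1) × Fin v₁, Brings f X.1.1 ru.1 ru.2 then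
    sg K c h.choose.1 • cl K c d (contr h.choose.2 (relabel₁ h.choose.1 X)) else 0

theorem edgeTerm_eq {f : Fin (e₁ + 1)} {X : Ent (v₁ + 1) (e₁ + 1) v₂ e₂}
    {r : Relabel (v₁ + 1) (e₁ + 1)} {u : Fin v₁} (h : Brings f X.1.1 r u) :
    edgeTerm K c d f X = sg K c r • cl K c d (contr u (relabel₁ r X)) := by
  have h' : ∃ ru : Relabel (v₁ + 1) (e₁ + 1) × Fin v₁, Brings f X.1.1 ru.1 ru.2 := ⟨(r, u), h⟩
  rw [edgeTerm, dif_pos h']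
  exact brings_unique K c d h'.choose_spec h

theorem edgeTerm_eq_zero {f : Fin (e₁ + 1)} {X : Ent (v₁ + 1) (e₁ + 1) v₂ e₂}
    (h : ∀ r u, ¬ Brings f X.1.1 r u) : edgeTerm K c d f X = 0 :=
  dif_neg fun ⟨ru, h'⟩ => h ru.1 ru.2 h'

theorem relabel₁_relabelEnt (ρ : Relabel v₁ e₁) (r : Relabel v₁ e₁ × Relabel v₂ e₂)
    (X : Ent v₁ e₁ v₂ e₂) :
    relabel₁ ρ (relabelEnt r X) = relabelEnt (1, r.2) (relabel₁ (ρ * r.1) X) := by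
  rw [relabel₁, relabel₁, ← relabelEnt_mul, ← relabelEnt_mul]
  congr 1
  ext1 <;> simp

theorem brings_relabel {f : Fin (e₁ + 1)} {Γ : Graph (v₁ + 1) (e₁ + 1)}
    {r s : Relabel (v₁ + 1) (e₁ + 1)} {u : Fin v₁} :
    Brings f (relabel s Γ) r u ↔ Brings (s.edge f) Γ (r * s) u := by
  unfold Brings
  rw [relabel_mul, Relabel.mul_edge, Equiv.Perm.mul_apply, EmbeddingLike.apply_eq_iff_eq]

theorem extRelabel_one {v e : ℕ} : extRelabel (1 : Relabel v e) = 1 := by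
  have h : ∀ n, extPerm (1 : Equiv.Perm (Fin n)) = 1 := fun n => Equiv.ext fun i => by
    induction i using Fin.lastCases <;> simp
  refine Relabel.ext' (h v) (h e) fun i => ?_
  induction i using Fin.lastCases <;> simp [extRelabel]

/-- Relabelling permutes the contractions of the single edges, so their sum descends to
coinvariants. -/
theorem edgeTerm_relabelEnt (f : Fin (e₁ + 1)) (r : Relabel (v₁ + 1) (e₁ + 1) × Relabel v₂ e₂)
    (X : Ent (v₁ + 1) (e₁ + 1) v₂ e₂) :
    edgeTerm K c d f (relabelEnt r X) = sgE K c d r • edgeTerm K c d (r.1.edge f) X := by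
  by_cases h : ∃ s u, Brings f (relabelEnt r X).1.1 s u
  · obtain ⟨s, u, h⟩ := h
    have h' : Brings (r.1.edge f) X.1.1 (s * r.1) u := brings_relabel.1 h
    rw [edgeTerm_eq K c d h, edgeTerm_eq K c d h', relabel₁_relabelEnt]
    have := contr_ext (1 : Relabel v₁ e₁) r.2 u (relabel₁ (s * r.1) X)
    rw [extRelabel_one, Relabel.one_vert, Equiv.Perm.one_apply] at this
    rw [this, cl_relabelEnt, smul_smul, smul_smul, sgE_eq, sgE_eq, sg_one, one_mul, sg_mul]
    congr 1
    linear_combination (-sg K c s * sg K d r.2) * sg_mul_self K c r.1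
  · rw [edgeTerm_eq_zero K c d fun s u h' => h ⟨s, u, h'⟩, edgeTerm_eq_zero, smul_zero]
    intro s u h'
    refine h ⟨s * r.1⁻¹, u, brings_relabel.2 ?_⟩
    rwa [inv_mul_cancel_right]

/-- The sum of the contractions of all edges of `Γ₁`. -/
def bd : Chain K c d (v₁ + 1) (e₁ + 1) v₂ e₂ →ₗ[K] Chain K c d v₁ e₁ v₂ e₂ :=
  Chain.lift K c d (fun X => ∑ f, edgeTerm K c d f X) fun r X => by
    rw [Finset.smul_sum, ← Equiv.sum_comp r.1.edge (fun f => sgE K c d r • edgeTerm K c d f X)]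
    exact Finset.sum_congr rfl fun f _ => edgeTerm_relabelEnt K c d f r X

theorem bd_cl (X : Ent (v₁ + 1) (e₁ + 1) v₂ e₂) :
    bd K c d (cl K c d X) = ∑ f, edgeTerm K c d f X := Chain.lift_cl _ _ _ _ _ _

end Chain

end GraphCplx

end

noncomputable section

namespace GraphCplx

/-! ### The subdivision homotopy -/

section Subdivision

variable (K : Type*) [Field K] (c d : ℤ) {v₁ e₁ v₂ e₂ : ℕ}

/-- Subdivide the edge `i` of `Γ₁` by a new vertex without hairs; the half of the edge near its head
becomes the new edge, and its hair is attached to `w`. -/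
def sub (i : Fin e₁) (w : Fin v₂) (Q : Ent v₁ e₁ v₂ e₂) : Ent (v₁ + 1) (e₁ + 1) v₂ e₂ :=
  ((Fin.snoc (α := fun _ => Fin (v₁ + 1) × Fin (v₁ + 1))
      (fun k => if k = i then ((Q.1.1 k).1.castSucc, Fin.last v₁)
        else Prod.map Fin.castSucc Fin.castSucc (Q.1.1 k)) ((Q.1.1 i).2.castSucc, Fin.last v₁),
    fun j => (Q.1.2 j).castSucc), (Q.2.1, Fin.snoc (α := fun _ => Fin v₂) Q.2.2 w))

@[simp] theorem sub_last (i : Fin e₁) (w : Fin v₂) (Q : Ent v₁ e₁ v₂ e₂) :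
    (sub i w Q).1.1 (Fin.last e₁) = ((Q.1.1 i).2.castSucc, Fin.last v₁) := by simp [sub]

theorem sub_castSucc (i : Fin e₁) (w : Fin v₂) (Q : Ent v₁ e₁ v₂ e₂) (k : Fin e₁) :
    (sub i w Q).1.1 k.castSucc = if k = i then ((Q.1.1 k).1.castSucc, Fin.last v₁)
        else Prod.map Fin.castSucc Fin.castSucc (Q.1.1 k) := by simp [sub]

@[simp] theorem sub_castSucc_self (i : Fin e₁) (w : Fin v₂) (Q : Ent v₁ e₁ v₂ e₂) :
    (sub i w Q).1.1 i.castSucc = ((Q.1.1 i).1.castSucc, Fin.last v₁) := by simp [sub]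

theorem sub_of_ne {i k : Fin e₁} (h : k ≠ i) (w : Fin v₂) (Q : Ent v₁ e₁ v₂ e₂) :
    (sub i w Q).1.1 k.castSucc = Prod.map Fin.castSucc Fin.castSucc (Q.1.1 k) := by
  simp [sub, h]

@[simp] theorem sub_hair (i : Fin e₁) (w : Fin v₂) (Q : Ent v₁ e₁ v₂ e₂) (j : Fin e₂) :
    (sub i w Q).1.2 j = (Q.1.2 j).castSucc := rfl

@[simp] theorem sub_snd_fst (i : Fin e₁) (w : Fin v₂) (Q : Ent v₁ e₁ v₂ e₂) :
    (sub i w Q).2.1 = Q.2.1 := rfl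

@[simp] theorem sub_color_castSucc (i : Fin e₁) (w : Fin v₂) (Q : Ent v₁ e₁ v₂ e₂) (k : Fin e₁) :
    (sub i w Q).2.2 k.castSucc = Q.2.2 k := by simp [sub]

@[simp] theorem sub_color_last (i : Fin e₁) (w : Fin v₂) (Q : Ent v₁ e₁ v₂ e₂) :
    (sub i w Q).2.2 (Fin.last e₁) = w := by simp [sub]

/-- The half near the head receives the new number, so a flip of `i` would exchange the halves; `hr`
excludes it. -/
theorem sub_relabelEnt (i : Fin e₁) (w : Fin v₂) (r : Relabel v₁ e₁ × Relabel v₂ e₂)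
    (hr : r.1.flip i = false) (Q : Ent v₁ e₁ v₂ e₂) :
    sub i (r.2.vert w) (relabelEnt r Q)
      = relabelEnt (extRelabel r.1, r.2) (sub (r.1.edge i) w Q) := by
  refine Prod.ext (Prod.ext (funext fun k => ?_) (funext fun j => ?_))
    (Prod.ext rfl (funext fun k => ?_))
  · induction k using Fin.lastCases with
    | last =>
      simp [relabelEnt, extRelabel, relabel, hr, flipIf]
    | cast k =>
      rw [sub_castSucc]
      simp only [relabelEnt, relabel_ext_castSucc, sub_castSucc, EmbeddingLike.apply_eq_iff_eq]
      by_cases h : k = i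
      · subst h
        simp [relabel, hr, flipIf]
      · simp only [h, if_false, relabel, flipIf_map, Prod.map_map]
        congr 2 <;> (funext x; simp)
  · simp [relabelEnt, extRelabel]
  · induction k using Fin.lastCases with
    | last => simp [relabelEnt, extRelabel]
    | cast k => simp [relabelEnt, extRelabel]

/-- The sum over the hairs of the subdivisions of a half of the edge `i`, to which `φ` is applied. -/
def subTerm {U : Type*} [AddCommGroup U] [Module K U] (φ : Ent (v₁ + 1) (e₁ + 1) v₂ e₂ → U)
    (i : Fin e₁) (b : Bool) (Q : Ent v₁ e₁ v₂ e₂) : U :=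
  sg K c (flipEdge v₁ i b) • ∑ w, φ (sub i w (relabel₁ (flipEdge v₁ i b) Q))

/-- A flip of `i` exchanges the two halves, hence the shift of `b`. Moving `flipEdge` across `r`
leaves a relabelling `ρ` that does not flip `i`. The maps `φ` and `φ'` are general so that the lemma
serves both for subdivision and for subdivision followed by a contraction. -/
theorem subTerm_relabelEnt {U : Type*} [AddCommGroup U] [Module K U]
    (φ φ' : Ent (v₁ + 1) (e₁ + 1) v₂ e₂ → U) (i : Fin e₁) (b : Bool)
    (r : Relabel v₁ e₁ × Relabel v₂ e₂)
    (h : ∀ ρ : Relabel v₁ e₁, ρ.edge = r.1.edge → ∀ X,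
      φ (relabelEnt (extRelabel ρ, r.2) X) = sgE K c d (ρ, r.2) • φ' X) (Q : Ent v₁ e₁ v₂ e₂) :
    subTerm K c φ i b (relabelEnt r Q)
      = sgE K c d r • subTerm K c φ' (r.1.edge i) (xor b (r.1.flip i)) Q := by
  obtain ⟨ρ, hρ, hρi, hmul⟩ : ∃ ρ : Relabel v₁ e₁, ρ.edge = r.1.edge ∧ ρ.flip i = false ∧
      flipEdge v₁ i b * r.1 = ρ * flipEdge v₁ (r.1.edge i) (xor b (r.1.flip i)) := by
    refine ⟨⟨r.1.vert, r.1.edge, fun k => !decide (k = i) && r.1.flip k⟩, rfl, by simp,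
      Relabel.ext' ?_ ?_ fun k => ?_⟩
    · simp [flipEdge]
    · simp [flipEdge]
    · by_cases hk : k = i
      · subst hk; simp [flipEdge]
      · simp [flipEdge, hk]
  have hsg : sg K c (flipEdge v₁ i b) * sg K c r.1
      = sg K c ρ * sg K c (flipEdge v₁ (r.1.edge i) (xor b (r.1.flip i))) := by
    rw [← sg_mul, hmul, sg_mul]
  have hQ : relabel₁ (flipEdge v₁ i b) (relabelEnt r Q) = relabelEnt (ρ, r.2)
      (relabel₁ (flipEdge v₁ (r.1.edge i) (xor b (r.1.flip i))) Q) := by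
    rw [relabel₁, relabel₁, ← relabelEnt_mul, ← relabelEnt_mul]
    congr 1
    exact Prod.ext hmul (by simp)
  unfold subTerm
  rw [hQ, ← Equiv.sum_comp r.2.vert]
  have : ∀ w, φ (sub i (r.2.vert w) (relabelEnt (ρ, r.2)
      (relabel₁ (flipEdge v₁ (r.1.edge i) (xor b (r.1.flip i))) Q)))
      = sgE K c d (ρ, r.2) • φ' (sub (r.1.edge i) w
        (relabel₁ (flipEdge v₁ (r.1.edge i) (xor b (r.1.flip i))) Q)) := by
    intro w
    have := sub_relabelEnt i w (ρ, r.2) hρi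
      (relabel₁ (flipEdge v₁ (r.1.edge i) (xor b (r.1.flip i))) Q)
    simp only at this
    rw [this, h ρ hρ, hρ]
  rw [Finset.sum_congr rfl fun w _ => this w, ← Finset.smul_sum, smul_smul, smul_smul, sgE_eq,
    sgE_eq]
  congr 1
  linear_combination (sg K c ρ * sg K c r.1 * sg K d r.2) * hsg
    - (sg K c (flipEdge v₁ i b) * sg K c ρ * sg K d r.2) * sg_mul_self K c r.1
    + (sg K c (flipEdge v₁ (r.1.edge i) (xor b (r.1.flip i))) * sg K c r.1 * sg K d r.2)
      * sg_mul_self K c ρ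

theorem sum_bool_xor {U : Type*} [AddCommMonoid U] (f : Bool → U) (a : Bool) :
    ∑ b, f (xor b a) = ∑ b, f b := by
  cases a <;> simp [add_comm]

/-- The sum of all subdivisions of edges of `Γ₁`. -/
def sd : Chain K c d v₁ e₁ v₂ e₂ →ₗ[K] Chain K c d (v₁ + 1) (e₁ + 1) v₂ e₂ :=
  Chain.lift K c d (fun Q => ∑ i, ∑ b, subTerm K c (cl K c d) i b Q) fun r Q => by
    rw [Finset.smul_sum,
      ← Equiv.sum_comp r.1.edge fun i => sgE K c d r • ∑ b, subTerm K c (cl K c d) i b Q]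
    refine Finset.sum_congr rfl fun i _ => ?_
    rw [← sum_bool_xor (fun b => subTerm K c (cl K c d) (r.1.edge i) b Q) (r.1.flip i),
      Finset.smul_sum]
    refine Finset.sum_congr rfl fun b _ => subTerm_relabelEnt K c d _ _ i b r ?_ Q
    intro ρ _ X
    rw [cl_relabelEnt, sgE_eq, sgE_eq, sg_ext]

theorem sd_cl (Q : Ent v₁ e₁ v₂ e₂) :
    sd K c d (cl K c d Q) = ∑ i, ∑ b, subTerm K c (cl K c d) i b Q := Chain.lift_cl _ _ _ _ _ _

/-! ### Contraction after subdivision -/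

/-- Replace the hair attachments of the edges of `Γ₁`. -/
def setColor (φ : Fin e₁ → Fin v₂) (Q : Ent v₁ e₁ v₂ e₂) : Ent v₁ e₁ v₂ e₂ := (Q.1, (Q.2.1, φ))

/-- Attach the hair labelled by the edge `i` of `Γ₁` to `w`. -/
def recolor (i : Fin e₁) (w : Fin v₂) (Q : Ent v₁ e₁ v₂ e₂) : Ent v₁ e₁ v₂ e₂ :=
  setColor (Function.update Q.2.2 i w) Q

theorem recolor_relabelEnt (i : Fin e₁) (w : Fin v₂) (r : Relabel v₁ e₁ × Relabel v₂ e₂)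
    (Q : Ent v₁ e₁ v₂ e₂) :
    recolor i (r.2.vert w) (relabelEnt r Q) = relabelEnt r (recolor (r.1.edge i) w Q) := by
  refine Prod.ext rfl (Prod.ext rfl (funext fun k => ?_))
  by_cases hk : k = i
  · subst hk; simp [recolor, setColor, relabelEnt]
  · simp [recolor, setColor, relabelEnt, hk]

/-- The anticommutator of contraction and subdivision. -/
def lap : Chain K c d v₁ e₁ v₂ e₂ →ₗ[K] Chain K c d v₁ e₁ v₂ e₂ :=
  Chain.lift K c d (fun Q => ∑ i, ∑ w, (2 : K) • (cl K c d Q - cl K c d (recolor i w Q)))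
    fun r Q => by
      rw [Finset.smul_sum, ← Equiv.sum_comp r.1.edge fun i =>
        sgE K c d r • ∑ w, (2 : K) • (cl K c d Q - cl K c d (recolor i w Q))]
      refine Finset.sum_congr rfl fun i _ => ?_
      rw [← Equiv.sum_comp r.2.vert, Finset.smul_sum]
      refine Finset.sum_congr rfl fun w _ => ?_
      rw [recolor_relabelEnt, cl_relabelEnt, cl_relabelEnt, ← smul_sub, smul_comm]

theorem lap_cl (Q : Ent v₁ e₁ v₂ e₂) : lap K c d (cl K c d Q) =
    ∑ i, ∑ w, (2 : K) • (cl K c d Q - cl K c d (recolor i w Q)) := Chain.lift_cl _ _ _ _ _ _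

theorem brings_one_sub (i : Fin e₁) (w : Fin v₂) (Q : Ent v₁ e₁ v₂ e₂) :
    Brings (Fin.last e₁) (sub i w Q).1.1 1 (Q.1.1 i).2 := by
  refine ⟨rfl, ?_⟩
  rw [relabel_one, sub_last]

theorem contr_sub (i : Fin e₁) (w : Fin v₂) (Q : Ent v₁ e₁ v₂ e₂) :
    contr (Q.1.1 i).2 (sub i w Q) = Q := by
  refine Prod.ext (Prod.ext (funext fun k => ?_) (funext fun j => ?_))
    (Prod.ext rfl (funext fun k => ?_))
  · simp only [contr, sub_castSucc]
    by_cases h : k = i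
    · subst h; simp
    · simp [h, Prod.map_map, Function.comp_def]
  · simp [contr]
  · simp [contr]

/-- Contracting the new half undoes the subdivision, wherever its hair was attached. -/
theorem edgeTerm_last_sub (i : Fin e₁) (w : Fin v₂) (Q : Ent v₁ e₁ v₂ e₂) :
    edgeTerm K c d (Fin.last e₁) (sub i w Q) = cl K c d Q := by
  rw [edgeTerm_eq K c d (brings_one_sub i w Q), sg_one, one_smul, relabel₁, ← Prod.one_eq_mk,
    relabelEnt_one, contr_sub]

/-- For even `c` the sign comes from the transposition of edges, for odd `c` from the flip. -/
theorem sg_flipEdge_mul (i : Fin e₁) :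
    sg K c (⟨1, Equiv.swap i.castSucc (Fin.last e₁), fun _ => false⟩ : Relabel (v₁ + 1) (e₁ + 1)) *
      sg K c (flipEdge v₁ i true) = -1 := by
  by_cases hc : Even c <;>
    simp [sg, relabelSign, flipEdge, hc, Equiv.Perm.sign_swap (Fin.castSucc_ne_last i)]

/-- Contracting the old half puts the new half in its place: the edge now carries the hair at `w`
and runs backwards. Renumbering and reversal together give the sign. -/
theorem edgeTerm_self_sub (i : Fin e₁) (w : Fin v₂) (Q : Ent v₁ e₁ v₂ e₂) :
    edgeTerm K c d i.castSucc (sub i w Q) = - cl K c d (recolor i w Q) := by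
  have hb : Brings i.castSucc (sub i w Q).1.1
      ⟨1, Equiv.swap i.castSucc (Fin.last e₁), fun _ => false⟩ (Q.1.1 i).1 := by
    refine ⟨by simp, ?_⟩
    simp [relabel, flipIf]
  have hc : contr (Q.1.1 i).1 (relabel₁ ⟨1, Equiv.swap i.castSucc (Fin.last e₁), fun _ => false⟩
      (sub i w Q)) = relabel₁ (flipEdge v₁ i true) (recolor i w Q) := by
    refine Prod.ext (Prod.ext (funext fun k => ?_) (funext fun j => ?_))
      (Prod.ext rfl (funext fun k => ?_))
    · by_cases h : k = i
      · subst h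
        simp [contr, relabelEnt, relabel, flipIf, recolor, setColor, flipEdge]
        rfl
      · have : Equiv.swap i.castSucc (Fin.last e₁) k.castSucc = k.castSucc :=
          Equiv.swap_apply_of_ne_of_ne (fun h' => h (Fin.castSucc_injective _ h'))
            (Fin.castSucc_ne_last _)
        simp [contr, relabelEnt, relabel, flipIf, recolor, setColor, flipEdge, this, sub_of_ne h, h,
          Prod.map_map, Function.comp_def]
    · simp [contr, relabelEnt, recolor, setColor, flipEdge]
    · by_cases h : k = i
      · subst h
        simp [contr, relabelEnt, recolor, setColor, flipEdge]
      · have : Equiv.swap i.castSucc (Fin.last e₁) k.castSucc = k.castSucc :=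
          Equiv.swap_apply_of_ne_of_ne (fun h' => h (Fin.castSucc_injective _ h'))
            (Fin.castSucc_ne_last _)
        simp [contr, relabelEnt, recolor, setColor, flipEdge, this, h]
  rw [edgeTerm_eq K c d hb, hc, cl_relabel₁, smul_smul, sg_flipEdge_mul, neg_one_smul]

/-- Tadpoles are exactly the edges for which `edgeTerm` takes its default value `0`. -/
theorem exists_brings_iff {f : Fin (e₁ + 1)} {Γ : Graph (v₁ + 1) (e₁ + 1)} :
    (∃ r u, Brings f Γ r u) ↔ (Γ f).1 ≠ (Γ f).2 := by
  constructor
  · rintro ⟨r, u, hf, h⟩ heq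
    rw [relabel, hf] at h
    have h1 := congrArg Prod.fst h
    have h2 := congrArg Prod.snd h
    refine Fin.castSucc_ne_last u (h1.symm.trans (Eq.trans ?_ h2))
    cases r.flip (Fin.last e₁) <;> simp [flipIf, heq]
  · intro hne
    have h1 : Equiv.swap (Γ f).2 (Fin.last v₁) (Γ f).1 ≠ Fin.last v₁ := by
      rw [Ne, Equiv.swap_apply_eq_iff, Equiv.swap_apply_right]
      exact hne
    refine ⟨swapRelabel (Γ f).2 (Fin.last v₁) f (Fin.last e₁),
      (Equiv.swap (Γ f).2 (Fin.last v₁) (Γ f).1).castPred h1, by simp [swapRelabel], ?_⟩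
    rw [swapRelabel_apply, Equiv.swap_apply_right]
    ext <;> simp

theorem flipEdge_castSucc (i : Fin e₁) (b : Bool) :
    flipEdge (v₁ + 1) i.castSucc b = extRelabel (flipEdge v₁ i b) := by
  have h1 : ∀ n, extPerm (1 : Equiv.Perm (Fin n)) = 1 := fun n => Equiv.ext fun i => by
    induction i using Fin.lastCases <;> simp
  refine Relabel.ext' (h1 _).symm (h1 _).symm fun k => ?_
  induction k using Fin.lastCases <;> simp [flipEdge, extRelabel, (Fin.castSucc_ne_last _).symm]

/-- Both orders give the same pair, except that the new vertex and edge of the subdivision and the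
vertex and edge to be contracted trade places in the numbering; exchanging both costs `-1`. -/
theorem edgeTerm_sub_contr {u : Fin v₁} {Y : Ent (v₁ + 1) (e₁ + 1) v₂ e₂}
    (hY : Y.1.1 (Fin.last e₁) = (u.castSucc, Fin.last v₁)) (i : Fin e₁) (w : Fin v₂) :
    edgeTerm K c d (Fin.last e₁).castSucc (sub i.castSucc w Y)
      = - cl K c d (sub i w (contr u Y)) := by
  have hi : Fin.last e₁ ≠ i.castSucc := (Fin.castSucc_ne_last i).symm
  set r : Relabel (v₁ + 2) (e₁ + 2) := swapRelabel (Fin.last v₁).castSucc (Fin.last (v₁ + 1))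
    (Fin.last e₁).castSucc (Fin.last (e₁ + 1)) with hr
  have hu : Equiv.swap (Fin.last v₁).castSucc (Fin.last (v₁ + 1)) u.castSucc.castSucc
      = u.castSucc.castSucc := Equiv.swap_apply_of_ne_of_ne
    (fun h => Fin.castSucc_ne_last _ (Fin.castSucc_injective _ h)) (Fin.castSucc_ne_last _)
  have hb : Brings (Fin.last e₁).castSucc (sub i.castSucc w Y).1.1 r u.castSucc := by
    refine ⟨by simp [hr, swapRelabel], ?_⟩
    rw [hr, swapRelabel_apply, Equiv.swap_apply_right, sub_of_ne hi, hY]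
    simp [hu]
  have hs : ∀ z : Fin (v₁ + 1), collapse u.castSucc (Equiv.swap (Fin.last v₁).castSucc
      (Fin.last (v₁ + 1)) z.castSucc) = (collapse u z).castSucc := by
    intro z
    induction z using Fin.lastCases with
    | last => simp
    | cast z =>
      rw [Equiv.swap_apply_of_ne_of_ne
        (fun h => Fin.castSucc_ne_last _ (Fin.castSucc_injective _ h)) (Fin.castSucc_ne_last _)]
      simp
  have hl : collapse u.castSucc (Equiv.swap (Fin.last v₁).castSucc
      (Fin.last (v₁ + 1)) (Fin.last (v₁ + 1))) = Fin.last v₁ := by simp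
  have hk : ∀ k : Fin e₁, Equiv.swap (Fin.last e₁).castSucc (Fin.last (e₁ + 1))
      k.castSucc.castSucc = k.castSucc.castSucc := fun k =>
    Equiv.swap_apply_of_ne_of_ne
      (fun h => Fin.castSucc_ne_last _ (Fin.castSucc_injective _ h)) (Fin.castSucc_ne_last _)
  have hc : contr u.castSucc (relabel₁ r (sub i.castSucc w Y)) = sub i w (contr u Y) := by
    refine Prod.ext (Prod.ext (funext fun k => ?_) (funext fun j => ?_))
      (Prod.ext ?_ (funext fun k => ?_))
    · induction k using Fin.lastCases with
      | last =>
        simp only [contr, relabelEnt, hr, swapRelabel_apply, Equiv.swap_apply_left, sub_last,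
          Prod.map_apply, hs, hl, Prod.map_snd]
      | cast k =>
        simp only [contr, relabelEnt, hr, swapRelabel_apply, hk, sub_castSucc,
          (Fin.castSucc_injective _).eq_iff]
        split_ifs with h
        · simp only [Prod.map_apply, hs, hl, Prod.map_fst]
        · rw [Prod.map_map, Prod.map_map, Prod.map_map]
          congr 1 <;> (funext z; simp [hs])
    · exact hs _
    · simp [contr, relabelEnt, relabel_one]
    · induction k using Fin.lastCases with
      | last => simp [contr, relabelEnt, hr, swapRelabel]
      | cast k => simp [contr, relabelEnt, hr, swapRelabel, hk]
  have hsg : sg K c r = -1 := by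
    rw [sg, hr, relabelSign_swap _ (Fin.castSucc_ne_last _) (Fin.castSucc_ne_last _)]
    simp
  rw [edgeTerm_eq K c d hb, hc, hsg, neg_one_smul]

theorem sum_subTerm_edgeTerm_last {u : Fin v₁} {Y : Ent (v₁ + 1) (e₁ + 1) v₂ e₂}
    (hY : Y.1.1 (Fin.last e₁) = (u.castSucc, Fin.last v₁)) :
    (∑ i, ∑ b, if i = Fin.last e₁ then 0 else
      subTerm K c (edgeTerm K c d (Fin.last e₁).castSucc) i b Y)
      = - sd K c d (cl K c d (contr u Y)) := by
  rw [Fin.sum_univ_castSucc, sd_cl]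
  simp only [if_true, Finset.sum_const_zero, add_zero, Fin.castSucc_ne_last, if_false]
  rw [← Finset.sum_neg_distrib]
  refine Finset.sum_congr rfl fun i _ => ?_
  rw [← Finset.sum_neg_distrib]
  refine Finset.sum_congr rfl fun b _ => ?_
  unfold subTerm
  rw [flipEdge_castSucc, sg_ext, ← smul_neg, ← Finset.sum_neg_distrib]
  congr 1
  refine Finset.sum_congr rfl fun w _ => ?_
  have hc : contr u (relabel₁ (extRelabel (flipEdge v₁ i b)) Y)
      = relabel₁ (flipEdge v₁ i b) (contr u Y) :=
    contr_ext (flipEdge v₁ i b) (1 : Relabel v₂ e₂) u Y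
  rw [edgeTerm_sub_contr K c d (u := u) _ i w, hc]
  have := (newEdge_ext (flipEdge v₁ i b) u Y.1.1).2 hY
  exact this

/-- Relabelling reduces to the case that `k` is the last edge in standard position. If `k` is a
tadpole, it stays one when another edge is subdivided, and both sides vanish. -/
theorem sum_subTerm_edgeTerm (k : Fin (e₁ + 1)) (Q : Ent (v₁ + 1) (e₁ + 1) v₂ e₂) :
    (∑ i, ∑ b, if i = k then 0 else subTerm K c (edgeTerm K c d k.castSucc) i b Q)
      = - sd K c d (edgeTerm K c d k Q) := by
  by_cases h : ∃ r u, Brings k Q.1.1 r u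
  · obtain ⟨r, u, hb⟩ := h
    have hY : (relabel₁ r Q).1.1 (Fin.last e₁) = (u.castSucc, Fin.last v₁) := hb.2
    have h1 := sum_subTerm_edgeTerm_last K c d hY
    have h2 : (∑ i, ∑ b, if i = Fin.last e₁ then 0 else
        subTerm K c (edgeTerm K c d (Fin.last e₁).castSucc) i b (relabel₁ r Q))
        = sg K c r • ∑ i, ∑ b, if i = k then 0 else
          subTerm K c (edgeTerm K c d k.castSucc) i b Q := by
      rw [← Equiv.sum_comp r.edge (fun i => ∑ b, if i = k then 0 else
          subTerm K c (edgeTerm K c d k.castSucc) i b Q), Finset.smul_sum]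
      refine Finset.sum_congr rfl fun i _ => ?_
      rw [← sum_bool_xor (fun b => if r.edge i = k then 0 else
        subTerm K c (edgeTerm K c d k.castSucc) (r.edge i) b Q) (r.flip i), Finset.smul_sum]
      refine Finset.sum_congr rfl fun b _ => ?_
      have hik : r.edge i = k ↔ i = Fin.last e₁ := by
        rw [← hb.1, EmbeddingLike.apply_eq_iff_eq]
      rw [if_congr hik rfl rfl]
      split_ifs
      · rw [smul_zero]
      · have := subTerm_relabelEnt K c d (edgeTerm K c d (Fin.last e₁).castSucc)
          (edgeTerm K c d k.castSucc) i b (r, 1) ?_ Q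
        · rw [this, sgE_eq, sg_one, mul_one]
        · intro ρ hρ X
          rw [edgeTerm_relabelEnt, sgE_eq, sgE_eq, sg_ext]
          have : (extRelabel ρ).edge (Fin.last e₁).castSucc = k.castSucc := by
            rw [extRelabel, extPerm_castSucc, hρ, hb.1]
          rw [this]
    rw [edgeTerm_eq K c d hb, map_smul, ← smul_neg, ← h1, h2, smul_smul, sg_mul_self, one_smul]
  · rw [edgeTerm_eq_zero K c d fun r u hb => h ⟨r, u, hb⟩, map_zero, neg_zero]
    refine Finset.sum_eq_zero fun i _ => Finset.sum_eq_zero fun b _ => ?_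
    split_ifs with hik
    · rfl
    · unfold subTerm
      rw [Finset.sum_eq_zero, smul_zero]
      intro w _
      refine edgeTerm_eq_zero K c d fun r u hb => ?_
      have := exists_brings_iff.1 ⟨r, u, hb⟩
      rw [sub_of_ne (Ne.symm hik)] at this
      refine h (exists_brings_iff.2 fun heq => this ?_)
      have hfl : (relabel₁ (flipEdge (v₁ + 1) i b) Q).1.1 k = Q.1.1 k := by
        simp [relabelEnt, relabel, flipEdge, Ne.symm hik, flipIf]
      rw [hfl, Prod.map_fst, Prod.map_snd, heq]

/-- Subdivision is a homotopy between the recolorings of the edges of `Γ₁` and the identity. -/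
theorem bd_sd_add_sd_bd (x : Chain K c d (v₁ + 1) (e₁ + 1) v₂ e₂) :
    bd K c d (sd K c d x) + sd K c d (bd K c d x) = lap K c d x := by
  suffices h : bd K c d ∘ₗ sd K c d + sd K c d ∘ₗ bd K c d
      = (lap K c d : Chain K c d (v₁ + 1) (e₁ + 1) v₂ e₂ →ₗ[K] _) from LinearMap.congr_fun h x
  refine Chain.hom_ext fun Q => ?_
  rw [LinearMap.add_apply, LinearMap.comp_apply, LinearMap.comp_apply, bd_cl, sd_cl, lap_cl,
    map_sum, map_sum]
  have h1 : ∀ i b, bd K c d (subTerm K c (cl K c d) i b Q) =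
      (∑ k : Fin (e₁ + 1), subTerm K c (edgeTerm K c d k.castSucc) i b Q)
        + subTerm K c (edgeTerm K c d (Fin.last (e₁ + 1))) i b Q := by
    intro i b
    unfold subTerm
    rw [map_smul, map_sum, ← Finset.smul_sum, ← smul_add, Finset.sum_comm,
      ← Finset.sum_add_distrib]
    congr 1
    refine Finset.sum_congr rfl fun w _ => ?_
    rw [bd_cl, Fin.sum_univ_castSucc]
  have h2 : ∀ i b, subTerm K c (edgeTerm K c d (Fin.last (e₁ + 1))) i b Q
      = ∑ w : Fin v₂, cl K c d Q := by
    intro i b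
    unfold subTerm
    rw [Finset.smul_sum]
    refine Finset.sum_congr rfl fun w _ => ?_
    rw [edgeTerm_last_sub, cl_relabel₁, smul_smul, sg_mul_self, one_smul]
  have h3 : ∀ i b, subTerm K c (edgeTerm K c d i.castSucc) i b Q
      = ∑ w, - cl K c d (recolor i w Q) := by
    intro i b
    unfold subTerm
    rw [Finset.smul_sum]
    refine Finset.sum_congr rfl fun w _ => ?_
    have := recolor_relabelEnt i w (flipEdge (v₁ + 1) i b, (1 : Relabel v₂ e₂)) Q
    rw [Relabel.one_vert, Equiv.Perm.one_apply] at this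
    rw [edgeTerm_self_sub, this, flipEdge, Equiv.Perm.one_apply, ← flipEdge, cl_relabelEnt, sgE_eq,
      sg_one, mul_one, smul_neg, smul_smul, sg_mul_self, one_smul]
  -- Among the contractions of old edges, that of the subdivided edge `i` is separated; the others
  -- cancel against subdivision after contraction.
  have h4 : ∀ i b, (∑ k : Fin (e₁ + 1), subTerm K c (edgeTerm K c d k.castSucc) i b Q) =
      subTerm K c (edgeTerm K c d i.castSucc) i b Q
        + ∑ k : Fin (e₁ + 1), if i = k then 0 else subTerm K c (edgeTerm K c d k.castSucc) i b Q := by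
    intro i b
    rw [← Finset.add_sum_erase _ _ (Finset.mem_univ i)]
    congr 1
    rw [← Finset.add_sum_erase _ (fun k => if i = k then 0 else _) (Finset.mem_univ i), if_pos rfl,
      zero_add]
    exact Finset.sum_congr rfl fun k hk => (if_neg (Finset.ne_of_mem_erase hk).symm).symm
  have h5 : (∑ i, ∑ b, (∑ k : Fin (e₁ + 1), if i = k then 0 else
      subTerm K c (edgeTerm K c d k.castSucc) i b Q)) = - ∑ k, sd K c d (edgeTerm K c d k Q) := by
    rw [← Finset.sum_neg_distrib,
      Finset.sum_congr rfl fun k _ => (sum_subTerm_edgeTerm K c d k Q).symm, Finset.sum_comm]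
    rw [Finset.sum_congr rfl fun i _ => Finset.sum_comm, Finset.sum_comm]
    exact Finset.sum_congr rfl fun k _ => Finset.sum_comm
  -- Both halves of the edge `i` contribute the same, whence the factor `2`.
  have h6 : ∀ i, bd K c d (∑ b, subTerm K c (cl K c d) i b Q) =
      (∑ b, ∑ k : Fin (e₁ + 1), if i = k then 0 else
        subTerm K c (edgeTerm K c d k.castSucc) i b Q)
      + ∑ w, (2 : K) • (cl K c d Q - cl K c d (recolor i w Q)) := by
    intro i
    rw [map_sum, Finset.sum_congr rfl fun b _ => (h1 i b).trans (by rw [h4, h2, h3]),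
      Fintype.sum_bool, Fintype.sum_bool, ← Finset.smul_sum, two_smul, Finset.sum_sub_distrib,
      Finset.sum_neg_distrib]
    abel
  rw [Finset.sum_congr rfl fun i _ => h6 i, Finset.sum_add_distrib, h5]
  abel

end Subdivision

end GraphCplx

end

noncomputable section

namespace GraphCplx

/-! ### Chains as functions -/

section Orbit

variable (K : Type*) [Field K] (c d : ℤ) {v₁ e₁ v₂ e₂ : ℕ}

open Classical in
/-- The function on labelled pairs given by the signed sum over an orbit. -/
def orb : Chain K c d v₁ e₁ v₂ e₂ →ₗ[K] (Ent v₁ e₁ v₂ e₂ → K) :=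
  Chain.lift K c d (fun X P => ∑ r, if relabelEnt r X = P then sgE K c d r else 0) fun ρ X => by
    funext P
    rw [Pi.smul_apply, smul_eq_mul, Finset.mul_sum, ← Equiv.sum_comp (Equiv.mulRight ρ)
      fun r => sgE K c d ρ * if relabelEnt r X = P then sgE K c d r else 0]
    refine Finset.sum_congr rfl fun r _ => ?_
    rw [Equiv.coe_mulRight, relabelEnt_mul, mul_ite, mul_zero, sgE_mul, mul_left_comm,
      sgE_mul_self, mul_one]

open Classical in
theorem orb_cl (X P : Ent v₁ e₁ v₂ e₂) : orb K c d (cl K c d X) P =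
    ∑ r, if relabelEnt r X = P then sgE K c d r else 0 := by
  rw [orb, Chain.lift_cl]

theorem orb_antiInv (x : Chain K c d v₁ e₁ v₂ e₂) : AntiInv c d (orb K c d x) := by
  classical
  intro ρ P
  change orb K c d x (relabelEnt ρ P) = sgE K c d ρ * orb K c d x P
  suffices h : LinearMap.proj (relabelEnt ρ P) ∘ₗ orb K c d
      = sgE K c d ρ • (LinearMap.proj P ∘ₗ orb K c d) from LinearMap.congr_fun h x
  refine Chain.hom_ext fun X => ?_
  simp only [LinearMap.comp_apply, LinearMap.proj_apply, LinearMap.smul_apply, smul_eq_mul, orb_cl]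
  rw [Finset.mul_sum, ← Equiv.sum_comp (Equiv.mulLeft ρ)]
  refine Finset.sum_congr rfl fun r _ => ?_
  rw [Equiv.coe_mulLeft, relabelEnt_mul, if_congr (relabelEnt_injective ρ).eq_iff rfl rfl, sgE_mul,
    mul_ite,
    mul_zero]

/-- All members of an orbit have the same class up to sign, so summation against classes inverts
`orb` up to the order of the group. With `orb_sum_smul_cl` this identifies chains with
anti-invariant functions in characteristic zero. -/
theorem sum_orb_smul_cl (x : Chain K c d v₁ e₁ v₂ e₂) :
    ∑ P, orb K c d x P • cl K c d P =
      (Fintype.card (Relabel v₁ e₁ × Relabel v₂ e₂) : K) • x := by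
  classical
  have h : ∑ P, (LinearMap.proj P ∘ₗ orb K c d).smulRight (cl K c d P)
      = (Fintype.card (Relabel v₁ e₁ × Relabel v₂ e₂) : K) •
        (LinearMap.id : Chain K c d v₁ e₁ v₂ e₂ →ₗ[K] _) := by
    refine Chain.hom_ext fun X => ?_
    simp only [LinearMap.sum_apply, LinearMap.smulRight_apply, LinearMap.comp_apply,
      LinearMap.proj_apply, orb_cl, Finset.sum_smul, ite_smul, zero_smul, LinearMap.smul_apply,
      LinearMap.id_apply]
    rw [Finset.sum_comm]
    simp only [Finset.sum_ite_eq, Finset.mem_univ, if_true, cl_relabelEnt, smul_smul, sgE_mul_self,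
      one_smul, Finset.sum_const, Finset.card_univ, Nat.cast_smul_eq_nsmul]
  simpa using LinearMap.congr_fun h x

theorem card_relabel_ne_zero [CharZero K] :
    (Fintype.card (Relabel v₁ e₁ × Relabel v₂ e₂) : K) ≠ 0 :=
  Nat.cast_ne_zero.2 Fintype.card_ne_zero

theorem orb_injective [CharZero K] :
    Function.Injective (orb K c d : Chain K c d v₁ e₁ v₂ e₂ →ₗ[K] _) := by
  rw [← LinearMap.ker_eq_bot, LinearMap.ker_eq_bot']
  intro x hx
  have := sum_orb_smul_cl K c d x
  simpa [hx, card_relabel_ne_zero] using this.symm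

theorem orb_sum_smul_cl {a : Ent v₁ e₁ v₂ e₂ → K} (ha : AntiInv c d a) :
    orb K c d (∑ P, a P • cl K c d P) =
      (Fintype.card (Relabel v₁ e₁ × Relabel v₂ e₂) : K) • a := by
  classical
  funext Q
  rw [map_sum, Finset.sum_apply]
  simp only [map_smul, Pi.smul_apply, orb_cl, smul_eq_mul, Finset.mul_sum]
  rw [Finset.sum_comm]
  have h : ∀ r : Relabel v₁ e₁ × Relabel v₂ e₂,
      (∑ P, a P * if relabelEnt r P = Q then sgE K c d r else 0) = a Q := by
    intro r
    have hr : ∀ P, relabelEnt r P = Q ↔ P = relabelEnt r⁻¹ Q := by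
      intro P
      rw [← (relabelEnt_injective r⁻¹).eq_iff, ← relabelEnt_mul, inv_mul_cancel, relabelEnt_one]
    simp only [hr, mul_ite, mul_zero, Finset.sum_ite_eq', Finset.mem_univ, if_true]
    rw [ha r⁻¹ Q]
    change sgE K c d r⁻¹ * a Q * sgE K c d r = a Q
    rw [sgE_inv, mul_right_comm, sgE_mul_self, one_mul]
  rw [Finset.sum_congr rfl fun r _ => h r]
  simp

/-! ### Transposed splitting as contraction -/

theorem extPerm_injective {n : ℕ} : Function.Injective (extPerm (n := n)) := by
  intro σ τ h
  ext i
  have := congrArg (fun ρ => ρ i.castSucc) h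
  simpa using congrArg Fin.val this

theorem extRelabel_injective {v e : ℕ} : Function.Injective (extRelabel (v := v) (e := e)) := by
  intro r s h
  refine Relabel.ext' (extPerm_injective (congrArg Relabel.vert h))
    (extPerm_injective (congrArg Relabel.edge h)) fun i => ?_
  have := congrFun (congrArg Relabel.flip h) i.castSucc
  simpa [extRelabel] using this

theorem brings_reverseLast {f : Fin (e₁ + 1)} {Γ : Graph (v₁ + 1) (e₁ + 1)}
    {r : Relabel (v₁ + 1) (e₁ + 1)} {u : Fin v₁} (h : Brings f Γ r u) :
    Brings f Γ (reverseLast u * r) u := by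
  refine ⟨by simpa [reverseLast] using h.1, ?_⟩
  rw [relabel_mul, relabel]
  simp [h.2, flipIf, reverseLast]

/-- The relabellings that bring `f` into standard position form two cosets of the relabellings of
the smaller graph, one for each direction of the edge. This is the source of the factor `2` in
`dst_orb`. -/
theorem exists_eq_of_brings {f : Fin (e₁ + 1)} {Γ : Graph (v₁ + 1) (e₁ + 1)}
    {r r₀ : Relabel (v₁ + 1) (e₁ + 1)} {u u₀ : Fin v₁} (h₀ : Brings f Γ r₀ u₀)
    (h : Brings f Γ r u) :
    ∃ s, extRelabel s * r₀ = r ∨ extRelabel s * (reverseLast u₀ * r₀) = r := by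
  have key : ∀ r₁, Brings f Γ r₁ u₀ → (r * r₁⁻¹).flip (Fin.last e₁) = false →
      ∃ s, extRelabel s * r₁ = r := by
    intro r₁ h₁ hf
    obtain ⟨m, rfl⟩ : ∃ m, r = m * r₁ := ⟨r * r₁⁻¹, by simp⟩
    rw [mul_inv_cancel_right] at hf
    have he : m.edge (Fin.last e₁) = Fin.last e₁ := r₁.edge.injective (by rw [h₁.1]; exact h.1)
    have hv := h.2
    rw [relabel_mul, relabel, he, hf, h₁.2] at hv
    obtain ⟨s, rfl⟩ := exists_extRelabel (congrArg Prod.snd hv) he hf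
    exact ⟨s, rfl⟩
  cases hf : (r * r₀⁻¹).flip (Fin.last e₁) with
  | false => exact (key r₀ h₀ hf).imp fun s hs => Or.inl hs
  | true =>
    refine (key _ (brings_reverseLast h₀) ?_).imp fun s hs => Or.inr hs
    obtain ⟨m, rfl⟩ : ∃ m, r = m * r₀ := ⟨r * r₀⁻¹, by simp⟩
    obtain ⟨n, rfl⟩ : ∃ n, m = n * reverseLast u₀ := ⟨m * (reverseLast u₀)⁻¹, by simp⟩
    have : n * reverseLast u₀ * r₀ * (reverseLast u₀ * r₀)⁻¹ = n := by group
    rw [this]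
    have he : n.edge (Fin.last e₁) = Fin.last e₁ := r₀.edge.injective (by
      have := h.1.trans h₀.1.symm
      simpa [reverseLast] using this)
    rw [mul_inv_cancel_right] at hf
    simpa [reverseLast, he] using hf

open Classical in
-- Summation over one of the two cosets produces the orbit sum of the contracted pair.
theorem sum_spl_relabel {f : Fin (e₁ + 1)} {X : Ent (v₁ + 1) (e₁ + 1) v₂ e₂}
    {r₀ : Relabel (v₁ + 1) (e₁ + 1)} {u₀ : Fin v₁} (h₀ : Brings f X.1.1 r₀ u₀)
    (P : Ent v₁ e₁ v₂ e₂) :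
    (∑ s : Relabel v₁ e₁, ∑ r₂ : Relabel v₂ e₂,
      if Spl P (relabelEnt (extRelabel s * r₀, r₂) X) then sgE K c d (extRelabel s * r₀, r₂) else 0)
      = orb K c d (edgeTerm K c d f X) P := by
  rw [edgeTerm_eq K c d h₀, map_smul, Pi.smul_apply, orb_cl, Fintype.sum_prod_type,
    Finset.smul_sum]
  refine Finset.sum_congr rfl fun s _ => ?_
  rw [Finset.smul_sum]
  refine Finset.sum_congr rfl fun r₂ _ => ?_
  have h1 : relabelEnt (extRelabel s * r₀, r₂) X = relabelEnt (extRelabel s, r₂) (relabel₁ r₀ X) := by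
    rw [relabel₁, ← relabelEnt_mul]
    simp
  have h2 : Spl P (relabelEnt (extRelabel s * r₀, r₂) X) ↔
      relabelEnt (s, r₂) (contr u₀ (relabel₁ r₀ X)) = P := by
    have h3 : Spl (relabelEnt (s, r₂) (contr u₀ (relabel₁ r₀ X)))
        (relabelEnt (extRelabel s * r₀, r₂) X) := by
      rw [h1]
      exact (spl_relabel (s, r₂) _ _).2 (spl_iff.2 ⟨u₀, h₀.2, rfl⟩)
    exact ⟨fun h => h3.unique h, fun h => h ▸ h3⟩
  rw [if_congr h2 rfl rfl, smul_ite, smul_zero, sgE_eq, sgE_eq, sg_mul, sg_ext, smul_eq_mul]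
  congr 1
  ring

/-- The transpose of the differential is twice the contraction of edges. -/
theorem dst_orb [CharZero K] (x : Chain K c d (v₁ + 1) (e₁ + 1) v₂ e₂) :
    dst (orb K c d x) = (2 : K) • orb K c d (bd K c d x) := by
  classical
  let D : (Ent (v₁ + 1) (e₁ + 1) v₂ e₂ → K) →ₗ[K] (Ent v₁ e₁ v₂ e₂ → K) :=
    { toFun := dst
      map_add' := fun a b => by
        funext P
        simp only [dst, Pi.add_apply, ← Finset.sum_add_distrib]
        refine Finset.sum_congr rfl fun P' _ => ?_
        split_ifs <;> simp
      map_smul' := fun t a => by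
        funext P
        simp [dst, Finset.mul_sum] }
  suffices h : D ∘ₗ orb K c d = (2 : K) • (orb K c d ∘ₗ bd K c d) from LinearMap.congr_fun h x
  refine Chain.hom_ext fun X => ?_
  funext P
  have h1 : dst (orb K c d (cl K c d X)) P = ∑ r : Relabel (v₁ + 1) (e₁ + 1) × Relabel v₂ e₂,
      if Spl P (relabelEnt r X) then sgE K c d r else 0 := by
    have : ∀ P', (if Spl P P' then orb K c d (cl K c d X) P' else 0) =
        ∑ r, if relabelEnt r X = P' then (if Spl P P' then sgE K c d r else 0) else 0 := by
      intro P'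
      rw [orb_cl]
      split_ifs <;> simp
    unfold dst
    rw [Finset.sum_congr rfl fun P' _ => this P', Finset.sum_comm]
    exact Finset.sum_congr rfl fun r _ => by simp
  -- The relabellings are sorted by the edge that they move to the last place; an edge that is not a
  -- tadpole contributes two cosets, a tadpole nothing.
  have h2 : ∀ f, (∑ r₁ : Relabel (v₁ + 1) (e₁ + 1), if r₁.edge (Fin.last e₁) = f then
      ∑ r₂ : Relabel v₂ e₂, (if Spl P (relabelEnt (r₁, r₂) X) then sgE K c d (r₁, r₂) else 0)
      else 0) = 2 * orb K c d (edgeTerm K c d f X) P := by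
    intro f
    have h3 : ∀ (r₁ : Relabel (v₁ + 1) (e₁ + 1)) (r₂ : Relabel v₂ e₂),
        r₁.edge (Fin.last e₁) = f → Spl P (relabelEnt (r₁, r₂) X) → ∃ u, Brings f X.1.1 r₁ u := by
      intro r₁ r₂ hf hs
      obtain ⟨u, hu, -⟩ := spl_iff.1 hs
      exact ⟨u, hf, hu⟩
    by_cases hb : ∃ r u, Brings f X.1.1 r u
    · obtain ⟨r₀, u₀, h₀⟩ := hb
      let j : Relabel v₁ e₁ ⊕ Relabel v₁ e₁ → Relabel (v₁ + 1) (e₁ + 1) :=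
        Sum.elim (fun s => extRelabel s * r₀) fun s => extRelabel s * (reverseLast u₀ * r₀)
      have hj : Function.Injective j := by
        have hne : ∀ s t : Relabel v₁ e₁,
            extRelabel s * r₀ ≠ extRelabel t * (reverseLast u₀ * r₀) := by
          intro s t h
          rw [← mul_assoc, mul_left_inj] at h
          have := congrFun (congrArg Relabel.flip h) (Fin.last e₁)
          simp [extRelabel, reverseLast] at this
        rintro (s | s) (t | t) h
        · rw [extRelabel_injective (mul_right_cancel h)]
        · exact absurd h (hne s t)
        · exact absurd h.symm (hne t s)
        · rw [extRelabel_injective (mul_right_cancel h)]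
      rw [← Fintype.sum_of_injective j hj (fun s => ∑ r₂ : Relabel v₂ e₂,
          if Spl P (relabelEnt (j s, r₂) X) then sgE K c d (j s, r₂) else 0), Fintype.sum_sum_type]
      · change (∑ s, ∑ r₂ : Relabel v₂ e₂, (if Spl P (relabelEnt (extRelabel s * r₀, r₂) X) then
            sgE K c d (extRelabel s * r₀, r₂) else 0)) + (∑ s, ∑ r₂ : Relabel v₂ e₂,
            if Spl P (relabelEnt (extRelabel s * (reverseLast u₀ * r₀), r₂) X) then
            sgE K c d (extRelabel s * (reverseLast u₀ * r₀), r₂) else 0) = _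
        rw [sum_spl_relabel K c d h₀, sum_spl_relabel K c d (brings_reverseLast h₀), two_mul]
      · intro r hr
        by_cases hf : r.edge (Fin.last e₁) = f
        · rw [if_pos hf]
          refine Finset.sum_eq_zero fun r₂ _ => if_neg fun hs => hr ?_
          obtain ⟨u, hu⟩ := h3 r r₂ hf hs
          obtain ⟨s, hs | hs⟩ := exists_eq_of_brings h₀ hu
          · exact ⟨Sum.inl s, hs⟩
          · exact ⟨Sum.inr s, hs⟩
        · rw [if_neg hf]
      · rintro (s | s)
        · have : (j (Sum.inl s)).edge (Fin.last e₁) = f := by simpa [j, extRelabel] using h₀.1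
          rw [if_pos this]
        · have : (j (Sum.inr s)).edge (Fin.last e₁) = f := by
            simpa [j, extRelabel, reverseLast] using h₀.1
          rw [if_pos this]
    · rw [edgeTerm_eq_zero K c d fun r u h => hb ⟨r, u, h⟩, map_zero, Pi.zero_apply, mul_zero]
      refine Finset.sum_eq_zero fun r _ => ?_
      split_ifs with hf
      · exact Finset.sum_eq_zero fun r₂ _ => if_neg fun hs => hb ⟨r, h3 r r₂ hf hs⟩
      · rfl
  change dst (orb K c d (cl K c d X)) P = 2 * orb K c d (bd K c d (cl K c d X)) P
  rw [h1, bd_cl, map_sum, Finset.sum_apply, Finset.mul_sum,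
    ← Finset.sum_congr rfl fun f _ => h2 f, Finset.sum_comm, Fintype.sum_prod_type]
  exact Finset.sum_congr rfl fun r₁ _ => by simp

variable {K} in
theorem dst_smul (t : K) (a : Ent (v₁ + 1) (e₁ + 1) v₂ e₂ → K) : dst (t • a) = t • dst a := by
  funext P
  simp [dst, Finset.mul_sum]

/-- Transported from `dst_dst` through the injection `orb`. -/
theorem bd_bd [CharZero K] (x : Chain K c d (v₁ + 2) (e₁ + 2) v₂ e₂) :
    bd K c d (bd K c d x) = 0 := by
  apply orb_injective K c d
  have h : dst (dst (orb K c d x)) = 0 := funext (dst_dst (orb_antiInv K c d x))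
  rw [dst_orb, dst_smul, dst_orb, smul_smul] at h
  rw [map_zero]
  exact (smul_eq_zero.1 h).resolve_left (by norm_num)

/-! ### Exchange of the two graphs -/

/-- Exchanging the roles of the two graphs. -/
def Chain.swap : Chain K c d v₁ e₁ v₂ e₂ →ₗ[K] Chain K d c v₂ e₂ v₁ e₁ :=
  Chain.lift K c d (fun P => cl K d c P.swap) fun r P => by
    change cl K d c (relabelEnt r.swap P.swap) = _
    rw [cl_relabelEnt, sgE, sgE, entSign_swap]

theorem Chain.swap_cl (P : Ent v₁ e₁ v₂ e₂) :
    Chain.swap K c d (cl K c d P) = cl K d c P.swap := Chain.lift_cl _ _ _ _ _ _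

theorem Chain.swap_swap (x : Chain K c d v₁ e₁ v₂ e₂) :
    Chain.swap K d c (Chain.swap K c d x) = x := by
  suffices h : Chain.swap K d c ∘ₗ Chain.swap K c d
      = (LinearMap.id : Chain K c d v₁ e₁ v₂ e₂ →ₗ[K] _) from LinearMap.congr_fun h x
  refine Chain.hom_ext fun P => ?_
  simp [Chain.swap_cl]

theorem orb_swap (x : Chain K c d v₁ e₁ v₂ e₂) (P : Ent v₂ e₂ v₁ e₁) :
    orb K d c (Chain.swap K c d x) P = orb K c d x P.swap := by
  classical
  suffices h : LinearMap.proj P ∘ₗ orb K d c ∘ₗ Chain.swap K c d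
      = LinearMap.proj P.swap ∘ₗ orb K c d from LinearMap.congr_fun h x
  refine Chain.hom_ext fun X => ?_
  simp only [LinearMap.comp_apply, LinearMap.proj_apply, Chain.swap_cl, orb_cl]
  rw [← Equiv.sum_comp (Equiv.prodComm _ _)]
  refine Finset.sum_congr rfl fun r _ => ?_
  have : relabelEnt (Equiv.prodComm _ _ r) X.swap = P ↔ relabelEnt r X = P.swap :=
    ⟨fun h => by rw [← h]; rfl, fun h => by rw [← Prod.swap_swap P, ← h]; rfl⟩
  rw [if_congr this rfl rfl]
  congr 1
  rw [sgE, sgE, ← entSign_swap]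
  rfl

/-- The sum of the contractions of all edges of `Γ₂`. -/
def bd₂ : Chain K c d v₁ e₁ (v₂ + 1) (e₂ + 1) →ₗ[K] Chain K c d v₁ e₁ v₂ e₂ :=
  Chain.swap K d c ∘ₗ bd K d c ∘ₗ Chain.swap K c d

theorem bd₂_bd₂ [CharZero K] (x : Chain K c d v₁ e₁ (v₂ + 2) (e₂ + 2)) :
    bd₂ K c d (bd₂ K c d x) = 0 := by
  simp [bd₂, Chain.swap_swap, bd_bd]

theorem dst₂_orb [CharZero K] (x : Chain K c d v₁ e₁ (v₂ + 1) (e₂ + 1)) :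
    dst₂ (orb K c d x) = (2 : K) • orb K c d (bd₂ K c d x) := by
  funext P
  have h : (fun Q : Ent (v₂ + 1) (e₂ + 1) v₁ e₁ => orb K c d x Q.swap)
      = orb K d c (Chain.swap K c d x) := funext fun Q => (orb_swap K c d x Q).symm
  rw [dst₂, h, dst_orb, Pi.smul_apply, Pi.smul_apply, bd₂, LinearMap.comp_apply,
    LinearMap.comp_apply, orb_swap]

theorem bd_bd₂ [CharZero K] (x : Chain K c d (v₁ + 1) (e₁ + 1) (v₂ + 1) (e₂ + 1)) :
    bd K c d (bd₂ K c d x) = bd₂ K c d (bd K c d x) := by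
  apply orb_injective K c d
  have h : dst (dst₂ (orb K c d x)) = dst₂ (dst (orb K c d x)) := funext (dst_dst₂ _)
  have h3 : ∀ a : Ent v₁ e₁ (v₂ + 1) (e₂ + 1) → K, dst₂ ((2 : K) • a) = (2 : K) • dst₂ a := by
    intro a
    funext P
    simp [dst₂, dst, Finset.mul_sum]
  rw [dst₂_orb, dst_smul, dst_orb, dst_orb, h3, dst₂_orb, smul_smul, smul_smul] at h
  exact smul_right_injective _ (by norm_num : (2 * 2 : K) ≠ 0) h

end Orbit

end GraphCplx

end

noncomputable section

namespace GraphCplx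

/-! ### Connectedness and valences under splitting and subdivision -/

section Geometry

/-- Connectedness in terms of predicates that are constant along the relation can be pulled back
along merging of vertices without handling paths. -/
theorem fromRel_connected_iff {V : Type*} {R : V → V → Prop} :
    (SimpleGraph.fromRel R).Connected ↔
      Nonempty V ∧ ∀ f : V → Prop, (∀ a b, R a b → (f a ↔ f b)) → ∀ a b, f a → f b := by
  constructor
  · intro h
    refine ⟨h.nonempty, fun f hf a b ha => ?_⟩
    obtain ⟨p⟩ := h.preconnected a b
    induction p with
    | nil => exact ha
    | cons hadj p ih =>
      refine ih ?_
      rw [SimpleGraph.fromRel_adj] at hadj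
      rcases hadj.2 with h | h
      · exact (hf _ _ h).1 ha
      · exact (hf _ _ h).2 ha
  · rintro ⟨hne, h⟩
    refine (SimpleGraph.connected_iff _).2 ⟨fun a b => ?_, hne⟩
    refine h (fun x => (SimpleGraph.fromRel R).Reachable a x) ?_ a b (SimpleGraph.Reachable.refl a)
    intro x y hxy
    by_cases hne : x = y
    · rw [hne]
    · have : (SimpleGraph.fromRel R).Adj x y := (SimpleGraph.fromRel_adj R x y).2 ⟨hne, Or.inl hxy⟩
      exact ⟨fun hx => hx.trans this.reachable, fun hy => hy.trans this.symm.reachable⟩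

variable {v e : ℕ}

theorem isConn_iff {Γ : Graph v e} : IsConn Γ ↔
    Nonempty (Fin v) ∧ ∀ f : Fin v → Prop, (∀ i, f (Γ i).1 ↔ f (Γ i).2) → ∀ a b, f a → f b := by
  rw [IsConn, fromRel_connected_iff]
  refine and_congr Iff.rfl (forall_congr' fun f => imp_congr_left ⟨fun h i => h _ _ ⟨i, rfl⟩, ?_⟩)
  rintro h a b ⟨i, hi⟩
  simpa [hi] using h i

theorem SplitsAt.isConn_iff {u : Fin v} {Γ : Graph v e} {Γ' : Graph (v + 1) (e + 1)}
    (h : SplitsAt u Γ Γ') : IsConn Γ' ↔ IsConn Γ := by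
  obtain ⟨hl, hc⟩ := h
  rw [GraphCplx.isConn_iff, GraphCplx.isConn_iff]
  constructor
  · rintro ⟨-, h⟩
    refine ⟨⟨u⟩, fun f hf a b ha => ?_⟩
    have := h (fun y => f (collapse u y)) ?_ a.castSucc b.castSucc (by simpa using ha)
    · simpa using this
    intro i
    induction i using Fin.lastCases with
    | last => simp [hl]
    | cast i => simpa [← hc i] using hf i
  · rintro ⟨-, h⟩
    refine ⟨⟨Fin.last v⟩, fun f hf => ?_⟩
    have hu : f u.castSucc ↔ f (Fin.last v) := by simpa [hl] using hf (Fin.last e)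
    have hcol : ∀ y, f (collapse u y).castSucc ↔ f y := by
      intro y
      induction y using Fin.lastCases <;> simp [hu]
    intro a b ha
    refine (hcol b).1 (h (fun x => f x.castSucc) ?_ _ _ ((hcol a).2 ha))
    intro i
    rw [← hc i, Prod.map_fst, Prod.map_snd, hcol, hcol]
    exact hf i.castSucc

theorem SplitsAt.valence_self {u : Fin v} {Γ : Graph v e} {Γ' : Graph (v + 1) (e + 1)}
    (h : SplitsAt u Γ Γ') :
    valence Γ u + 2 = valence Γ' u.castSucc + valence Γ' (Fin.last v) := by
  obtain ⟨hl, hc⟩ := h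
  unfold valence
  rw [Fin.sum_univ_castSucc, Fin.sum_univ_castSucc, hl]
  simp only [Fin.castSucc_ne_last, (Fin.castSucc_ne_last u).symm, if_true, if_false]
  have : ∀ i, ((if (Γ i).1 = u then 1 else 0) + (if (Γ i).2 = u then 1 else 0) : ℕ) =
      ((if (Γ' i.castSucc).1 = u.castSucc then 1 else 0)
        + (if (Γ' i.castSucc).2 = u.castSucc then 1 else 0))
      + ((if (Γ' i.castSucc).1 = Fin.last v then 1 else 0)
        + (if (Γ' i.castSucc).2 = Fin.last v then 1 else 0)) := by
    intro i
    rw [← hc i, Prod.map_fst, Prod.map_snd, collapse_ite, collapse_ite]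
    ring
  rw [Finset.sum_congr rfl fun i _ => this i, Finset.sum_add_distrib]
  ring

theorem SplitsAt.valence_of_ne {u x : Fin v} {Γ : Graph v e} {Γ' : Graph (v + 1) (e + 1)}
    (h : SplitsAt u Γ Γ') (hx : x ≠ u) : valence Γ' x.castSucc = valence Γ x := by
  obtain ⟨hl, hc⟩ := h
  unfold valence
  rw [Fin.sum_univ_castSucc, hl]
  have hxu' : u.castSucc ≠ x.castSucc := fun h => hx (Fin.castSucc_injective _ h).symm
  simp only [hxu', (Fin.castSucc_ne_last x).symm, if_false, add_zero]
  refine Finset.sum_congr rfl fun i _ => ?_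
  rw [← hc i]
  simp only [Prod.map_fst, Prod.map_snd, collapse_eq_iff hx]

/-- Connected graphs all of whose vertices are at least bivalent. -/
def IsGC (Γ : Graph v e) : Prop := IsConn Γ ∧ ∀ x, 2 ≤ valence Γ x

theorem isGC_relabel (r : Relabel v e) (Γ : Graph v e) : IsGC (relabel r Γ) ↔ IsGC Γ :=
  and_congr (isConn_relabel r Γ) (forall_valence_relabel r Γ fun n => 2 ≤ n)

theorem SplitsAt.isGC {u : Fin v} {Γ : Graph v e} {Γ' : Graph (v + 1) (e + 1)}
    (h : SplitsAt u Γ Γ') (hΓ : IsGC Γ') : IsGC Γ := by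
  refine ⟨h.isConn_iff.1 hΓ.1, fun x => ?_⟩
  by_cases hx : x = u
  · subst hx
    have h1 := h.valence_self
    have h2 := hΓ.2 x.castSucc
    have h3 := hΓ.2 (Fin.last v)
    omega
  · rw [← h.valence_of_ne hx]
    exact hΓ.2 _

variable {v₁ e₁ v₂ e₂ : ℕ}

theorem splitsAt_contr {u : Fin v₁} {X : Ent (v₁ + 1) (e₁ + 1) v₂ e₂}
    (h : X.1.1 (Fin.last e₁) = (u.castSucc, Fin.last v₁)) : SplitsAt u (contr u X).1.1 X.1.1 :=
  ⟨h, fun _ => rfl⟩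

/-- The new vertex is bivalent and the other valences do not change. Here it matters that bivalent
vertices are admitted in `GC_c`. -/
theorem isGC_sub (i : Fin e₁) (w : Fin v₂) (Q : Ent v₁ e₁ v₂ e₂) (h : IsGC Q.1.1) :
    IsGC (sub i w Q).1.1 := by
  have hs : SplitsAt (Q.1.1 i).2 Q.1.1 (sub i w Q).1.1 := by
    have := splitsAt_contr (u := (Q.1.1 i).2) (X := sub i w Q) (sub_last i w Q)
    rwa [contr_sub] at this
  have hl : valence (sub i w Q).1.1 (Fin.last v₁) = 2 := by
    unfold valence
    rw [Fin.sum_univ_castSucc, sub_last, Finset.sum_eq_single i]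
    · simp [Fin.castSucc_ne_last]
    · intro k _ hk
      rw [sub_of_ne hk]
      simp [Fin.castSucc_ne_last]
    · simp
  refine ⟨hs.isConn_iff.2 h.1, fun x => ?_⟩
  induction x using Fin.lastCases with
  | last => exact hl.ge
  | cast x =>
    by_cases hx : x = (Q.1.1 i).2
    · have h1 := hs.valence_self
      have h2 := h.2 x
      rw [hx] at h2 ⊢
      omega
    · rw [hs.valence_of_ne hx]
      exact h.2 x

end Geometry

/-! ### Subspaces of chains -/

section Subspaces

variable (K : Type*) [Field K] (c d : ℤ) (v₁ e₁ v₂ e₂ : ℕ)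

/-- The span of the pairs of connected graphs with vertices that are at least bivalent. -/
def gcChains : Submodule K (Chain K c d v₁ e₁ v₂ e₂) :=
  Submodule.span K {z | ∃ P, (IsGC P.1.1 ∧ IsGC P.2.1) ∧ z = cl K c d P}

/-- The span of the differences of pairs that differ in the attachment of the edges of `Γ₁`. -/
def colorDiff : Submodule K (Chain K c d v₁ e₁ v₂ e₂) :=
  Submodule.span K {z | ∃ P f, z = cl K c d P - cl K c d (setColor f P)}

/-- Replace the hair attachments of the edges of `Γ₂`. -/
def setHair {v₁ e₁ v₂ e₂ : ℕ} (f : Fin e₂ → Fin v₁) (Q : Ent v₁ e₁ v₂ e₂) : Ent v₁ e₁ v₂ e₂ :=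
  ((Q.1.1, f), Q.2)

/-- The span of the differences of pairs that differ in the attachment of the edges of `Γ₂`. -/
def hairDiff : Submodule K (Chain K c d v₁ e₁ v₂ e₂) :=
  Submodule.span K {z | ∃ P f, z = cl K c d P - cl K c d (setHair f P)}

variable {K c d v₁ e₁ v₂ e₂}

theorem cl_mem_gcChains {P : Ent v₁ e₁ v₂ e₂} (h : IsGC P.1.1 ∧ IsGC P.2.1) :
    cl K c d P ∈ gcChains K c d v₁ e₁ v₂ e₂ := Submodule.subset_span ⟨P, h, rfl⟩

theorem sub_setColor_mem (P : Ent v₁ e₁ v₂ e₂) (f : Fin e₁ → Fin v₂) :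
    cl K c d P - cl K c d (setColor f P) ∈ colorDiff K c d v₁ e₁ v₂ e₂ :=
  Submodule.subset_span ⟨P, f, rfl⟩

theorem sub_setHair_mem (P : Ent v₁ e₁ v₂ e₂) (f : Fin e₂ → Fin v₁) :
    cl K c d P - cl K c d (setHair f P) ∈ hairDiff K c d v₁ e₁ v₂ e₂ :=
  Submodule.subset_span ⟨P, f, rfl⟩

/-- The two pairs share the graph `Γ₁`, so one relabelling computes the contraction of `f` in both.
-/
theorem edgeTerm_sub_mem {N : Submodule K (Chain K c d v₁ e₁ v₂ e₂)}
    {X Y : Ent (v₁ + 1) (e₁ + 1) v₂ e₂} (hXY : Y.1.1 = X.1.1)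
    (h : ∀ r u, cl K c d (contr u (relabel₁ r X)) - cl K c d (contr u (relabel₁ r Y)) ∈ N)
    (f : Fin (e₁ + 1)) : edgeTerm K c d f X - edgeTerm K c d f Y ∈ N := by
  by_cases hb : ∃ r u, Brings f X.1.1 r u
  · obtain ⟨r, u, hb⟩ := hb
    rw [edgeTerm_eq K c d hb, edgeTerm_eq K c d (hXY.symm ▸ hb), ← smul_sub]
    exact N.smul_mem _ (h r u)
  · rw [edgeTerm_eq_zero K c d fun r u h => hb ⟨r, u, h⟩,
      edgeTerm_eq_zero K c d fun r u h => hb ⟨r, u, hXY ▸ h⟩, sub_zero]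
    exact N.zero_mem

theorem bd_mem_gcChains {x : Chain K c d (v₁ + 1) (e₁ + 1) v₂ e₂} (hx : x ∈ gcChains K c d _ _ _ _) :
    bd K c d x ∈ gcChains K c d v₁ e₁ v₂ e₂ := by
  revert x
  change gcChains K c d _ _ _ _ ≤ (gcChains K c d v₁ e₁ v₂ e₂).comap (bd K c d)
  refine Submodule.span_le.2 ?_
  rintro _ ⟨P, hP, rfl⟩
  rw [SetLike.mem_coe, Submodule.mem_comap, bd_cl]
  refine Submodule.sum_mem _ fun f _ => ?_
  by_cases hb : ∃ r u, Brings f P.1.1 r u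
  · obtain ⟨r, u, hb⟩ := hb
    rw [edgeTerm_eq K c d hb]
    refine Submodule.smul_mem _ _ (cl_mem_gcChains ⟨?_, (isGC_relabel 1 P.2.1).2 hP.2⟩)
    exact (splitsAt_contr (X := relabel₁ r P) hb.2).isGC ((isGC_relabel r P.1.1).2 hP.1)
  · rw [edgeTerm_eq_zero K c d fun r u h => hb ⟨r, u, h⟩]
    exact Submodule.zero_mem _

theorem bd_mem_colorDiff {x : Chain K c d (v₁ + 1) (e₁ + 1) v₂ e₂}
    (hx : x ∈ colorDiff K c d _ _ _ _) : bd K c d x ∈ colorDiff K c d v₁ e₁ v₂ e₂ := by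
  revert x
  change colorDiff K c d _ _ _ _ ≤ (colorDiff K c d v₁ e₁ v₂ e₂).comap (bd K c d)
  refine Submodule.span_le.2 ?_
  rintro _ ⟨P, f, rfl⟩
  rw [SetLike.mem_coe, Submodule.mem_comap, map_sub, bd_cl, bd_cl, ← Finset.sum_sub_distrib]
  refine Submodule.sum_mem _ fun k _ => ?_
  refine edgeTerm_sub_mem (X := P) (Y := setColor f P) rfl (fun r u => ?_) k
  have h : contr u (relabel₁ r (setColor f P))
      = setColor (fun i => f (r.edge i.castSucc)) (contr u (relabel₁ r P)) := rfl
  rw [h]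
  exact sub_setColor_mem _ _

theorem bd_mem_hairDiff {x : Chain K c d (v₁ + 1) (e₁ + 1) v₂ e₂}
    (hx : x ∈ hairDiff K c d _ _ _ _) : bd K c d x ∈ hairDiff K c d v₁ e₁ v₂ e₂ := by
  revert x
  change hairDiff K c d _ _ _ _ ≤ (hairDiff K c d v₁ e₁ v₂ e₂).comap (bd K c d)
  refine Submodule.span_le.2 ?_
  rintro _ ⟨P, f, rfl⟩
  rw [SetLike.mem_coe, Submodule.mem_comap, map_sub, bd_cl, bd_cl, ← Finset.sum_sub_distrib]
  refine Submodule.sum_mem _ fun k _ => ?_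
  refine edgeTerm_sub_mem (X := P) (Y := setHair f P) rfl (fun r u => ?_) k
  have h : contr u (relabel₁ r (setHair f P))
      = setHair (fun j => collapse u (r.vert (f j))) (contr u (relabel₁ r P)) := rfl
  rw [h]
  exact sub_setHair_mem _ _

theorem sd_mem_gcChains {x : Chain K c d v₁ e₁ v₂ e₂} (hx : x ∈ gcChains K c d _ _ _ _) :
    sd K c d x ∈ gcChains K c d (v₁ + 1) (e₁ + 1) v₂ e₂ := by
  revert x
  change gcChains K c d _ _ _ _ ≤ (gcChains K c d (v₁ + 1) (e₁ + 1) v₂ e₂).comap (sd K c d)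
  refine Submodule.span_le.2 ?_
  rintro _ ⟨P, hP, rfl⟩
  rw [SetLike.mem_coe, Submodule.mem_comap, sd_cl]
  refine Submodule.sum_mem _ fun i _ => Submodule.sum_mem _ fun b _ => Submodule.smul_mem _ _ <|
    Submodule.sum_mem _ fun w _ => cl_mem_gcChains ⟨isGC_sub _ _ _ ?_, ?_⟩
  · exact (isGC_relabel _ P.1.1).2 hP.1
  · exact (isGC_relabel 1 P.2.1).2 hP.2

theorem sd_mem_colorDiff {x : Chain K c d v₁ e₁ v₂ e₂} (hx : x ∈ colorDiff K c d _ _ _ _) :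
    sd K c d x ∈ colorDiff K c d (v₁ + 1) (e₁ + 1) v₂ e₂ := by
  revert x
  change colorDiff K c d _ _ _ _ ≤ (colorDiff K c d (v₁ + 1) (e₁ + 1) v₂ e₂).comap (sd K c d)
  refine Submodule.span_le.2 ?_
  rintro _ ⟨P, f, rfl⟩
  rw [SetLike.mem_coe, Submodule.mem_comap, map_sub, sd_cl, sd_cl, ← Finset.sum_sub_distrib]
  refine Submodule.sum_mem _ fun i _ => ?_
  rw [← Finset.sum_sub_distrib]
  refine Submodule.sum_mem _ fun b _ => ?_
  unfold subTerm
  rw [← smul_sub, ← Finset.sum_sub_distrib]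
  exact Submodule.smul_mem _ _ (Submodule.sum_mem _ fun w _ =>
    sub_setColor_mem _ (Fin.snoc (α := fun _ => Fin v₂) f w))

theorem sd_mem_hairDiff {x : Chain K c d v₁ e₁ v₂ e₂} (hx : x ∈ hairDiff K c d _ _ _ _) :
    sd K c d x ∈ hairDiff K c d (v₁ + 1) (e₁ + 1) v₂ e₂ := by
  revert x
  change hairDiff K c d _ _ _ _ ≤ (hairDiff K c d (v₁ + 1) (e₁ + 1) v₂ e₂).comap (sd K c d)
  refine Submodule.span_le.2 ?_
  rintro _ ⟨P, f, rfl⟩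
  rw [SetLike.mem_coe, Submodule.mem_comap, map_sub, sd_cl, sd_cl, ← Finset.sum_sub_distrib]
  refine Submodule.sum_mem _ fun i _ => ?_
  rw [← Finset.sum_sub_distrib]
  refine Submodule.sum_mem _ fun b _ => ?_
  unfold subTerm
  rw [← smul_sub, ← Finset.sum_sub_distrib]
  exact Submodule.smul_mem _ _ (Submodule.sum_mem _ fun w _ =>
    sub_setHair_mem _ fun j => (f j).castSucc)

theorem lap_mem_gcChains {x : Chain K c d v₁ e₁ v₂ e₂} (hx : x ∈ gcChains K c d _ _ _ _) :
    lap K c d x ∈ gcChains K c d v₁ e₁ v₂ e₂ := by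
  revert x
  change gcChains K c d _ _ _ _ ≤ (gcChains K c d v₁ e₁ v₂ e₂).comap (lap K c d)
  refine Submodule.span_le.2 ?_
  rintro _ ⟨P, hP, rfl⟩
  rw [SetLike.mem_coe, Submodule.mem_comap, lap_cl]
  exact Submodule.sum_mem _ fun i _ => Submodule.sum_mem _ fun w _ => Submodule.smul_mem _ _
    (Submodule.sub_mem _ (cl_mem_gcChains hP) (cl_mem_gcChains hP))

theorem lap_mem_colorDiff (x : Chain K c d v₁ e₁ v₂ e₂) :
    lap K c d x ∈ colorDiff K c d v₁ e₁ v₂ e₂ := by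
  have hx : x ∈ Submodule.span K (Set.range (cl K c d : Ent v₁ e₁ v₂ e₂ → _)) := by
    rw [Chain.span_cl]; trivial
  revert x
  change Submodule.span K _ ≤ (colorDiff K c d v₁ e₁ v₂ e₂).comap (lap K c d)
  refine Submodule.span_le.2 ?_
  rintro _ ⟨P, rfl⟩
  rw [SetLike.mem_coe, Submodule.mem_comap, lap_cl]
  exact Submodule.sum_mem _ fun i _ => Submodule.sum_mem _ fun w _ => Submodule.smul_mem _ _
    (sub_setColor_mem _ _)

theorem lap_mem_hairDiff {x : Chain K c d v₁ e₁ v₂ e₂} (hx : x ∈ hairDiff K c d _ _ _ _) :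
    lap K c d x ∈ hairDiff K c d v₁ e₁ v₂ e₂ := by
  revert x
  change hairDiff K c d _ _ _ _ ≤ (hairDiff K c d v₁ e₁ v₂ e₂).comap (lap K c d)
  refine Submodule.span_le.2 ?_
  rintro _ ⟨P, f, rfl⟩
  rw [SetLike.mem_coe, Submodule.mem_comap, map_sub, lap_cl, lap_cl, ← Finset.sum_sub_distrib]
  refine Submodule.sum_mem _ fun i _ => ?_
  rw [← Finset.sum_sub_distrib]
  refine Submodule.sum_mem _ fun w _ => ?_
  rw [← smul_sub, sub_sub_sub_comm]
  exact Submodule.smul_mem _ _ (Submodule.sub_mem _ (sub_setHair_mem _ _)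
    (sub_setHair_mem (recolor i w P) f))

theorem gcChains_eq_bot (h : v₁ = 0 ∨ v₂ = 0) : gcChains K c d v₁ e₁ v₂ e₂ = ⊥ := by
  refine Submodule.span_eq_bot.2 ?_
  rintro _ ⟨P, hP, rfl⟩
  obtain ⟨h1⟩ := (isConn_iff.1 hP.1.1).1
  obtain ⟨h2⟩ := (isConn_iff.1 hP.2.1).1
  rcases h with rfl | rfl
  · exact h1.elim0
  · exact h2.elim0

/-- Without edges in `Γ₁` there is no attachment to change. Together with `gcChains_eq_bot` this
settles the lower end of the double complex. -/
theorem colorDiff_eq_bot : colorDiff K c d v₁ 0 v₂ e₂ = ⊥ := by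
  refine Submodule.span_eq_bot.2 ?_
  rintro _ ⟨P, f, rfl⟩
  have : setColor f P = P := Prod.ext rfl (Prod.ext rfl (funext fun i => i.elim0))
  rw [this, sub_self]

end Subspaces

end GraphCplx

end

noncomputable section

namespace GraphCplx

/-! ### Averaging over the hair attachments and exactness -/

section Rows

variable {K : Type*} [Field K] {c d : ℤ} {v₁ e₁ v₂ e₂ : ℕ}

theorem setColor_relabelEnt (r : Relabel v₁ e₁ × Relabel v₂ e₂) (f : Fin e₁ → Fin v₂)
    (Q : Ent v₁ e₁ v₂ e₂) :
    setColor (r.1.edge.symm.arrowCongr r.2.vert f) (relabelEnt r Q) = relabelEnt r (setColor f Q) :=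
  rfl

variable (K c d) in
/-- The sum over all attachments of the edges of `Γ₁`. -/
def avg : Chain K c d v₁ e₁ v₂ e₂ →ₗ[K] Chain K c d v₁ e₁ v₂ e₂ :=
  Chain.lift K c d (fun Q => ∑ f, cl K c d (setColor f Q)) fun r Q => by
    rw [Finset.smul_sum, ← Equiv.sum_comp (r.1.edge.symm.arrowCongr r.2.vert)]
    exact Finset.sum_congr rfl fun f _ => by rw [setColor_relabelEnt, cl_relabelEnt]

theorem avg_cl (Q : Ent v₁ e₁ v₂ e₂) :
    avg K c d (cl K c d Q) = ∑ f, cl K c d (setColor f Q) := Chain.lift_cl _ _ _ _ _ _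

theorem avg_mem_gcChains {x : Chain K c d v₁ e₁ v₂ e₂} (hx : x ∈ gcChains K c d _ _ _ _) :
    avg K c d x ∈ gcChains K c d v₁ e₁ v₂ e₂ := by
  revert x
  change gcChains K c d _ _ _ _ ≤ (gcChains K c d v₁ e₁ v₂ e₂).comap (avg K c d)
  refine Submodule.span_le.2 ?_
  rintro _ ⟨P, hP, rfl⟩
  rw [SetLike.mem_coe, Submodule.mem_comap, avg_cl]
  exact Submodule.sum_mem _ fun f _ => cl_mem_gcChains hP

theorem avg_mem_hairDiff {x : Chain K c d v₁ e₁ v₂ e₂} (hx : x ∈ hairDiff K c d _ _ _ _) :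
    avg K c d x ∈ hairDiff K c d v₁ e₁ v₂ e₂ := by
  revert x
  change hairDiff K c d _ _ _ _ ≤ (hairDiff K c d v₁ e₁ v₂ e₂).comap (avg K c d)
  refine Submodule.span_le.2 ?_
  rintro _ ⟨P, f, rfl⟩
  rw [SetLike.mem_coe, Submodule.mem_comap, map_sub, avg_cl, avg_cl, ← Finset.sum_sub_distrib]
  exact Submodule.sum_mem _ fun g _ => sub_setHair_mem (setColor g P) f

theorem avg_eq_zero {x : Chain K c d v₁ e₁ v₂ e₂} (hx : x ∈ colorDiff K c d _ _ _ _) :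
    avg K c d x = 0 := by
  revert x
  change colorDiff K c d _ _ _ _ ≤ LinearMap.ker (avg K c d)
  refine Submodule.span_le.2 ?_
  rintro _ ⟨P, f, rfl⟩
  rw [SetLike.mem_coe, LinearMap.mem_ker, map_sub, avg_cl, avg_cl, ← Finset.sum_sub_distrib]
  exact Finset.sum_eq_zero fun g _ => _root_.sub_self _

/-- Together with `avg_eq_zero` this makes `1 - avg`, suitably normalised, a projection onto the
differences. -/
theorem smul_sub_avg_mem (x : Chain K c d v₁ e₁ v₂ e₂) :
    (Fintype.card (Fin e₁ → Fin v₂) : K) • x - avg K c d x ∈ colorDiff K c d v₁ e₁ v₂ e₂ := by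
  have hx : x ∈ Submodule.span K (Set.range (cl K c d : Ent v₁ e₁ v₂ e₂ → _)) := by
    rw [Chain.span_cl]; trivial
  revert x
  change Submodule.span K _ ≤ (colorDiff K c d v₁ e₁ v₂ e₂).comap
    ((Fintype.card (Fin e₁ → Fin v₂) : K) • LinearMap.id - avg K c d)
  refine Submodule.span_le.2 ?_
  rintro _ ⟨P, rfl⟩
  rw [SetLike.mem_coe, Submodule.mem_comap, LinearMap.sub_apply, avg_cl, LinearMap.smul_apply,
    LinearMap.id_apply, Nat.cast_smul_eq_nsmul, ← Finset.card_univ, ← Finset.sum_const,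
    ← Finset.sum_sub_distrib]
  exact Submodule.sum_mem _ fun f _ => sub_setColor_mem _ _

/-! ### Invertibility of `lap` on differences -/

open Classical in
variable (K c d) in
/-- The sum over all attachments of the edges in `T`. -/
def partialAvg (T : Finset (Fin e₁)) (Q : Ent v₁ e₁ v₂ e₂) : Chain K c d v₁ e₁ v₂ e₂ :=
  ∑ f : Fin e₁ → Fin v₂, cl K c d (setColor (fun i => if i ∈ T then f i else Q.2.2 i) Q)

/-- Overwriting the value at `i` forgets the old one, so each function is reached `v₂` times. -/
theorem sum_sum_update {U : Type*} [AddCommMonoid U] (i : Fin e₁)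
    (F : (Fin e₁ → Fin v₂) → U) :
    ∑ f, ∑ w, F (Function.update f i w) = v₂ • ∑ f, F f := by
  have h : ∀ w₀ w : Fin v₂, (∑ g : {j // j ≠ i} → Fin v₂,
      F (Function.update ((Equiv.funSplitAt i (Fin v₂)).symm (w₀, g)) i w))
      = ∑ g : {j // j ≠ i} → Fin v₂, F ((Equiv.funSplitAt i (Fin v₂)).symm (w, g)) := by
    intro w₀ w
    refine Finset.sum_congr rfl fun g _ => congrArg F (funext fun j => ?_)
    by_cases hj : j = i
    · subst hj; simp [Equiv.funSplitAt]
    · simp [Equiv.funSplitAt, hj]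
  rw [← Equiv.sum_comp (Equiv.funSplitAt i (Fin v₂)).symm, Fintype.sum_prod_type,
    ← Equiv.sum_comp (Equiv.funSplitAt i (Fin v₂)).symm F, Fintype.sum_prod_type]
  have h2 : ∀ w₀ : Fin v₂, (∑ g : {j // j ≠ i} → Fin v₂, ∑ w,
      F (Function.update ((Equiv.funSplitAt i (Fin v₂)).symm (w₀, g)) i w))
      = ∑ w, ∑ g : {j // j ≠ i} → Fin v₂, F ((Equiv.funSplitAt i (Fin v₂)).symm (w, g)) := by
    intro w₀
    rw [Finset.sum_comm]
    exact Finset.sum_congr rfl fun w _ => h w₀ w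
  rw [Finset.sum_congr rfl fun w₀ _ => h2 w₀]
  simp

open Classical in
-- Moving the hair of `i` to all vertices adds `i` to the set of averaged edges, so `lap` is
-- triangular on partial averages; the terms with `i ∈ T` vanish.
theorem lap_partialAvg (T : Finset (Fin e₁)) (Q : Ent v₁ e₁ v₂ e₂) :
    lap K c d (partialAvg K c d T Q) = (2 * v₂ : K) •
      ∑ i, (partialAvg K c d T Q - partialAvg K c d (insert i T) Q) := by
  unfold partialAvg
  rw [map_sum, Finset.sum_congr rfl fun f _ => lap_cl K c d _, Finset.sum_comm, Finset.smul_sum]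
  refine Finset.sum_congr rfl fun i _ => ?_
  have h : ∀ f w, cl K c d (recolor i w (setColor (fun i => if i ∈ T then f i else Q.2.2 i) Q))
      = cl K c d (setColor (fun j => if j ∈ insert i T then Function.update f i w j
        else Q.2.2 j) Q) := by
    intro f w
    congr 1
    refine Prod.ext rfl (Prod.ext rfl (funext fun j => ?_))
    by_cases hj : j = i
    · subst hj; simp [recolor, setColor]
    · simp [recolor, setColor, hj]
  simp only [← Finset.smul_sum, h, Finset.sum_sub_distrib]
  rw [mul_smul]
  congr 1
  rw [smul_sub, sum_sum_update i fun f => cl K c d (setColor (fun j =>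
    if j ∈ insert i T then f j else Q.2.2 j) Q), Nat.cast_smul_eq_nsmul, Nat.cast_smul_eq_nsmul]
  congr 1
  rw [Finset.smul_sum]
  exact Finset.sum_congr rfl fun f _ => by simp

theorem partialAvg_univ (Q : Ent v₁ e₁ v₂ e₂) :
    partialAvg K c d Finset.univ Q = avg K c d (cl K c d Q) := by
  simp [partialAvg, avg_cl]

theorem partialAvg_empty (Q : Ent v₁ e₁ v₂ e₂) :
    partialAvg K c d ∅ Q = (Fintype.card (Fin e₁ → Fin v₂) : K) • cl K c d Q := by
  simp only [partialAvg, Finset.notMem_empty, if_false, Finset.sum_const, Finset.card_univ,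
    Nat.cast_smul_eq_nsmul]
  rfl

theorem lap_avg (x : Chain K c d v₁ e₁ v₂ e₂) : lap K c d (avg K c d x) = 0 := by
  classical
  suffices h : lap K c d ∘ₗ avg K c d = (0 : Chain K c d v₁ e₁ v₂ e₂ →ₗ[K] _) from
    LinearMap.congr_fun h x
  refine Chain.hom_ext fun Q => ?_
  rw [LinearMap.comp_apply, ← partialAvg_univ, lap_partialAvg]
  simp

/-- Induction on the number of edges not yet averaged: by `lap_partialAvg`, a partial average is
modulo the image of `lap` the mean of those with one more edge averaged. -/
theorem partialAvg_sub_mem [CharZero K] {Q : Ent v₁ e₁ v₂ e₂} (hQ : IsGC Q.1.1 ∧ IsGC Q.2.1)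
    (T : Finset (Fin e₁)) : partialAvg K c d T Q - partialAvg K c d Finset.univ Q ∈
      (gcChains K c d v₁ e₁ v₂ e₂).map (lap K c d) := by
  classical
  have hv : v₂ ≠ 0 := by
    rintro rfl
    obtain ⟨h⟩ := (isConn_iff.1 hQ.2.1).1
    exact h.elim0
  induction hn : Tᶜ.card using Nat.strong_induction_on generalizing T with
  | _ n ih =>
    by_cases hT : T = Finset.univ
    · rw [hT, _root_.sub_self]
      exact Submodule.zero_mem _
    have hc : Tᶜ.card ≠ 0 := by simpa [Finset.card_eq_zero] using hT
    have hmem : (2 * v₂ * Tᶜ.card : K) • (partialAvg K c d T Q - partialAvg K c d Finset.univ Q) =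
        lap K c d (partialAvg K c d T Q) + (2 * v₂ : K) • ∑ i ∈ Tᶜ,
          (partialAvg K c d (insert i T) Q - partialAvg K c d Finset.univ Q) := by
      have h1 : ∑ i, (partialAvg K c d T Q - partialAvg K c d (insert i T) Q)
          = ∑ i ∈ Tᶜ, (partialAvg K c d T Q - partialAvg K c d (insert i T) Q) := by
        refine (Finset.sum_subset (Finset.subset_univ _) fun i _ hi => ?_).symm
        rw [Finset.mem_compl, not_not] at hi
        rw [Finset.insert_eq_of_mem hi, _root_.sub_self]
      rw [lap_partialAvg, h1, ← smul_add, ← Finset.sum_add_distrib, mul_smul,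
        Nat.cast_smul_eq_nsmul K Tᶜ.card]
      simp [smul_sub]
    -- Characteristic zero, a vertex in `Γ₂` and an edge outside `T` allow the division.
    have hne : (2 * v₂ * Tᶜ.card : K) ≠ 0 := by
      simp only [ne_eq, mul_eq_zero, not_or, Nat.cast_eq_zero]
      exact ⟨⟨two_ne_zero, hv⟩, hc⟩
    rw [← Submodule.smul_mem_iff _ hne, hmem]
    refine Submodule.add_mem _ (Submodule.mem_map_of_mem ?_) (Submodule.smul_mem _ _
      (Submodule.sum_mem _ fun i hi => ih _ ?_ _ rfl))
    · exact Submodule.sum_mem _ fun f _ => cl_mem_gcChains hQ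
    · rw [← hn]
      refine Finset.card_lt_card ?_
      rw [Finset.compl_ssubset_compl]
      exact Finset.ssubset_insert (Finset.mem_compl.1 hi)

theorem smul_sub_avg_mem_map [CharZero K] {x : Chain K c d v₁ e₁ v₂ e₂}
    (hx : x ∈ gcChains K c d _ _ _ _) :
    (Fintype.card (Fin e₁ → Fin v₂) : K) • x - avg K c d x ∈
      (gcChains K c d v₁ e₁ v₂ e₂).map (lap K c d) := by
  revert x
  change gcChains K c d _ _ _ _ ≤ ((gcChains K c d v₁ e₁ v₂ e₂).map (lap K c d)).comap
    ((Fintype.card (Fin e₁ → Fin v₂) : K) • LinearMap.id - avg K c d)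
  refine Submodule.span_le.2 ?_
  rintro _ ⟨P, hP, rfl⟩
  rw [SetLike.mem_coe, Submodule.mem_comap, LinearMap.sub_apply, LinearMap.smul_apply,
    LinearMap.id_apply, ← partialAvg_univ, ← partialAvg_empty]
  exact partialAvg_sub_mem hP ∅

theorem card_pi_ne_zero [CharZero K] (hv : v₂ ≠ 0) :
    (Fintype.card (Fin e₁ → Fin v₂) : K) ≠ 0 := by
  simp [hv]

/-- A difference has average zero, so `smul_sub_avg_mem_map` provides a preimage up to a factor.
Removing the average of the preimage, which `lap` kills by `lap_avg`, makes it a difference. -/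
theorem exists_lap_eq [CharZero K] {x : Chain K c d v₁ e₁ v₂ e₂}
    (hx : x ∈ gcChains K c d _ _ _ _ ⊓ colorDiff K c d _ _ _ _) :
    ∃ y ∈ gcChains K c d v₁ e₁ v₂ e₂ ⊓ colorDiff K c d _ _ _ _, lap K c d y = x := by
  by_cases hv : v₂ = 0
  · have h0 : x ∈ gcChains K c d v₁ e₁ v₂ e₂ := hx.1
    rw [gcChains_eq_bot (Or.inr hv), Submodule.mem_bot] at h0
    exact ⟨0, Submodule.zero_mem _, by rw [map_zero, h0]⟩
  have hN := card_pi_ne_zero (K := K) (e₁ := e₁) hv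
  obtain ⟨y, hy, hyx⟩ := smul_sub_avg_mem_map hx.1
  rw [avg_eq_zero hx.2, sub_zero] at hyx
  set N : K := (Fintype.card (Fin e₁ → Fin v₂) : K)
  -- One factor `N⁻¹` is due to `lap y = N • x`, the other normalises the projection `N • y - avg
  -- y`.
  refine ⟨N⁻¹ • N⁻¹ • (N • y - avg K c d y), ⟨?_, ?_⟩, ?_⟩
  · exact Submodule.smul_mem _ _ (Submodule.smul_mem _ _ (Submodule.sub_mem _
      (Submodule.smul_mem _ _ hy) (avg_mem_gcChains hy)))
  · exact Submodule.smul_mem _ _ (Submodule.smul_mem _ _ (smul_sub_avg_mem y))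
  · rw [map_smul, map_smul, map_sub, lap_avg, sub_zero, map_smul, hyx, smul_smul, smul_smul,
      smul_smul]
    field_simp
    simp

/-- On the finite-dimensional space of differences `lap` is surjective, hence injective. So it is
also bijective on the stable subspace cut out by `R`, and the preimage found there must be `x`. -/
theorem mem_of_lap_mem [CharZero K] {R : Submodule K (Chain K c d v₁ e₁ v₂ e₂)}
    (hR : ∀ x ∈ R, lap K c d x ∈ R) {x : Chain K c d v₁ e₁ v₂ e₂}
    (hx : x ∈ gcChains K c d _ _ _ _ ⊓ colorDiff K c d _ _ _ _) (h : lap K c d x ∈ R) : x ∈ R := by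
  set E := gcChains K c d v₁ e₁ v₂ e₂ ⊓ colorDiff K c d v₁ e₁ v₂ e₂
  have hE : ∀ x ∈ E, lap K c d x ∈ E := fun x hx => ⟨lap_mem_gcChains hx.1, lap_mem_colorDiff x⟩
  have hsurj : Function.Surjective ((lap K c d).restrict hE) := by
    rintro ⟨y, hy⟩
    obtain ⟨z, hz, hzy⟩ := exists_lap_eq hy
    exact ⟨⟨z, hz⟩, Subtype.ext hzy⟩
  have hinj := LinearMap.injective_iff_surjective.2 hsurj
  have hE' : ∀ y ∈ E, ∀ z ∈ E, lap K c d y = lap K c d z → y = z := fun y hy z hz hyz =>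
    congrArg Subtype.val (@hinj ⟨y, hy⟩ ⟨z, hz⟩ (Subtype.ext hyz))
  have hF : ∀ x ∈ E ⊓ R, lap K c d x ∈ E ⊓ R := fun x hx => ⟨hE x hx.1, hR x hx.2⟩
  have hinj' : Function.Injective ((lap K c d).restrict hF) := by
    rintro ⟨y, hy⟩ ⟨z, hz⟩ hyz
    exact Subtype.ext (hE' y hy.1 z hz.1 (congrArg Subtype.val hyz))
  obtain ⟨⟨y, hy⟩, hyx⟩ := LinearMap.injective_iff_surjective.1 hinj' ⟨lap K c d x, hE x hx, h⟩
  rw [← hE' y hy.1 x hx (congrArg Subtype.val hyx)]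
  exact hy.2

/-- The normalised average of `x` lies in `R`, because `avg` preserves `R` and kills differences;
the rest of `x` is a difference. -/
theorem exists_sub_mem [CharZero K] {R : Submodule K (Chain K c d v₁ e₁ v₂ e₂)}
    (havg : ∀ x ∈ R, avg K c d x ∈ R) {x : Chain K c d v₁ e₁ v₂ e₂}
    (hx : x ∈ gcChains K c d _ _ _ _ ⊓ (R ⊔ colorDiff K c d _ _ _ _)) :
    ∃ y ∈ gcChains K c d _ _ _ _ ⊓ colorDiff K c d _ _ _ _, x - y ∈ R := by
  by_cases hv : v₂ = 0
  · have h0 : x ∈ gcChains K c d v₁ e₁ v₂ e₂ := hx.1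
    rw [gcChains_eq_bot (Or.inr hv), Submodule.mem_bot] at h0
    exact ⟨0, Submodule.zero_mem _, by rw [h0, _root_.sub_self]; exact Submodule.zero_mem _⟩
  have hN := card_pi_ne_zero (K := K) (e₁ := e₁) hv
  set N : K := (Fintype.card (Fin e₁ → Fin v₂) : K)
  refine ⟨N⁻¹ • (N • x - avg K c d x), ⟨?_, ?_⟩, ?_⟩
  · exact Submodule.smul_mem _ _ (Submodule.sub_mem _
      (Submodule.smul_mem _ _ hx.1) (avg_mem_gcChains hx.1))
  · exact Submodule.smul_mem _ _ (smul_sub_avg_mem x)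
  · rw [smul_sub, smul_smul, inv_mul_cancel₀ hN, one_smul, sub_sub_cancel]
    obtain ⟨r, hr, s, hs, hrs⟩ := Submodule.mem_sup.1 hx.2
    rw [← hrs, map_add, avg_eq_zero hs, add_zero]
    exact R.smul_mem _ (havg r hr)

theorem mem_of_size_zero [CharZero K] {R : Submodule K (Chain K c d v₁ e₁ v₂ e₂)}
    (havg : ∀ x ∈ R, avg K c d x ∈ R) {x : Chain K c d v₁ e₁ v₂ e₂}
    (h0 : v₁ = 0 ∨ e₁ = 0)
    (hx : x ∈ gcChains K c d _ _ _ _ ⊓ (R ⊔ colorDiff K c d _ _ _ _)) : x ∈ R := by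
  obtain ⟨y, hy, hxy⟩ := exists_sub_mem havg hx
  have : y = 0 := by
    rcases h0 with rfl | rfl
    · have := hy.1
      rwa [gcChains_eq_bot (Or.inl rfl)] at this
    · have := hy.2
      rwa [colorDiff_eq_bot] at this
  rwa [this, sub_zero] at hxy

/-- Exactness of the complex of chains modulo averages. -/
theorem exists_bd_sub_mem [CharZero K] (R : ∀ v e, Submodule K (Chain K c d v e v₂ e₂))
    (hbd : ∀ v e, ∀ x ∈ R (v + 1) (e + 1), bd K c d x ∈ R v e)
    (hsd : ∀ v e, ∀ x ∈ R v e, sd K c d x ∈ R (v + 1) (e + 1))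
    (hlap : ∀ v e, ∀ x ∈ R v e, lap K c d x ∈ R v e)
    (havg : ∀ v e, ∀ x ∈ R v e, avg K c d x ∈ R v e)
    {x : Chain K c d (v₁ + 1) (e₁ + 1) v₂ e₂}
    (hx : x ∈ gcChains K c d _ _ _ _ ⊓ (R _ _ ⊔ colorDiff K c d _ _ _ _))
    (h : bd K c d x ∈ R v₁ e₁) :
    ∃ y ∈ gcChains K c d (v₁ + 2) (e₁ + 2) v₂ e₂ ⊓ colorDiff K c d _ _ _ _,
      bd K c d y - x ∈ R (v₁ + 1) (e₁ + 1) := by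
  -- Modulo `R` only the part `x₀` of `x` that is a difference matters.
  obtain ⟨x₀, hx₀, hxx⟩ := exists_sub_mem (havg _ _) hx
  have hb₀ : bd K c d x₀ ∈ R v₁ e₁ := by
    have := Submodule.sub_mem _ h (hbd _ _ _ hxx)
    rwa [map_sub, sub_sub_cancel] at this
  obtain ⟨z, hz, hzx⟩ := exists_lap_eq hx₀
  -- By the homotopy formula and `bd_bd`, `lap` commutes with `bd`; so `lap (bd z) = bd x₀` lies in
  -- `R`, and so does `bd z` by invertibility of `lap`.
  have hbz : bd K c d z ∈ R v₁ e₁ := by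
    have hE : bd K c d z ∈ gcChains K c d v₁ e₁ v₂ e₂ ⊓ colorDiff K c d _ _ _ _ :=
      ⟨bd_mem_gcChains hz.1, bd_mem_colorDiff hz.2⟩
    by_cases h0 : v₁ = 0 ∨ e₁ = 0
    · exact mem_of_size_zero (havg _ _) h0 ⟨hE.1, Submodule.mem_sup_right hE.2⟩
    · refine mem_of_lap_mem (hlap _ _) hE ?_
      push Not at h0
      obtain ⟨v, rfl⟩ := Nat.exists_eq_succ_of_ne_zero h0.1
      obtain ⟨e, rfl⟩ := Nat.exists_eq_succ_of_ne_zero h0.2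
      have h1 : lap K c d (bd K c d z) = bd K c d x₀ := by
        rw [← hzx, ← bd_sd_add_sd_bd, ← bd_sd_add_sd_bd, map_add, bd_bd, bd_bd, map_zero, zero_add,
          add_zero]
      rw [h1]
      exact hb₀
  -- The homotopy formula reads `bd (sd z) = x₀ - sd (bd z)`, where the last term lies in `R`.
  refine ⟨sd K c d z, ⟨sd_mem_gcChains hz.1, sd_mem_colorDiff hz.2⟩, ?_⟩
  have h2 : bd K c d (sd K c d z) - x = -(sd K c d (bd K c d z)) - (x - x₀) := by
    rw [← hzx, ← bd_sd_add_sd_bd]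
    abel
  rw [h2]
  exact Submodule.sub_mem _ (Submodule.neg_mem _ (hsd _ _ _ hbz)) hxx

end Rows

end GraphCplx

end

noncomputable section

namespace GraphCplx

/-! ### Lifting closed families in a double complex -/

/-- A staircase argument by recursion on `k`. The error of the next equation lies in `R` and is
`D`-closed modulo `R'`, so by `hex` it is `D` of a correction in `R`, up to `R'`. At `k = 0` no
correction is needed, by `h0`. -/
theorem exists_lift {K : Type*} [Field K] {C : ℕ → ℕ → Type*} [∀ k l, AddCommGroup (C k l)]
    [∀ k l, Module K (C k l)] (D : ∀ k l, C (k + 1) l →ₗ[K] C k l)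
    (D' : ∀ k l, C k (l + 1) →ₗ[K] C k l)
    (hDD : ∀ k l x, D k l (D (k + 1) l x) = 0)
    (hDD' : ∀ k l x, D' k l (D' k (l + 1) x) = 0)
    (hcomm : ∀ k l x, D k l (D' (k + 1) l x) = D' k l (D k (l + 1) x))
    (p R R' : ∀ k l, Submodule K (C k l))
    (hp : ∀ k l, ∀ x ∈ p (k + 1) l, D k l x ∈ p k l)
    (hp' : ∀ k l, ∀ x ∈ p k (l + 1), D' k l x ∈ p k l)
    (hR : ∀ k l, ∀ x ∈ R k (l + 1), D' k l x ∈ R k l)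
    (hR' : ∀ k l, ∀ x ∈ R' k (l + 1), D' k l x ∈ R' k l)
    (h0 : ∀ l, ∀ x ∈ p 0 l ⊓ R 0 l, x ∈ R' 0 l)
    (hex : ∀ k l, ∀ x ∈ p (k + 1) l ⊓ R (k + 1) l, D k l x ∈ R' k l →
      ∃ y ∈ p (k + 2) l ⊓ R (k + 2) l, D (k + 1) l y - x ∈ R' (k + 1) l)
    (η : ℕ → ℕ → K) (z : ∀ k l, C k l) (hz : ∀ k l, z k l ∈ p k l)
    (hzR : ∀ k l, D k l (z (k + 1) l) - η k l • D' k l (z k (l + 1)) ∈ R k l) :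
    ∃ x : ∀ k l, C k l, (∀ k l, x k l ∈ p k l) ∧ (∀ k l, x k l - z k l ∈ R k l) ∧
      ∀ k l, D k l (x (k + 1) l) - η k l • D' k l (x k (l + 1)) ∈ R' k l := by
  -- The state at stage `k` records that the next equation can be solved, so that the recursion goes
  -- on.
  let T : ℕ → Type _ := fun k => {x : ∀ l, C k l // (∀ l, x l ∈ p k l ∧ x l - z k l ∈ R k l) ∧
    ∀ l, ∃ y ∈ p (k + 1) l ⊓ R (k + 1) l,
      D k l y - (η k l • D' k l (x (l + 1)) - D k l (z (k + 1) l)) ∈ R' k l}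
  have hκ : ∀ k l (x : ∀ l, C k l), (∀ l, x l ∈ p k l ∧ x l - z k l ∈ R k l) →
      η k l • D' k l (x (l + 1)) - D k l (z (k + 1) l) ∈ p k l ⊓ R k l := by
    intro k l x hx
    refine ⟨Submodule.sub_mem _ (Submodule.smul_mem _ _ (hp' _ _ _ (hx _).1)) (hp _ _ _ (hz _ _)),
      ?_⟩
    have h1 : η k l • D' k l (x (l + 1)) - D k l (z (k + 1) l) =
        η k l • D' k l (x (l + 1) - z k (l + 1))
          - (D k l (z (k + 1) l) - η k l • D' k l (z k (l + 1))) := by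
      rw [map_sub, smul_sub]
      abel
    rw [h1]
    exact Submodule.sub_mem _ (Submodule.smul_mem _ _ (hR _ _ _ (hx _).2)) (hzR k l)
  have x₀ : T 0 := ⟨z 0, fun l => ⟨hz 0 l, by rw [sub_self]; exact Submodule.zero_mem _⟩,
    fun l => ⟨0, Submodule.zero_mem _, by
      rw [map_zero, zero_sub]
      exact Submodule.neg_mem _ (h0 l _ (hκ 0 l (z 0) fun l =>
        ⟨hz 0 l, by rw [sub_self]; exact Submodule.zero_mem _⟩))⟩⟩
  have step : ∀ k (x : T k), ∃ x' : T (k + 1), ∀ l,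
      D k l (x'.1 l) - η k l • D' k l (x.1 (l + 1)) ∈ R' k l := by
    rintro k ⟨x, hx, hy⟩
    have hy₀ := hy
    choose y hy' hyx using hy₀
    have heq : ∀ l, D k l (z (k + 1) l + y l) - η k l • D' k l (x (l + 1)) ∈ R' k l := by
      intro l
      have h1 : D k l (z (k + 1) l + y l) - η k l • D' k l (x (l + 1)) =
          D k l (y l) - (η k l • D' k l (x (l + 1)) - D k l (z (k + 1) l)) := by
        rw [map_add]
        abel
      rw [h1]
      exact hyx l
    have hx' : ∀ l, z (k + 1) l + y l ∈ p (k + 1) l ∧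
        z (k + 1) l + y l - z (k + 1) l ∈ R (k + 1) l := fun l =>
      ⟨Submodule.add_mem _ (hz _ _) (hy' l).1, by rw [add_sub_cancel_left]; exact (hy' l).2⟩
    refine ⟨⟨fun l => z (k + 1) l + y l, hx', fun l => ?_⟩, heq⟩
    refine hex k l _ (hκ (k + 1) l _ hx') ?_
    -- The next error is `D`-closed modulo `R'`: apply `D'` to the equation just solved and commute
    -- it past `D`.
    have h2 := hR' k l _ (heq (l + 1))
    rw [map_sub, map_smul, hDD', smul_zero, sub_zero, ← hcomm] at h2
    rw [map_sub, hDD, sub_zero, map_smul]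
    exact Submodule.smul_mem _ _ h2
  choose g hg using step
  let f : ∀ k, T k := fun k => Nat.rec x₀ (fun k x => g k x) k
  exact ⟨fun k l => (f k).1 l, fun k l => ((f k).2.1 l).1, fun k l => ((f k).2.1 l).2,
    fun k l => hg k (f k) l⟩

/-! ### Closing a family up to hair attachments -/

section Closed

variable {K : Type*} [Field K] {c d : ℤ} {v₁ e₁ v₂ e₂ : ℕ}

theorem swap_mem_gcChains {x : Chain K c d v₁ e₁ v₂ e₂} (hx : x ∈ gcChains K c d _ _ _ _) :
    Chain.swap K c d x ∈ gcChains K d c v₂ e₂ v₁ e₁ := by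
  revert x
  change gcChains K c d _ _ _ _ ≤ (gcChains K d c v₂ e₂ v₁ e₁).comap (Chain.swap K c d)
  refine Submodule.span_le.2 ?_
  rintro _ ⟨P, hP, rfl⟩
  rw [SetLike.mem_coe, Submodule.mem_comap, Chain.swap_cl]
  exact cl_mem_gcChains hP.symm

theorem swap_mem_hairDiff {x : Chain K c d v₁ e₁ v₂ e₂} (hx : x ∈ colorDiff K c d _ _ _ _) :
    Chain.swap K c d x ∈ hairDiff K d c v₂ e₂ v₁ e₁ := by
  revert x
  change colorDiff K c d _ _ _ _ ≤ (hairDiff K d c v₂ e₂ v₁ e₁).comap (Chain.swap K c d)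
  refine Submodule.span_le.2 ?_
  rintro _ ⟨P, f, rfl⟩
  rw [SetLike.mem_coe, Submodule.mem_comap, map_sub, Chain.swap_cl, Chain.swap_cl]
  exact sub_setHair_mem _ f

theorem swap_mem_colorDiff {x : Chain K c d v₁ e₁ v₂ e₂} (hx : x ∈ hairDiff K c d _ _ _ _) :
    Chain.swap K c d x ∈ colorDiff K d c v₂ e₂ v₁ e₁ := by
  revert x
  change hairDiff K c d _ _ _ _ ≤ (colorDiff K d c v₂ e₂ v₁ e₁).comap (Chain.swap K c d)
  refine Submodule.span_le.2 ?_
  rintro _ ⟨P, f, rfl⟩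
  rw [SetLike.mem_coe, Submodule.mem_comap, map_sub, Chain.swap_cl, Chain.swap_cl]
  exact sub_setColor_mem _ f

theorem swap_mem_sup {x : Chain K c d v₁ e₁ v₂ e₂}
    (hx : x ∈ colorDiff K c d _ _ _ _ ⊔ hairDiff K c d _ _ _ _) :
    Chain.swap K c d x ∈ hairDiff K d c v₂ e₂ v₁ e₁ ⊔ colorDiff K d c _ _ _ _ := by
  obtain ⟨y, hy, z, hz, rfl⟩ := Submodule.mem_sup.1 hx
  rw [map_add]
  exact Submodule.add_mem_sup (swap_mem_hairDiff hy) (swap_mem_colorDiff hz)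

theorem bd_mem_sup {x : Chain K c d (v₁ + 1) (e₁ + 1) v₂ e₂}
    (hx : x ∈ colorDiff K c d _ _ _ _ ⊔ hairDiff K c d _ _ _ _) :
    bd K c d x ∈ colorDiff K c d v₁ e₁ v₂ e₂ ⊔ hairDiff K c d _ _ _ _ := by
  obtain ⟨y, hy, z, hz, rfl⟩ := Submodule.mem_sup.1 hx
  rw [map_add]
  exact Submodule.add_mem_sup (bd_mem_colorDiff hy) (bd_mem_hairDiff hz)

theorem bd₂_mem_gcChains {x : Chain K c d v₁ e₁ (v₂ + 1) (e₂ + 1)}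
    (hx : x ∈ gcChains K c d _ _ _ _) : bd₂ K c d x ∈ gcChains K c d v₁ e₁ v₂ e₂ :=
  swap_mem_gcChains (bd_mem_gcChains (swap_mem_gcChains hx))

theorem bd₂_mem_colorDiff {x : Chain K c d v₁ e₁ (v₂ + 1) (e₂ + 1)}
    (hx : x ∈ colorDiff K c d _ _ _ _) : bd₂ K c d x ∈ colorDiff K c d v₁ e₁ v₂ e₂ :=
  swap_mem_colorDiff (bd_mem_hairDiff (swap_mem_hairDiff hx))

/-- A family that is closed up to changing hair attachments can be corrected to a closed one. -/
theorem exists_closed [CharZero K] {a b a' b' : ℕ} (h : a = 0 ∨ b = 0) (h' : a' = 0 ∨ b' = 0)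
    (η : ℕ → ℕ → K) (hη : ∀ k l, η k l ≠ 0)
    (z : ∀ k l, Chain K c d (a + k) (b + k) (a' + l) (b' + l))
    (hz : ∀ k l, z k l ∈ gcChains K c d _ _ _ _)
    (hzb : ∀ k l, bd K c d (z (k + 1) l) ∈ colorDiff K c d (a + k) (b + k) (a' + l) (b' + l) ⊔
      hairDiff K c d _ _ _ _)
    (hzb₂ : ∀ k l, bd₂ K c d (z k (l + 1)) ∈ colorDiff K c d (a + k) (b + k) (a' + l) (b' + l) ⊔
      hairDiff K c d _ _ _ _) :
    ∃ x : ∀ k l, Chain K c d (a + k) (b + k) (a' + l) (b' + l),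
      (∀ k l, x k l ∈ gcChains K c d _ _ _ _) ∧
      (∀ k l, x k l - z k l ∈ colorDiff K c d _ _ _ _ ⊔ hairDiff K c d _ _ _ _) ∧
      ∀ k l, (bd K c d (x (k + 1) l) : Chain K c d (a + k) (b + k) (a' + l) (b' + l)) =
        η k l • bd₂ K c d (x k (l + 1)) := by
  -- This pass runs in the direction of `bd₂` and shrinks the error from `colorDiff ⊔ hairDiff` to
  -- `colorDiff`. After exchanging the two graphs, exactness is that of `bd` modulo `hairDiff`.
  obtain ⟨y, hy, hyz, hyb⟩ := exists_lift (K := K)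
    (C := fun l k => Chain K c d (a + k) (b + k) (a' + l) (b' + l))
    (fun l k => bd₂ K c d) (fun l k => bd K c d) (fun l k x => bd₂_bd₂ K c d x)
    (fun l k x => bd_bd K c d x) (fun l k x => (bd_bd₂ K c d x).symm)
    (fun l k => gcChains K c d _ _ _ _)
    (fun l k => colorDiff K c d _ _ _ _ ⊔ hairDiff K c d _ _ _ _)
    (fun l k => colorDiff K c d _ _ _ _)
    (fun l k x hx => bd₂_mem_gcChains hx) (fun l k x hx => bd_mem_gcChains hx)
    (fun l k x hx => bd_mem_sup (v₁ := a + k) (e₁ := b + k) (v₂ := a' + l) (e₂ := b' + l) hx)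
    (fun l k x hx => bd_mem_colorDiff hx)
    (fun k x hx => by
      have := mem_of_size_zero (R := hairDiff K d c (a' + 0) (b' + 0) (a + k) (b + k))
        (fun x => avg_mem_hairDiff) (by simpa using h') (x := Chain.swap K c d x)
        ⟨swap_mem_gcChains hx.1, swap_mem_sup hx.2⟩
      have := swap_mem_colorDiff this
      rwa [Chain.swap_swap] at this)
    (fun l k x hx hb => by
      have h1 : bd K d c (Chain.swap K c d x) ∈ hairDiff K d c (a' + l) (b' + l) (a + k) (b + k) := by
        have := swap_mem_hairDiff hb
        rwa [bd₂, LinearMap.comp_apply, LinearMap.comp_apply, Chain.swap_swap] at this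
      obtain ⟨y, hy, hyx⟩ := exists_bd_sub_mem (fun v e => hairDiff K d c v e (a + k) (b + k))
        (fun v e x => bd_mem_hairDiff) (fun v e x => sd_mem_hairDiff)
        (fun v e x => lap_mem_hairDiff) (fun v e x => avg_mem_hairDiff) (x := Chain.swap K c d x)
        ⟨swap_mem_gcChains hx.1, swap_mem_sup hx.2⟩ h1
      refine ⟨Chain.swap K d c y, ⟨swap_mem_gcChains hy.1, Submodule.mem_sup_right
        (swap_mem_hairDiff hy.2)⟩, ?_⟩
      have := swap_mem_colorDiff hyx
      rw [map_sub, Chain.swap_swap] at this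
      rwa [bd₂, LinearMap.comp_apply, LinearMap.comp_apply, Chain.swap_swap])
    (fun l k => (η k l)⁻¹) (fun l k => z k l) (fun l k => hz k l)
    (fun l k => Submodule.sub_mem (colorDiff K c d (a + k) (b + k) (a' + l) (b' + l) ⊔
      hairDiff K c d _ _ _ _) (hzb₂ k l) (Submodule.smul_mem _ _ (hzb k l)))
  -- This pass runs in the direction of `bd` and shrinks the error from `colorDiff` to zero.
  obtain ⟨x, hx, hxy, hxb⟩ := exists_lift (K := K)
    (C := fun k l => Chain K c d (a + k) (b + k) (a' + l) (b' + l))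
    (fun k l => bd K c d) (fun k l => bd₂ K c d) (fun k l x => bd_bd K c d x)
    (fun k l x => bd₂_bd₂ K c d x) (fun k l x => bd_bd₂ K c d x)
    (fun k l => gcChains K c d _ _ _ _) (fun k l => colorDiff K c d _ _ _ _) (fun k l => ⊥)
    (fun k l x hx => bd_mem_gcChains hx) (fun k l x hx => bd₂_mem_gcChains hx)
    (fun k l x hx => bd₂_mem_colorDiff hx)
    (fun k l x hx => by
      rw [Submodule.mem_bot] at hx ⊢
      rw [hx, map_zero])
    (fun l x hx => mem_of_size_zero (R := ⊥) (fun x hx => by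
      rw [Submodule.mem_bot] at hx ⊢
      rw [hx, map_zero]) (v₁ := a + 0) (e₁ := b + 0) (by simpa using h) ⟨hx.1, Submodule.mem_sup_right hx.2⟩)
    (fun k l x hx hb => by
      exact exists_bd_sub_mem (fun v e => ⊥)
        (fun v e x hx => by
          rw [Submodule.mem_bot] at hx ⊢
          rw [hx, map_zero])
        (fun v e x hx => by
          rw [Submodule.mem_bot] at hx ⊢
          rw [hx, map_zero])
        (fun v e x hx => by
          rw [Submodule.mem_bot] at hx ⊢
          rw [hx, map_zero])
        (fun v e x hx => by
          rw [Submodule.mem_bot] at hx ⊢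
          rw [hx, map_zero])
        ⟨hx.1, Submodule.mem_sup_right hx.2⟩ hb)
    η (fun k l => y l k) (fun k l => hy l k)
    (fun k l => by
      -- The relation from the pass above has coefficient one at `bd₂`; multiplication by `-η`
      -- normalises it at `bd`.
      have := Submodule.smul_mem _ (-η k l) (hyb l k)
      rw [smul_sub, smul_smul, neg_mul, mul_inv_cancel₀ (hη k l), neg_smul, neg_smul, one_smul,
        sub_neg_eq_add, neg_add_eq_sub] at this
      exact this)
  refine ⟨x, hx, fun k l => ?_, fun k l => sub_eq_zero.1 ((Submodule.mem_bot K).1 (hxb k l))⟩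
  rw [← sub_add_sub_cancel _ (y l k)]
  exact Submodule.add_mem _ (Submodule.mem_sup_left (hxy k l)) (hyz l k)

end Closed

end GraphCplx

end

noncomputable section

namespace GraphCplx

/-! ### The chains of a pair of closed functions on graphs -/

section Start

variable {K : Type*} [Field K] {c d : ℤ} {v₁ e₁ v₂ e₂ : ℕ}

theorem cl_sub_cl_mem {P Q : Ent v₁ e₁ v₂ e₂} (h₁ : P.1.1 = Q.1.1) (h₂ : P.2.1 = Q.2.1) :
    cl K c d P - cl K c d Q ∈ colorDiff K c d v₁ e₁ v₂ e₂ ⊔ hairDiff K c d _ _ _ _ := by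
  have hQ : Q = setColor Q.2.2 (setHair Q.1.2 P) := Prod.ext (Prod.ext h₁.symm rfl)
    (Prod.ext h₂.symm rfl)
  rw [hQ, ← sub_add_sub_cancel _ (cl K c d (setHair Q.1.2 P)), add_comm]
  exact Submodule.add_mem_sup (sub_setColor_mem _ _) (sub_setHair_mem _ _)

open Classical in
/-- The transpose of the differential of `GC_c`: the sum of a function over all splittings. -/
def gdst {v e : ℕ} (g : Graph (v + 1) (e + 1) → K) (Γ : Graph v e) : K :=
  ∑ Γ' : Graph (v + 1) (e + 1), if ∃ u, SplitsAt u Γ Γ' then g Γ' else 0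

open Classical in
/-- The sum of a function over all hair attachments of a pair of graphs. -/
def fiberSum (a : Ent v₁ e₁ v₂ e₂ → K) (Γ₁ : Graph v₁ e₁) (Γ₂ : Graph v₂ e₂) : K :=
  ∑ P : Ent v₁ e₁ v₂ e₂, if P.1.1 = Γ₁ ∧ P.2.1 = Γ₂ then a P else 0

/-- Replacing each pair by a fixed one over the same two graphs costs only differences of
attachments, and after that the coefficients cancel. -/
theorem sum_smul_cl_mem {g : Ent v₁ e₁ v₂ e₂ → K} (hg : ∀ Γ₁ Γ₂, fiberSum g Γ₁ Γ₂ = 0) :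
    ∑ P, g P • cl K c d P ∈ colorDiff K c d v₁ e₁ v₂ e₂ ⊔ hairDiff K c d _ _ _ _ := by
  classical
  rcases isEmpty_or_nonempty (Ent v₁ e₁ v₂ e₂) with hE | hE
  · rw [Finset.univ_eq_empty, Finset.sum_empty]
    exact Submodule.zero_mem _
  let π : Ent v₁ e₁ v₂ e₂ → Graph v₁ e₁ × Graph v₂ e₂ := fun P => (P.1.1, P.2.1)
  let ρ := Function.invFun π
  have hρ : ∀ P, π (ρ (π P)) = π P := fun P => Function.invFun_eq ⟨P, rfl⟩
  have h0 : ∑ P, g P • cl K c d (ρ (π P)) = 0 := by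
    rw [← Finset.sum_fiberwise Finset.univ π]
    refine Finset.sum_eq_zero fun γ _ => ?_
    have h1 : ∑ P ∈ Finset.univ.filter (fun P => π P = γ), g P • cl K c d (ρ (π P)) =
        fiberSum g γ.1 γ.2 • cl K c d (ρ γ) := by
      rw [fiberSum, Finset.sum_smul, Finset.sum_filter]
      refine Finset.sum_congr rfl fun P _ => ?_
      have : π P = γ ↔ P.1.1 = γ.1 ∧ P.2.1 = γ.2 := Prod.ext_iff
      rw [ite_smul, zero_smul, ← if_congr this rfl rfl]
      split_ifs with h
      · rw [h]
      · rfl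
    rw [h1, hg, zero_smul]
  rw [← sub_zero (∑ P, g P • cl K c d P), ← h0, ← Finset.sum_sub_distrib]
  refine Submodule.sum_mem _ fun P _ => ?_
  rw [← smul_sub]
  exact Submodule.smul_mem _ _ (cl_sub_cl_mem (congrArg Prod.fst (hρ P)).symm
    (congrArg Prod.snd (hρ P)).symm)

open Classical in
theorem sum_fiber_orb_cl (X : Ent v₁ e₁ v₂ e₂) (Γ₁ : Graph v₁ e₁) (Γ₂ : Graph v₂ e₂) :
    fiberSum (orb K c d (cl K c d X)) Γ₁ Γ₂ =
      ∑ r : Relabel v₁ e₁ × Relabel v₂ e₂,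
        if relabel r.1 X.1.1 = Γ₁ ∧ relabel r.2 X.2.1 = Γ₂ then sgE K c d r else 0 := by
  have h : ∀ P : Ent v₁ e₁ v₂ e₂, (if P.1.1 = Γ₁ ∧ P.2.1 = Γ₂ then orb K c d (cl K c d X) P else 0)
      = ∑ r, if relabelEnt r X = P then
        (if P.1.1 = Γ₁ ∧ P.2.1 = Γ₂ then sgE K c d r else 0) else 0 := by
    intro P
    rw [orb_cl]
    split_ifs <;> simp
  rw [fiberSum, Finset.sum_congr rfl fun P _ => h P, Finset.sum_comm]
  refine Finset.sum_congr rfl fun r _ => ?_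
  rw [Finset.sum_ite_eq, if_pos (Finset.mem_univ _)]
  rfl

/-- The values of a functional on the image of `Sym` are fibre sums (`evalFun_symComp_gcl`). So
correcting a chain by differences of attachments does not change them. -/
theorem sum_fiber_orb_eq_zero {x : Chain K c d v₁ e₁ v₂ e₂}
    (hx : x ∈ colorDiff K c d _ _ _ _ ⊔ hairDiff K c d _ _ _ _) (Γ₁ : Graph v₁ e₁)
    (Γ₂ : Graph v₂ e₂) :
    fiberSum (orb K c d x) Γ₁ Γ₂ = 0 := by
  classical
  let F : Chain K c d v₁ e₁ v₂ e₂ →ₗ[K] K := ∑ P : Ent v₁ e₁ v₂ e₂,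
    if P.1.1 = Γ₁ ∧ P.2.1 = Γ₂ then LinearMap.proj P ∘ₗ orb K c d else 0
  have hF : ∀ x, F x = fiberSum (orb K c d x) Γ₁ Γ₂ := by
    intro x
    rw [LinearMap.sum_apply, fiberSum]
    refine Finset.sum_congr rfl fun P _ => ?_
    split_ifs <;> simp
  rw [← hF]
  revert x
  change _ ≤ LinearMap.ker F
  refine sup_le (Submodule.span_le.2 ?_) (Submodule.span_le.2 ?_)
  · rintro _ ⟨P, f, rfl⟩
    rw [SetLike.mem_coe, LinearMap.mem_ker, map_sub, hF, hF, sum_fiber_orb_cl, sum_fiber_orb_cl]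
    exact _root_.sub_self _
  · rintro _ ⟨P, f, rfl⟩
    rw [SetLike.mem_coe, LinearMap.mem_ker, map_sub, hF, hF, sum_fiber_orb_cl, sum_fiber_orb_cl]
    exact _root_.sub_self _

variable (K) in
/-- A function on graphs that is closed under the transpose of the differential of `GC_c`. -/
structure ClosedFun (c : ℤ) where
  /-- The underlying function. -/
  toFun : ∀ v e, Graph v e → K
  isGC : ∀ {v e} {Γ : Graph v e}, toFun v e Γ ≠ 0 → IsGC Γ
  relabel : ∀ {v e} (r : Relabel v e) (Γ : Graph v e),
    toFun v e (relabel r Γ) = sg K c r * toFun v e Γ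
  closed : ∀ {v e} (Γ : Graph v e), gdst (toFun (v + 1) (e + 1)) Γ = 0

/-- The chain given by a pair of functions on graphs. -/
def startChain (A : ClosedFun K c) (B : ClosedFun K d) (v₁ e₁ v₂ e₂ : ℕ) :
    Chain K c d v₁ e₁ v₂ e₂ :=
  ∑ P : Ent v₁ e₁ v₂ e₂, (A.toFun _ _ P.1.1 * B.toFun _ _ P.2.1) • cl K c d P

theorem startChain_mem (A : ClosedFun K c) (B : ClosedFun K d) :
    startChain A B v₁ e₁ v₂ e₂ ∈ gcChains K c d v₁ e₁ v₂ e₂ := by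
  refine Submodule.sum_mem _ fun P _ => ?_
  by_cases h : A.toFun _ _ P.1.1 * B.toFun _ _ P.2.1 = 0
  · rw [h, zero_smul]
    exact Submodule.zero_mem _
  · exact Submodule.smul_mem _ _
      (cl_mem_gcChains ⟨A.isGC (left_ne_zero_of_mul h), B.isGC (right_ne_zero_of_mul h)⟩)

theorem antiInv_mul (A : ClosedFun K c) (B : ClosedFun K d) :
    AntiInv c d fun P : Ent v₁ e₁ v₂ e₂ => A.toFun _ _ P.1.1 * B.toFun _ _ P.2.1 := by
  intro r P
  change A.toFun _ _ (relabel r.1 P.1.1) * B.toFun _ _ (relabel r.2 P.2.1) = sgE K c d r * _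
  rw [A.relabel, B.relabel, sgE_eq]
  ring

theorem orb_startChain (A : ClosedFun K c) (B : ClosedFun K d) :
    orb K c d (startChain A B v₁ e₁ v₂ e₂) =
      (Fintype.card (Relabel v₁ e₁ × Relabel v₂ e₂) : K) •
        fun P => A.toFun _ _ P.1.1 * B.toFun _ _ P.2.1 := by
  rw [startChain, orb_sum_smul_cl K c d (antiInv_mul A B)]

/-- The powers count the attachments: a vertex of `Γ₁` for each edge of `Γ₂` and conversely. -/
theorem fiberSum_mul (f : Graph v₁ e₁ → K) (g : Graph v₂ e₂ → K) (Γ₁ : Graph v₁ e₁)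
    (Γ₂ : Graph v₂ e₂) : fiberSum (fun P => f P.1.1 * g P.2.1) Γ₁ Γ₂ =
      (v₁ : K) ^ e₂ * (v₂ : K) ^ e₁ * (f Γ₁ * g Γ₂) := by
  classical
  simp only [fiberSum, Fintype.sum_prod_type]
  have h : ∀ (x : Graph v₁ e₁) (y : Graph v₂ e₂), (if x = Γ₁ ∧ y = Γ₂ then f x * g y else 0)
      = if x = Γ₁ then (if y = Γ₂ then f Γ₁ * g Γ₂ else 0) else 0 := by
    intro x y
    by_cases hx : x = Γ₁ <;> by_cases hy : y = Γ₂ <;> simp [hx, hy]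
  simp only [h]
  simp
  ring

theorem fiberSum_smul (t : K) (a : Ent v₁ e₁ v₂ e₂ → K) (Γ₁ : Graph v₁ e₁) (Γ₂ : Graph v₂ e₂) :
    fiberSum (t • a) Γ₁ Γ₂ = t * fiberSum a Γ₁ Γ₂ := by
  simp [fiberSum, Finset.mul_sum]

theorem fiberSum_orb_startChain (A : ClosedFun K c) (B : ClosedFun K d) (Γ₁ : Graph v₁ e₁)
    (Γ₂ : Graph v₂ e₂) : fiberSum (orb K c d (startChain A B v₁ e₁ v₂ e₂)) Γ₁ Γ₂ =
      (Fintype.card (Relabel v₁ e₁ × Relabel v₂ e₂) : K) * ((v₁ : K) ^ e₂ * (v₂ : K) ^ e₁ *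
        (A.toFun _ _ Γ₁ * B.toFun _ _ Γ₂)) := by
  rw [orb_startChain, fiberSum_smul, fiberSum_mul]

open Classical in
-- A splitting of `Γ₁` with any attachment of the hairs arises from exactly one pair over `Γ₁` and
-- `Γ₂`, its contraction. This is the dual form of `Sym` being a chain map.
theorem fiberSum_dst (a : Ent (v₁ + 1) (e₁ + 1) v₂ e₂ → K) (Γ₁ : Graph v₁ e₁)
    (Γ₂ : Graph v₂ e₂) : fiberSum (dst a) Γ₁ Γ₂ =
      gdst (fun Γ' => fiberSum a Γ' Γ₂) Γ₁ := by
  classical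
  let dec : DecidablePred fun P : Ent v₁ e₁ v₂ e₂ => P.1.1 = Γ₁ ∧ P.2.1 = Γ₂ := fun _ =>
    Classical.propDecidable _
  have h1 := sum_spl_spl (K := K) (fun P : Ent v₁ e₁ v₂ e₂ => P.1.1 = Γ₁ ∧ P.2.1 = Γ₂) Spl
    (fun P Q X h h' => h.unique h') a
  have h2 : ∀ X : Ent (v₁ + 1) (e₁ + 1) v₂ e₂, (∃ P : Ent v₁ e₁ v₂ e₂,
      (P.1.1 = Γ₁ ∧ P.2.1 = Γ₂) ∧ Spl P X) ↔ (∃ u, SplitsAt u Γ₁ X.1.1) ∧ X.2.1 = Γ₂ := by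
    intro X
    constructor
    · rintro ⟨P, ⟨rfl, rfl⟩, ⟨u, hu⟩, h⟩
      exact ⟨⟨u, hu.1⟩, h.1⟩
    · rintro ⟨⟨u, hu⟩, rfl⟩
      exact ⟨contr u X, ⟨funext hu.2, rfl⟩, spl_iff.2 ⟨u, hu.1, rfl⟩⟩
  have h3 : ∀ Γ' : Graph (v₁ + 1) (e₁ + 1),
      (if ∃ u, SplitsAt u Γ₁ Γ' then fiberSum a Γ' Γ₂ else 0) =
      ∑ X : Ent (v₁ + 1) (e₁ + 1) v₂ e₂, if X.1.1 = Γ' then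
        (if (∃ u, SplitsAt u Γ₁ X.1.1) ∧ X.2.1 = Γ₂ then a X else 0) else 0 := by
    intro Γ'
    by_cases h : ∃ u, SplitsAt u Γ₁ Γ'
    · rw [if_pos h, fiberSum]
      refine Finset.sum_congr rfl fun X _ => ?_
      by_cases hX : X.1.1 = Γ'
      · simp [hX, h]
      · simp [hX]
    · rw [if_neg h]
      refine (Finset.sum_eq_zero fun X _ => ?_).symm
      by_cases hX : X.1.1 = Γ'
      · simp [hX, h]
      · simp [hX]
  rw [gdst, Finset.sum_congr rfl fun Γ' _ => h3 Γ', Finset.sum_comm]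
  refine Eq.trans ?_ (h1.trans (Finset.sum_congr rfl fun X _ => ?_))
  · unfold fiberSum dst
    exact Finset.sum_congr rfl fun P _ => by congr
  · rw [Finset.sum_ite_eq, if_pos (Finset.mem_univ _)]
    exact if_congr (h2 X) rfl rfl

theorem fiberSum_dst_mul (A : ClosedFun K c) (B : ClosedFun K d) (Γ₁ : Graph v₁ e₁)
    (Γ₂ : Graph v₂ e₂) : fiberSum (dst fun P' : Ent (v₁ + 1) (e₁ + 1) v₂ e₂ =>
      A.toFun _ _ P'.1.1 * B.toFun _ _ P'.2.1) Γ₁ Γ₂ = 0 := by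
  have h := A.closed Γ₁
  rw [fiberSum_dst]
  trans ((v₁ + 1 : ℕ) : K) ^ e₂ * (v₂ : K) ^ (e₁ + 1) * B.toFun _ _ Γ₂ *
    gdst (A.toFun (v₁ + 1) (e₁ + 1)) Γ₁
  · rw [gdst, gdst, Finset.mul_sum]
    refine Finset.sum_congr rfl fun Γ' _ => ?_
    rw [fiberSum_mul]
    split_ifs <;> ring
  · rw [h, mul_zero]

/-- By `dst_orb` the function of the boundary is proportional to `dst` of the product of `A` and
`B`. Its fibre sums vanish because `A` is closed, and `sum_smul_cl_mem` applies. -/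
theorem bd_startChain_mem [CharZero K] (A : ClosedFun K c) (B : ClosedFun K d) :
    bd K c d (startChain A B (v₁ + 1) (e₁ + 1) v₂ e₂) ∈
      colorDiff K c d v₁ e₁ v₂ e₂ ⊔ hairDiff K c d _ _ _ _ := by
  have h1 : (2 : K) • orb K c d (bd K c d (startChain A B (v₁ + 1) (e₁ + 1) v₂ e₂)) =
      (Fintype.card (Relabel (v₁ + 1) (e₁ + 1) × Relabel v₂ e₂) : K) •
        dst fun P' => A.toFun _ _ P'.1.1 * B.toFun _ _ P'.2.1 := by
    rw [← dst_orb, orb_startChain, dst_smul]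
  have h2 := sum_orb_smul_cl K c d (bd K c d (startChain A B (v₁ + 1) (e₁ + 1) v₂ e₂))
  rw [← Submodule.smul_mem_iff _ (card_relabel_ne_zero K (v₁ := v₁) (e₁ := e₁) (v₂ := v₂)
    (e₂ := e₂)), ← h2]
  refine sum_smul_cl_mem fun Γ₁ Γ₂ => ?_
  have h3 := congrArg (fun a => fiberSum a Γ₁ Γ₂) h1
  simp only [fiberSum_smul, fiberSum_dst_mul, mul_zero] at h3
  exact (mul_eq_zero.1 h3).resolve_left two_ne_zero

theorem swap_startChain (A : ClosedFun K c) (B : ClosedFun K d) :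
    Chain.swap K c d (startChain A B v₁ e₁ v₂ e₂) = startChain B A v₂ e₂ v₁ e₁ := by
  unfold startChain
  rw [map_sum, ← Equiv.sum_comp (Equiv.prodComm _ _)]
  refine Finset.sum_congr rfl fun P _ => ?_
  rw [map_smul, Chain.swap_cl, mul_comm]
  rfl

theorem bd₂_startChain_mem [CharZero K] (A : ClosedFun K c) (B : ClosedFun K d) :
    bd₂ K c d (startChain A B v₁ e₁ (v₂ + 1) (e₂ + 1)) ∈
      colorDiff K c d v₁ e₁ v₂ e₂ ⊔ hairDiff K c d _ _ _ _ := by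
  rw [bd₂, LinearMap.comp_apply, LinearMap.comp_apply, swap_startChain, sup_comm]
  exact swap_mem_sup (bd_startChain_mem B A)

end Start

end GraphCplx

end

noncomputable section

namespace GraphCplx

/-! ### Functionals on the graph complexes -/

section Functionals

variable {K : Type*} [Field K] {c d : ℤ} {v e v₁ e₁ v₂ e₂ : ℕ}

theorem AntiInv.dst {a : Ent (v₁ + 1) (e₁ + 1) v₂ e₂ → K} (ha : AntiInv c d a) :
    AntiInv c d (dst a) := by
  classical
  intro r P
  unfold GraphCplx.dst
  have hbij : Function.Bijective
      (relabelEnt (extRelabel r.1, r.2) : Ent (v₁ + 1) (e₁ + 1) v₂ e₂ → _) :=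
    Finite.injective_iff_bijective.1 (relabelEnt_injective _)
  rw [← (Equiv.ofBijective _ hbij).sum_comp, Finset.mul_sum]
  refine Finset.sum_congr rfl fun P' _ => ?_
  rw [Equiv.ofBijective_apply, if_congr (spl_relabel r P P') rfl rfl, ha, mul_ite, mul_zero]
  congr 3
  simp [entSign, relabelSign_ext]

theorem AntiInv.dst₂ {a : Ent v₁ e₁ (v₂ + 1) (e₂ + 1) → K} (ha : AntiInv c d a) :
    AntiInv c d (dst₂ a) := by
  have := ha.swap.dst.swap
  exact this

/-- The function vanishes on pairs with a univalent vertex. -/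
def NoUnivalent (a : Ent v₁ e₁ v₂ e₂ → K) : Prop := ∀ P, HasUnivalent P → a P = 0

theorem Spl.hasUnivalent {P : Ent v₁ e₁ v₂ e₂} {P' : Ent (v₁ + 1) (e₁ + 1) v₂ e₂} (h : Spl P P')
    (hP : HasUnivalent P) : HasUnivalent P' := by
  obtain ⟨⟨u, hu⟩, hh⟩ := h
  rcases hP with hP | hP
  · exact Or.inl (univalent_of_splitsAt hu.1 hP)
  · refine Or.inr ?_
    rwa [hh.1]

theorem NoUnivalent.dst {a : Ent (v₁ + 1) (e₁ + 1) v₂ e₂ → K} (ha : NoUnivalent a) :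
    NoUnivalent (dst a) := fun P hP => Finset.sum_eq_zero fun P' _ => by
  split_ifs with h
  · exact ha P' (h.hasUnivalent hP)
  · rfl

theorem NoUnivalent.swap {a : Ent v₁ e₁ v₂ e₂ → K} (ha : NoUnivalent a) :
    NoUnivalent fun P => a P.swap := fun P hP => ha _ ((hasUnivalent_swap P).2 hP)

theorem NoUnivalent.dst₂ {a : Ent v₁ e₁ (v₂ + 1) (e₂ + 1) → K} (ha : NoUnivalent a) :
    NoUnivalent (dst₂ a) := ha.swap.dst.swap

/-- The stars of the contracted pair are the images of the stars of `P'`, and the new edge joins the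
two vertices that are merged. -/
theorem Spl.entConn {P : Ent v₁ e₁ v₂ e₂} {P' : Ent (v₁ + 1) (e₁ + 1) v₂ e₂} (h : Spl P P')
    (hP : EntConn P) : EntConn P' := by
  obtain ⟨u, hu, rfl⟩ := spl_iff.1 h
  obtain ⟨-, h2, h3⟩ := hP
  refine ⟨Nat.succ_pos _, h2, ?_⟩
  rw [fromRel_connected_iff] at h3 ⊢
  refine ⟨⟨Sum.inl (Fin.last _)⟩, fun f hf => ?_⟩
  have hu' : f (Sum.inl u.castSucc) ↔ f (Sum.inl (Fin.last v₁)) := by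
    refine hf _ _ (Or.inl ⟨Fin.last e₁, ?_⟩)
    simp [star₁, hu]
  let g : Fin v₁ ⊕ Fin v₂ → Prop := fun x => f (Sum.map Fin.castSucc id x)
  let col : Fin (v₁ + 1) ⊕ Fin v₂ → Fin v₁ ⊕ Fin v₂ := Sum.map (collapse u) id
  have hg : ∀ y, g (col y) ↔ f y := by
    rintro (y | y)
    · induction y using Fin.lastCases with
      | last => simpa [g, col] using hu'
      | cast y => simp [g, col]
    · simp [g, col]
  have key : ∀ (S : Set (Fin (v₁ + 1) ⊕ Fin v₂)), (∀ x ∈ S, ∀ y ∈ S, f x ↔ f y) →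
      ∀ x ∈ col '' S, ∀ y ∈ col '' S, g x ↔ g y := by
    rintro S hS _ ⟨x, hx, rfl⟩ _ ⟨y, hy, rfl⟩
    rw [hg, hg]
    exact hS x hx y hy
  intro x y hx
  refine (hg y).1 (h3.2 g ?_ _ _ ((hg x).2 hx))
  have h1 : ∀ i, star₁ (contr u P') i = col '' star₁ P' i.castSucc := by
    intro i
    simp [star₁, contr, col, Set.image_insert_eq]
  have h2 : ∀ j, star₂ (contr u P') j = col '' star₂ P' j := by
    intro j
    simp [star₂, contr, col, Set.image_insert_eq]
  rintro a b (⟨i, ha, hb⟩ | ⟨j, ha, hb⟩)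
  · rw [h1] at ha hb
    exact key _ (fun x hx y hy => hf _ _ (Or.inl ⟨_, hx, hy⟩)) a ha b hb
  · rw [h2] at ha hb
    exact key _ (fun x hx y hy => hf _ _ (Or.inr ⟨_, hx, hy⟩)) a ha b hb

theorem entConn_swap {P : Ent v₁ e₁ v₂ e₂} (h : EntConn P) : EntConn P.swap := by
  obtain ⟨h1, h2, h3⟩ := h
  refine ⟨h2, h1, ?_⟩
  rw [fromRel_connected_iff] at h3 ⊢
  refine ⟨⟨Sum.inl ⟨0, h2⟩⟩, fun f hf x y hx => ?_⟩
  have hs₁ : ∀ (i : Fin e₁) a, a ∈ star₁ P i → a.swap ∈ star₂ P.swap i := by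
    rintro i (a | a) ha <;> simpa [star₁, star₂] using ha
  have hs₂ : ∀ (j : Fin e₂) a, a ∈ star₂ P j → a.swap ∈ star₁ P.swap j := by
    rintro i (a | a) ha <;> simpa [star₁, star₂] using ha
  have := h3.2 (fun z => f z.swap) ?_ x.swap y.swap (by simpa using hx)
  · simpa using this
  rintro a b (⟨i, ha, hb⟩ | ⟨j, ha, hb⟩)
  · exact hf _ _ (Or.inr ⟨i, hs₁ i a ha, hs₁ i b hb⟩)
  · exact hf _ _ (Or.inl ⟨j, hs₂ j a ha, hs₂ j b hb⟩)

theorem IsGC.pos_vert {Γ : Graph v e} (h : IsGC Γ) : 0 < v := by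
  obtain ⟨x⟩ := (isConn_iff.1 h.1).1
  exact x.pos

theorem IsGC.pos_edge {Γ : Graph v e} (h : IsGC Γ) : 0 < e := by
  obtain ⟨x⟩ := (isConn_iff.1 h.1).1
  have := h.2 x
  rcases e with _ | e
  · simp [valence] at this
  · exact Nat.succ_pos e

/-- Bivalence forces `Γ₁` to have an edge, and its hair ties `Γ₁` to `Γ₂`. -/
theorem entConn_of_isGC {P : Ent v₁ e₁ v₂ e₂} (h₁ : IsGC P.1.1) (h₂ : IsGC P.2.1) :
    EntConn P := by
  refine ⟨h₁.pos_vert, h₂.pos_vert, ?_⟩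
  rw [fromRel_connected_iff]
  refine ⟨⟨Sum.inl ⟨0, h₁.pos_vert⟩⟩, fun f hf => ?_⟩
  have hl := (isConn_iff.1 h₁.1).2 (fun x => f (Sum.inl x)) fun i =>
    hf _ _ (Or.inl ⟨i, by simp [star₁], by simp [star₁]⟩)
  have hr := (isConn_iff.1 h₂.1).2 (fun x => f (Sum.inr x)) fun j =>
    hf _ _ (Or.inr ⟨j, by simp [star₂], by simp [star₂]⟩)
  let i : Fin e₁ := ⟨0, h₁.pos_edge⟩
  have hlr : f (Sum.inl (P.1.1 i).1) ↔ f (Sum.inr (P.2.2 i)) :=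
    hf _ _ (Or.inl ⟨i, by simp [star₁], by simp [star₁]⟩)
  rintro (x | x) (y | y) hx
  · exact hl _ _ hx
  · exact hr _ _ (hlr.1 (hl _ _ hx))
  · exact hl _ _ (hlr.2 (hr _ _ hx))
  · exact hr _ _ hx

/-! ### Functionals as functions on labelled pairs -/

/-- A connected pair as a generator. -/
def EntConn.gen {P : Ent v₁ e₁ v₂ e₂} (h : EntConn P) : EntGen v₁ e₁ v₂ e₂ := ⟨P, h⟩

/-- A connected graph with vertices that are at least bivalent, as a generator. -/
def IsGC.gen {Γ : Graph v e} (h : IsGC Γ) : GCGen v e := ⟨Γ, h⟩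

variable (K c d) in
/-- The class of a connected pair. -/
def ecl (P : EntGen v₁ e₁ v₂ e₂) : FcGCComp K c d v₁ e₁ v₂ e₂ :=
  Submodule.Quotient.mk (Finsupp.single P 1)

variable (K c) in
/-- The class of a graph. -/
def gcl (Γ : GCGen v e) : GCComp K c v e := Submodule.Quotient.mk (Finsupp.single Γ 1)

theorem FcGCComp.hom_ext {U : Type*} [AddCommGroup U] [Module K U]
    {f g : FcGCComp K c d v₁ e₁ v₂ e₂ →ₗ[K] U} (h : ∀ P, f (ecl K c d P) = g (ecl K c d P)) :
    f = g :=
  Submodule.linearMap_qext _ (Finsupp.lhom_ext' fun P => LinearMap.ext_ring (h P))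

theorem GCComp.hom_ext {U : Type*} [AddCommGroup U] [Module K U]
    {f g : GCComp K c v e →ₗ[K] U} (h : ∀ Γ, f (gcl K c Γ) = g (gcl K c Γ)) : f = g :=
  Submodule.linearMap_qext _ (Finsupp.lhom_ext' fun P => LinearMap.ext_ring (h P))

theorem ecl_entAct (r : Relabel v₁ e₁ × Relabel v₂ e₂) (P : EntGen v₁ e₁ v₂ e₂) :
    ecl K c d (entAct r P) = sgE K c d r • ecl K c d P := by
  unfold ecl
  rw [← Submodule.Quotient.mk_smul, Submodule.Quotient.eq]
  exact Submodule.subset_span ⟨r, P, rfl⟩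

theorem gcl_gcAct (r : Relabel v e) (Γ : GCGen v e) :
    gcl K c (gcAct r Γ) = sg K c r • gcl K c Γ := by
  unfold gcl
  rw [← Submodule.Quotient.mk_smul, Submodule.Quotient.eq]
  exact Submodule.subset_span ⟨r, Γ, rfl⟩

/-- The functional given by a function on labelled pairs. -/
def evalFun {a : Ent v₁ e₁ v₂ e₂ → K} (ha : AntiInv c d a) :
    FcGCComp K c d v₁ e₁ v₂ e₂ →ₗ[K] K :=
  Submodule.liftQ _ (Finsupp.linearCombination K fun P : EntGen v₁ e₁ v₂ e₂ => a P.1) (by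
    unfold relations
    rw [Submodule.span_le]
    rintro _ ⟨r, P, rfl⟩
    have := ha r P.1
    rw [SetLike.mem_coe, LinearMap.mem_ker, map_sub, map_smul, Finsupp.linearCombination_single,
      Finsupp.linearCombination_single, one_smul, one_smul]
    exact sub_eq_zero.2 this)

theorem evalFun_ecl {a : Ent v₁ e₁ v₂ e₂ → K} (ha : AntiInv c d a) (P : EntGen v₁ e₁ v₂ e₂) :
    evalFun ha (ecl K c d P) = a P.1 := by
  have : evalFun ha (ecl K c d P) = Finsupp.linearCombination K
    (fun P : EntGen v₁ e₁ v₂ e₂ => a P.1) (Finsupp.single P (1 : K)) := Submodule.liftQ_apply _ _ _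
  rw [this]
  simp

theorem evalFun_univalentSpan {a : Ent v₁ e₁ v₂ e₂ → K} (ha : AntiInv c d a) (hu : NoUnivalent a)
    {x : FcGCComp K c d v₁ e₁ v₂ e₂} (hx : x ∈ univalentSpan K c d v₁ e₁ v₂ e₂) :
    evalFun ha x = 0 := by
  revert x
  change _ ≤ LinearMap.ker (evalFun ha)
  refine Submodule.span_le.2 ?_
  rintro _ ⟨P, hP, rfl⟩
  exact (evalFun_ecl ha P).trans (hu _ hP)

theorem exists_evalFun_eq (f : FcGCComp K c d v₁ e₁ v₂ e₂ →ₗ[K] K)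
    (hf : ∀ x ∈ univalentSpan K c d v₁ e₁ v₂ e₂, f x = 0) :
    ∃ (a : Ent v₁ e₁ v₂ e₂ → K) (ha : AntiInv c d a), NoUnivalent a ∧ evalFun ha = f := by
  classical
  -- Extension by zero to disconnected pairs respects the signs, since relabelling preserves
  -- connectedness.
  let a : Ent v₁ e₁ v₂ e₂ → K := fun P => if h : EntConn P then f (ecl K c d h.gen) else 0
  have ha₁ : ∀ {P} (h : EntConn P), a P = f (ecl K c d h.gen) := fun h => dif_pos h
  have ha₀ : ∀ {P}, ¬ EntConn P → a P = 0 := fun h => dif_neg h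
  have ha : AntiInv c d a := by
    intro r P
    by_cases h : EntConn P
    · have h' := (entConn_relabel r P).2 h
      rw [ha₁ h, ha₁ h']
      have := ecl_entAct (K := K) (c := c) (d := d) r h.gen
      change ecl K c d h'.gen = _ at this
      rw [this, map_smul]
      rfl
    · rw [ha₀ h, ha₀ fun h' => h ((entConn_relabel r P).1 h'), mul_zero]
  refine ⟨a, ha, fun P hP => ?_, FcGCComp.hom_ext fun P => ?_⟩
  · by_cases h : EntConn P
    · rw [ha₁ h]
      exact hf _ (Submodule.subset_span ⟨h.gen, hP, rfl⟩)
    · exact ha₀ h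
  · rw [evalFun_ecl, ha₁ P.2]
    rfl

/-- A subspace is cut out by the functionals vanishing on it. Hence identities in `GC^{≥2}_{c,d}`
reduce to identities for `dst` and `dst₂`. -/
theorem mem_univalentSpan_of_evalFun {x : FcGCComp K c d v₁ e₁ v₂ e₂}
    (h : ∀ (a : Ent v₁ e₁ v₂ e₂ → K) (ha : AntiInv c d a), NoUnivalent a → evalFun ha x = 0) :
    x ∈ univalentSpan K c d v₁ e₁ v₂ e₂ := by
  by_contra hx
  obtain ⟨f, hf, hfu⟩ := Submodule.exists_le_ker_of_notMem hx
  obtain ⟨a, ha, hu, rfl⟩ := exists_evalFun_eq f fun x hx => hfu hx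
  exact hf (h a ha hu)

theorem sum_entGen {f : Ent v₁ e₁ v₂ e₂ → K} (hf : ∀ P, f P ≠ 0 → EntConn P) :
    ∑ P : EntGen v₁ e₁ v₂ e₂, f P.1 = ∑ P, f P := by
  refine Fintype.sum_of_injective (fun P : EntGen v₁ e₁ v₂ e₂ => P.1)
    (fun P Q h => Subtype.ext h) _ _ (fun P hP => ?_) fun P => rfl
  by_contra h
  exact hP ⟨(hf P h).gen, rfl⟩

/-- The subtracted terms have a univalent vertex, where `a` vanishes. -/
theorem entCoeff₁_mul {a : Ent (v₁ + 1) (e₁ + 1) v₂ e₂ → K} (ha : NoUnivalent a)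
    (P : Ent v₁ e₁ v₂ e₂) (P' : Ent (v₁ + 1) (e₁ + 1) v₂ e₂) :
    (entCoeff₁ P P' : K) * a P' = open Classical in if Spl P P' then a P' else 0 := by
  classical
  have h1 : (entCoeff₁ P P' : ℤ) = (if Spl P P' then 1 else 0)
      - 2 * (if (∃ u, AttachesAt u P.1 P'.1) ∧ AddsHair P.2 P'.2 then 1 else 0) := by
    unfold entCoeff₁
    exact congrArg₂ (fun a b : ℤ => a - 2 * b) (ite_of_iff Iff.rfl _ _) (ite_of_iff Iff.rfl _ _)
  rw [h1]
  by_cases h : (∃ u, AttachesAt u P.1 P'.1) ∧ AddsHair P.2 P'.2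
  · obtain ⟨⟨u, hu1, hu2, -⟩, -⟩ := h
    have : a P' = 0 := by
      refine ha _ (Or.inl ⟨Fin.last _, ?_⟩)
      unfold valence
      rw [Fin.sum_univ_castSucc, hu1, Finset.sum_eq_zero]
      · simp [Fin.castSucc_ne_last]
      · intro i _
        rw [hu2]
        simp [Fin.castSucc_ne_last]
    rw [this, mul_zero, ite_self]
  · rw [if_neg h]
    split_ifs <;> simp

theorem evalFun_entDComp₁ {a : Ent (v₁ + 1) (e₁ + 1) v₂ e₂ → K} (ha : AntiInv c d a)
    (hu : NoUnivalent a) (x : FcGCComp K c d v₁ e₁ v₂ e₂) :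
    evalFun ha (entDComp₁ K c d v₁ e₁ v₂ e₂ x) = evalFun ha.dst x := by
  classical
  suffices h : evalFun ha ∘ₗ entDComp₁ K c d v₁ e₁ v₂ e₂ = evalFun ha.dst from
    LinearMap.congr_fun h x
  refine FcGCComp.hom_ext fun P => ?_
  have h1 : entDComp₁ K c d v₁ e₁ v₂ e₂ (ecl K c d P) =
      ∑ P', (entCoeff₁ P.1 P'.1 : K) • ecl K c d P' := by
    rw [entDComp₁, ecl, Submodule.mapQ_apply, matMap_single, ← Submodule.mkQ_apply, map_sum]
    rfl
  rw [LinearMap.comp_apply, h1, map_sum, evalFun_ecl]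
  simp only [map_smul, evalFun_ecl, smul_eq_mul, entCoeff₁_mul hu]
  -- The sum extends from connected pairs to all pairs because splitting preserves connectedness.
  rw [sum_entGen (f := fun P' => if Spl P.1 P' then a P' else 0)]
  · unfold dst
    exact Finset.sum_congr rfl fun P' _ => by congr
  · intro P' hP'
    by_cases h : Spl P.1 P'
    · exact h.entConn P.2
    · exact absurd (if_neg h) hP'

theorem evalFun_entDComp₂ {a : Ent v₁ e₁ (v₂ + 1) (e₂ + 1) → K} (ha : AntiInv c d a)
    (hu : NoUnivalent a) (x : FcGCComp K c d v₁ e₁ v₂ e₂) :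
    evalFun ha (entDComp₂ K c d v₁ e₁ v₂ e₂ x) = evalFun ha.dst₂ x := by
  classical
  suffices h : evalFun ha ∘ₗ entDComp₂ K c d v₁ e₁ v₂ e₂ = evalFun ha.dst₂ from
    LinearMap.congr_fun h x
  refine FcGCComp.hom_ext fun P => ?_
  have h1 : entDComp₂ K c d v₁ e₁ v₂ e₂ (ecl K c d P) =
      ∑ P', (entCoeff₂ P.1 P'.1 : K) • ecl K c d P' := by
    rw [entDComp₂, ecl, Submodule.mapQ_apply, matMap_single, ← Submodule.mkQ_apply, map_sum]
    rfl
  rw [LinearMap.comp_apply, h1, map_sum, evalFun_ecl]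
  have h2 : ∀ P' : Ent v₁ e₁ (v₂ + 1) (e₂ + 1), (entCoeff₂ P.1 P' : K) * a P' =
      if Spl P.1.swap P'.swap then a P' else 0 := fun P' =>
    (entCoeff₁_mul hu.swap P.1.swap P'.swap).trans (by congr)
  simp only [map_smul, evalFun_ecl, smul_eq_mul, h2]
  rw [sum_entGen (f := fun P' => if Spl P.1.swap P'.swap then a P' else 0)]
  · unfold dst₂ dst
    rw [← Equiv.sum_comp (Equiv.prodComm _ _)]
    exact Finset.sum_congr rfl fun P' _ => by
      simp only [Equiv.prodComm_apply, Prod.swap_swap]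
  · intro P' hP'
    by_cases h : Spl P.1.swap P'.swap
    · exact entConn_swap (h.entConn (entConn_swap P.2))
    · exact absurd (if_neg h) hP'

end Functionals

end GraphCplx

end

noncomputable section

namespace GraphCplx

/-! ### The differentials square to zero -/

section Complexes

variable {K : Type*} [Field K] {c d : ℤ} {v e v₁ e₁ v₂ e₂ : ℕ}

theorem deg_succ_succ (d : ℤ) (v e : ℕ) : deg d (v + 1) (e + 1) = deg d v e + 1 := by
  unfold deg
  push_cast
  ring

theorem evalFun_congr {a b : Ent v₁ e₁ v₂ e₂ → K} (ha : AntiInv c d a) (hb : AntiInv c d b)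
    (h : ∀ P, a P = b P) (x : FcGCComp K c d v₁ e₁ v₂ e₂) : evalFun ha x = evalFun hb x := by
  obtain rfl : a = b := funext h
  rfl

theorem evalFun_eq_zero {a : Ent v₁ e₁ v₂ e₂ → K} (ha : AntiInv c d a) (h : ∀ P, a P = 0)
    (x : FcGCComp K c d v₁ e₁ v₂ e₂) : evalFun ha x = 0 := by
  suffices h : evalFun ha = 0 from LinearMap.congr_fun h x
  exact FcGCComp.hom_ext fun P => (evalFun_ecl ha P).trans (h _)

theorem dst₂_dst₂ [CharZero K] {a : Ent v₁ e₁ (v₂ + 2) (e₂ + 2) → K} (ha : AntiInv c d a)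
    (P : Ent v₁ e₁ v₂ e₂) : dst₂ (dst₂ a) P = 0 := by
  change dst (dst fun Q => a Q.swap) P.swap = 0
  exact dst_dst ha.swap _

theorem entD₁_succ (x : FcGC K c d) (v₁ e₁ v₂ e₂ : ℕ) : entD₁ K c d x (v₁ + 1) (e₁ + 1) v₂ e₂ =
    entDComp₁ K c d v₁ e₁ v₂ e₂ (x v₁ e₁ v₂ e₂) := rfl

theorem entD₁_zero_vert (x : FcGC K c d) (e₁ v₂ e₂ : ℕ) : entD₁ K c d x 0 e₁ v₂ e₂ = 0 := rfl

theorem entD₁_zero_edge (x : FcGC K c d) (v₁ v₂ e₂ : ℕ) : entD₁ K c d x v₁ 0 v₂ e₂ = 0 := by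
  cases v₁ <;> rfl

theorem entD₂_succ (x : FcGC K c d) (v₁ e₁ v₂ e₂ : ℕ) : entD₂ K c d x v₁ e₁ (v₂ + 1) (e₂ + 1) =
    (((deg c v₁ e₁).negOnePow : ℤˣ) : ℤ) • entDComp₂ K c d v₁ e₁ v₂ e₂ (x v₁ e₁ v₂ e₂) := rfl

theorem entD₂_zero_vert (x : FcGC K c d) (v₁ e₁ e₂ : ℕ) : entD₂ K c d x v₁ e₁ 0 e₂ = 0 := rfl

theorem entD₂_zero_edge (x : FcGC K c d) (v₁ e₁ v₂ : ℕ) : entD₂ K c d x v₁ e₁ v₂ 0 = 0 := by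
  cases v₂ <;> rfl

theorem entD₁_entD₁_mem [CharZero K] (x : FcGC K c d) :
    entD₁ K c d (entD₁ K c d x) ∈ GC1 K c d := by
  intro v₁ e₁ v₂ e₂
  rcases v₁ with _ | v₁
  · exact Submodule.zero_mem _
  rcases e₁ with _ | e₁
  · exact Submodule.zero_mem _
  rw [entD₁_succ]
  rcases v₁ with _ | v₁
  · rw [entD₁_zero_vert, map_zero]
    exact Submodule.zero_mem _
  rcases e₁ with _ | e₁
  · rw [entD₁_zero_edge, map_zero]
    exact Submodule.zero_mem _
  rw [entD₁_succ]
  refine mem_univalentSpan_of_evalFun fun a ha hu => ?_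
  rw [evalFun_entDComp₁ ha hu, evalFun_entDComp₁ ha.dst hu.dst]
  exact evalFun_eq_zero _ (dst_dst ha) _

theorem entD₂_entD₂_mem [CharZero K] (x : FcGC K c d) :
    entD₂ K c d (entD₂ K c d x) ∈ GC1 K c d := by
  intro v₁ e₁ v₂ e₂
  rcases v₂ with _ | v₂
  · exact Submodule.zero_mem _
  rcases e₂ with _ | e₂
  · exact Submodule.zero_mem _
  rw [entD₂_succ]
  refine zsmul_mem ?_ _
  rcases v₂ with _ | v₂
  · rw [entD₂_zero_vert, map_zero]
    exact Submodule.zero_mem _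
  rcases e₂ with _ | e₂
  · rw [entD₂_zero_edge, map_zero]
    exact Submodule.zero_mem _
  rw [entD₂_succ, map_zsmul]
  refine zsmul_mem ?_ _
  refine mem_univalentSpan_of_evalFun fun a ha hu => ?_
  rw [evalFun_entDComp₂ ha hu, evalFun_entDComp₂ ha.dst₂ hu.dst₂]
  exact evalFun_eq_zero _ (dst₂_dst₂ ha) _

theorem negOnePow_deg_succ_succ (c : ℤ) (v e : ℕ) :
    (((deg c (v + 1) (e + 1)).negOnePow : ℤˣ) : ℤ) = -(((deg c v e).negOnePow : ℤˣ) : ℤ) := by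
  rw [deg_succ_succ, Int.negOnePow_succ, Units.val_neg]

/-- `dst` and `dst₂` commute, while `δ'` raises `|Γ₁|` by one and so reverses the sign in front of
`δ''`. -/
theorem entD_anticomm_mem (x : FcGC K c d) :
    entD₁ K c d (entD₂ K c d x) + entD₂ K c d (entD₁ K c d x) ∈ GC1 K c d := by
  intro v₁ e₁ v₂ e₂
  rw [FcGC.add_apply]
  rcases v₁ with _ | v₁ <;> rcases e₁ with _ | e₁ <;> rcases v₂ with _ | v₂ <;>
    rcases e₂ with _ | e₂ <;>
    simp only [entD₁_succ, entD₁_zero_vert, entD₁_zero_edge, entD₂_succ, entD₂_zero_vert,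
      entD₂_zero_edge, map_zero, add_zero, smul_zero, Submodule.zero_mem]
  rw [map_zsmul, negOnePow_deg_succ_succ, neg_smul, ← sub_eq_add_neg, ← smul_sub]
  refine zsmul_mem ?_ _
  refine mem_univalentSpan_of_evalFun fun a ha hu => ?_
  rw [map_sub, evalFun_entDComp₁ ha hu, evalFun_entDComp₂ ha.dst hu.dst, evalFun_entDComp₂ ha hu,
    evalFun_entDComp₁ ha.dst₂ hu.dst₂, sub_eq_zero]
  exact evalFun_congr _ _ (fun P => (dst_dst₂ a P).symm) _

theorem gcge2D_gcge2D [CharZero K] (x : GCge2 K c d) : gcge2D K c d (gcge2D K c d x) = 0 := by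
  obtain ⟨x, rfl⟩ := Submodule.Quotient.mk_surjective _ x
  unfold gcge2D
  rw [Submodule.mapQ_apply, Submodule.mapQ_apply, Submodule.Quotient.mk_eq_zero]
  have h : fcGCD K c d (fcGCD K c d x) = entD₁ K c d (entD₁ K c d x) +
      (entD₁ K c d (entD₂ K c d x) + entD₂ K c d (entD₁ K c d x)) +
      entD₂ K c d (entD₂ K c d x) := by
    simp only [fcGCD, LinearMap.add_apply, map_add]
    abel
  rw [h]
  exact add_mem (add_mem (entD₁_entD₁_mem x) (entD_anticomm_mem x)) (entD₂_entD₂_mem x)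

/-- A special case of `dst_dst`: take as second graph a single vertex without edges, so that there
is only one attachment of hairs. -/
theorem gdst_gdst [CharZero K] {g : Graph (v + 2) (e + 2) → K}
    (hg : ∀ r Γ, g (relabel r Γ) = sg K c r * g Γ) (Γ : Graph v e) : gdst (gdst g) Γ = 0 := by
  let a : Ent (v + 2) (e + 2) 1 0 → K := fun P => g P.1.1 * 1
  have ha : AntiInv c 0 a := by
    intro r P
    have : entSign c 0 r = relabelSign c r.1 := by
      have : r.2.edge = 1 := Subsingleton.elim _ _
      simp [entSign, relabelSign, this]
    rw [this]
    change g (relabel r.1 P.1.1) * 1 = _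
    rw [hg, mul_one]
    simp [a, sg]
  let Γ₂ : Graph 1 0 := Fin.elim0
  have h := fiberSum_dst (dst a) Γ Γ₂
  have h0 : dst (dst a) = fun _ => 0 := funext fun P => dst_dst ha P
  have h1 : ∀ Γ', fiberSum a Γ' Γ₂ = g Γ' := fun Γ' => by
    rw [fiberSum_mul g (fun _ => 1)]
    simp
  simp only [fiberSum_dst, h1, h0] at h
  rw [← h]
  simp [fiberSum]

/-- The ends of the new edge have valence at least one, so a splitting can leave `GC_c` only through
a univalent vertex. -/
theorem isGC_of_splitsAt {u : Fin v} {Γ : Graph v e} {Γ' : Graph (v + 1) (e + 1)}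
    (hs : SplitsAt u Γ Γ') (hΓ : IsGC Γ) (h : ∀ x, valence Γ' x ≠ 1) : IsGC Γ' := by
  refine ⟨hs.isConn_iff.2 hΓ.1, fun x => ?_⟩
  have h1 : ∀ y, ((Γ' (Fin.last e)).1 = y ∨ (Γ' (Fin.last e)).2 = y) → 1 ≤ valence Γ' y := by
    intro y hy
    unfold valence
    rw [Fin.sum_univ_castSucc]
    refine le_add_left ?_
    rcases hy with hy | hy
    · rw [if_pos hy]; omega
    · rw [if_pos hy]; omega
  have h2 := h x
  induction x using Fin.lastCases with
  | last =>
    have := h1 (Fin.last v) (Or.inr (by rw [hs.1]))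
    omega
  | cast x =>
    by_cases hx : x = u
    · subst hx
      have := h1 x.castSucc (Or.inl (by rw [hs.1]))
      omega
    · rw [hs.valence_of_ne hx]
      exact hΓ.2 x

theorem sum_gcCoeff (Γ : GCGen v e) {g : Graph (v + 1) (e + 1) → K}
    (hg : ∀ Γ' u, SplitsAt u Γ.1 Γ' → ¬ IsGC Γ' → g Γ' = 0) :
    ∑ Γ' : GCGen (v + 1) (e + 1), (gcCoeff Γ Γ' : K) * g Γ'.1 = gdst g Γ.1 := by
  classical
  unfold gdst
  refine Fintype.sum_of_injective (fun P : GCGen (v + 1) (e + 1) => P.1)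
    (fun P Q h => Subtype.ext h) _ _ (fun Γ' hΓ' => ?_) fun Γ' => ?_
  · split_ifs with h
    · obtain ⟨u, hu⟩ := h
      exact hg Γ' u hu fun h => hΓ' ⟨h.gen, rfl⟩
    · rfl
  · unfold gcCoeff
    split_ifs with h <;> simp

theorem gcDComp_gcl (Γ : GCGen v e) :
    gcDComp K c v e (gcl K c Γ) = ∑ Γ', (gcCoeff Γ Γ' : K) • gcl K c Γ' := by
  rw [gcDComp, gcl, Submodule.mapQ_apply, matMap_single, ← Submodule.mkQ_apply, map_sum]
  rfl

open Classical in
/-- A functional on `GC_c` as a function on labelled graphs. -/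
def extFun (f : GCComp K c v e →ₗ[K] K) (Γ : Graph v e) : K :=
  if h : IsGC Γ then f (gcl K c h.gen) else 0

theorem extFun_gen (f : GCComp K c v e →ₗ[K] K) (Γ : GCGen v e) :
    extFun f Γ.1 = f (gcl K c Γ) := dif_pos (show IsGC Γ.1 from Γ.2)

theorem extFun_of_not (f : GCComp K c v e →ₗ[K] K) {Γ : Graph v e} (h : ¬ IsGC Γ) :
    extFun f Γ = 0 := dif_neg h

theorem extFun_relabel (f : GCComp K c v e →ₗ[K] K) (r : Relabel v e) (Γ : Graph v e) :
    extFun f (relabel r Γ) = sg K c r * extFun f Γ := by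
  by_cases h : IsGC Γ
  · have h1 := extFun_gen f h.gen
    have h2 := extFun_gen f (gcAct r h.gen)
    rw [gcl_gcAct, map_smul, ← h1] at h2
    exact h2
  · rw [extFun_of_not f h, extFun_of_not f fun h' => h ((isGC_relabel r Γ).1 h'), mul_zero]

/-- Splittings of a graph outside `GC_c` stay outside, so extension by zero is compatible with the
transposed differential. -/
theorem extFun_comp_gcDComp (f : GCComp K c (v + 1) (e + 1) →ₗ[K] K) (Γ : Graph v e) :
    extFun (f ∘ₗ gcDComp K c v e) Γ = gdst (extFun f) Γ := by
  by_cases h : IsGC Γ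
  · have h1 := extFun_gen (f ∘ₗ gcDComp K c v e) h.gen
    rw [LinearMap.comp_apply, gcDComp_gcl, map_sum] at h1
    refine h1.trans (Eq.trans ?_ (sum_gcCoeff h.gen fun Γ' u _ h' => extFun_of_not f h'))
    refine Finset.sum_congr rfl fun Γ' _ => ?_
    rw [map_smul, smul_eq_mul, extFun_gen]
  · rw [extFun_of_not _ h]
    refine (Finset.sum_eq_zero fun Γ' _ => ?_).symm
    split_ifs with hs
    · obtain ⟨u, hu⟩ := hs
      exact extFun_of_not f fun h' => h (hu.isGC h')
    · rfl

theorem gcDComp_gcDComp [CharZero K] (x : GCComp K c v e) :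
    gcDComp K c (v + 1) (e + 1) (gcDComp K c v e x) = 0 := by
  rw [← Module.forall_dual_apply_eq_zero_iff K]
  intro f
  change (f ∘ₗ gcDComp K c (v + 1) (e + 1) ∘ₗ gcDComp K c v e) x = 0
  suffices h : f ∘ₗ gcDComp K c (v + 1) (e + 1) ∘ₗ gcDComp K c v e = 0 by rw [h]; rfl
  refine GCComp.hom_ext fun Γ => ?_
  have h1 := extFun_gen ((f ∘ₗ gcDComp K c (v + 1) (e + 1)) ∘ₗ gcDComp K c v e) Γ
  rw [extFun_comp_gcDComp] at h1
  rw [← LinearMap.comp_assoc, ← h1, funext (extFun_comp_gcDComp f)]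
  exact gdst_gdst (extFun_relabel f) _

theorem gcD_gcD [CharZero K] (x : GC K c) : gcD K c (gcD K c x) = 0 := by
  funext v e
  rcases v with _ | v
  · rfl
  rcases e with _ | e
  · rfl
  change gcDComp K c v e (gcD K c x v e) = 0
  rcases v with _ | v
  · exact map_zero _
  rcases e with _ | e
  · exact map_zero _
  exact gcDComp_gcDComp _

theorem gcD_mem {n : ℤ} {x : GC K c} (hx : x ∈ gcDeg K c n) : gcD K c x ∈ gcDeg K c (n + 1) := by
  intro v e h
  rcases v with _ | v
  · rfl
  rcases e with _ | e
  · rfl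
  change gcDComp K c v e (x v e) = 0
  rw [hx v e, map_zero]
  intro h'
  rw [deg_succ_succ, h'] at h
  exact h rfl

theorem isCochainComplex_gcD (K : Type*) [Field K] [CharZero K] (c : ℤ) :
    IsCochainComplex (gcD K c) (gcDeg K c) :=
  ⟨fun _ _ hx => gcD_mem hx, gcD_gcD⟩

theorem fcGCD_mem {n : ℤ} {x : FcGC K c d} (hx : x ∈ fcGCDeg K c d n) :
    fcGCD K c d x ∈ fcGCDeg K c d (n + 1) := by
  refine Submodule.add_mem (fcGCDeg K c d (n + 1)) ?_ ?_
  · intro v₁ e₁ v₂ e₂ h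
    rcases v₁ with _ | v₁
    · rfl
    rcases e₁ with _ | e₁
    · rfl
    change entDComp₁ K c d v₁ e₁ v₂ e₂ (x v₁ e₁ v₂ e₂) = 0
    rw [hx v₁ e₁ v₂ e₂, map_zero]
    rw [deg_succ_succ] at h
    omega
  · intro v₁ e₁ v₂ e₂ h
    rcases v₂ with _ | v₂
    · rfl
    rcases e₂ with _ | e₂
    · rfl
    rw [entD₂_succ, hx v₁ e₁ v₂ e₂, map_zero, smul_zero]
    rw [deg_succ_succ] at h
    omega

theorem isCochainComplex_gcge2D (K : Type*) [Field K] [CharZero K] (c d : ℤ) :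
    IsCochainComplex (gcge2D K c d) (gcge2Deg K c d) := by
  refine ⟨?_, gcge2D_gcge2D⟩
  rintro n _ ⟨x, hx, rfl⟩
  exact ⟨fcGCD K c d x, fcGCD_mem hx, rfl⟩

end Complexes

/-! ### `Sym` is a map of complexes -/

section SymMap

variable {K : Type*} [Field K] {c d : ℤ} {v e v₁ e₁ v₂ e₂ : ℕ}

/-- Every attachment gives a connected pair by `entConn_of_isGC`, so the sum defining `Sym` runs
over the whole fibre. -/
theorem evalFun_symComp_gcl {a : Ent v₁ e₁ v₂ e₂ → K} (ha : AntiInv c d a) (Γ₁ : GCGen v₁ e₁)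
    (Γ₂ : GCGen v₂ e₂) :
    evalFun ha (symComp K c d v₁ e₁ v₂ e₂ (gcl K c Γ₁) (gcl K d Γ₂)) =
      fiberSum a Γ₁.1 Γ₂.1 := by
  classical
  have h1 : symComp K c d v₁ e₁ v₂ e₂ (gcl K c Γ₁) (gcl K d Γ₂) =
      ∑ P, (symCoeff Γ₁ Γ₂ P : K) • ecl K c d P := by
    have : symComp K c d v₁ e₁ v₂ e₂ (gcl K c Γ₁) (gcl K d Γ₂) =
        symFree K c d v₁ e₁ v₂ e₂ (Finsupp.single Γ₁ 1) (Finsupp.single Γ₂ 1) := rfl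
    rw [this, symFree, LinearMap.compr₂_apply, Finsupp.linearCombination_single, one_smul,
      matMap_single, map_sum]
    rfl
  rw [h1, map_sum]
  simp only [map_smul, evalFun_ecl, smul_eq_mul]
  have h2 : ∀ P : EntGen v₁ e₁ v₂ e₂, (symCoeff Γ₁ Γ₂ P : K) * a P.1 =
      if P.1.1.1 = Γ₁.1 ∧ P.1.2.1 = Γ₂.1 then a P.1 else 0 := by
    intro P
    unfold symCoeff
    split_ifs with h <;> simp
  rw [Finset.sum_congr rfl fun P _ => h2 P, sum_entGen
    (f := fun P => if P.1.1 = Γ₁.1 ∧ P.2.1 = Γ₂.1 then a P else 0)]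
  · unfold fiberSum
    exact Finset.sum_congr rfl fun P _ => by congr
  · intro P hP
    have h : P.1.1 = Γ₁.1 ∧ P.2.1 = Γ₂.1 := by
      by_contra h
      exact hP (if_neg h)
    exact entConn_of_isGC (h.1 ▸ Γ₁.2) (h.2 ▸ Γ₂.2)

theorem fiberSum_swap (a : Ent v₁ e₁ v₂ e₂ → K) (Γ₁ : Graph v₁ e₁) (Γ₂ : Graph v₂ e₂) :
    fiberSum (fun P => a P.swap) Γ₂ Γ₁ = fiberSum a Γ₁ Γ₂ := by
  classical
  unfold fiberSum
  rw [← Equiv.sum_comp (Equiv.prodComm _ _)]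
  refine Finset.sum_congr rfl fun P _ => ?_
  by_cases h : P.1.1 = Γ₁ ∧ P.2.1 = Γ₂
  · rw [if_pos h, if_pos ⟨h.2, h.1⟩]
    rfl
  · rw [if_neg h, if_neg fun h' => h ⟨h'.2, h'.1⟩]

theorem fiberSum_dst₂ (a : Ent v₁ e₁ (v₂ + 1) (e₂ + 1) → K) (Γ₁ : Graph v₁ e₁)
    (Γ₂ : Graph v₂ e₂) : fiberSum (dst₂ a) Γ₁ Γ₂ = gdst (fun Γ' => fiberSum a Γ₁ Γ') Γ₂ := by
  simp only [← fiberSum_swap (a := a), ← fiberSum_dst]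
  exact (fiberSum_swap _ _ _).symm

theorem fiberSum_eq_zero_of_univalent {a : Ent v₁ e₁ v₂ e₂ → K} (ha : NoUnivalent a)
    {Γ₁ : Graph v₁ e₁} {Γ₂ : Graph v₂ e₂}
    (h : (∃ x, valence Γ₁ x = 1) ∨ ∃ y, valence Γ₂ y = 1) : fiberSum a Γ₁ Γ₂ = 0 := by
  classical
  refine Finset.sum_eq_zero fun P _ => ?_
  split_ifs with hP
  · refine ha P ?_
    rwa [HasUnivalent, hP.1, hP.2]
  · rfl

/-- The dual form of the chain map property. Splittings that create a univalent vertex are absent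
from `GC_c` and invisible to `a`. -/
theorem evalFun_dst_symComp {a : Ent (v₁ + 1) (e₁ + 1) v₂ e₂ → K} (ha : AntiInv c d a)
    (hu : NoUnivalent a) (x : GCComp K c v₁ e₁) (y : GCComp K d v₂ e₂) :
    evalFun ha.dst (symComp K c d _ _ _ _ x y) =
      evalFun ha (symComp K c d _ _ _ _ (gcDComp K c v₁ e₁ x) y) := by
  suffices h : (symComp K c d v₁ e₁ v₂ e₂).compr₂ (evalFun ha.dst) =
      ((symComp K c d (v₁ + 1) (e₁ + 1) v₂ e₂).compr₂ (evalFun ha)) ∘ₗ gcDComp K c v₁ e₁ from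
    LinearMap.congr_fun (LinearMap.congr_fun h x) y
  refine GCComp.hom_ext fun Γ₁ => GCComp.hom_ext fun Γ₂ => ?_
  rw [LinearMap.compr₂_apply, evalFun_symComp_gcl, LinearMap.comp_apply, LinearMap.compr₂_apply,
    gcDComp_gcl, map_sum, LinearMap.sum_apply, map_sum, fiberSum_dst,
    ← sum_gcCoeff Γ₁ fun Γ' u hs h' => ?_]
  · refine Finset.sum_congr rfl fun Γ' _ => ?_
    rw [map_smul, LinearMap.smul_apply, map_smul, evalFun_symComp_gcl, smul_eq_mul]
  · refine fiberSum_eq_zero_of_univalent hu (Or.inl ?_)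
    by_contra! h
    exact h' (isGC_of_splitsAt hs Γ₁.2 h)

theorem evalFun_dst₂_symComp {a : Ent v₁ e₁ (v₂ + 1) (e₂ + 1) → K} (ha : AntiInv c d a)
    (hu : NoUnivalent a) (x : GCComp K c v₁ e₁) (y : GCComp K d v₂ e₂) :
    evalFun ha.dst₂ (symComp K c d _ _ _ _ x y) =
      evalFun ha (symComp K c d _ _ _ _ x (gcDComp K d v₂ e₂ y)) := by
  suffices h : (symComp K c d v₁ e₁ v₂ e₂).compr₂ (evalFun ha.dst₂) =
      ((symComp K c d v₁ e₁ (v₂ + 1) (e₂ + 1)).compr₂ (evalFun ha)).compl₂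
        (gcDComp K d v₂ e₂) from
    LinearMap.congr_fun (LinearMap.congr_fun h x) y
  refine GCComp.hom_ext fun Γ₁ => GCComp.hom_ext fun Γ₂ => ?_
  rw [LinearMap.compr₂_apply, evalFun_symComp_gcl, LinearMap.compl₂_apply, LinearMap.compr₂_apply,
    gcDComp_gcl, map_sum, map_sum, fiberSum_dst₂,
    ← sum_gcCoeff Γ₂ fun Γ' u hs h' => ?_]
  · refine Finset.sum_congr rfl fun Γ' _ => ?_
    rw [map_smul, map_smul, evalFun_symComp_gcl, smul_eq_mul]
  · refine fiberSum_eq_zero_of_univalent hu (Or.inr ?_)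
    by_contra! h
    exact h' (isGC_of_splitsAt hs Γ₂.2 h)

variable (K c d) in
/-- The map `Sym` before passing to the quotient by `GC^1_{c,d}`. -/
def symRaw (x : GC K c) (y : GC K d) : FcGC K c d :=
  fun v₁ e₁ v₂ e₂ => symComp K c d v₁ e₁ v₂ e₂ (x v₁ e₁) (y v₂ e₂)

theorem Sym_apply (x : GC K c) (y : GC K d) :
    Sym K c d x y = Submodule.Quotient.mk (symRaw K c d x y) := rfl

theorem Sym_mem {i j : ℤ} {x : GC K c} (hx : x ∈ gcDeg K c i) {y : GC K d}
    (hy : y ∈ gcDeg K d j) : Sym K c d x y ∈ gcge2Deg K c d (i + j) := by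
  refine ⟨symRaw K c d x y, fun v₁ e₁ v₂ e₂ h => ?_, rfl⟩
  change symComp K c d v₁ e₁ v₂ e₂ (x v₁ e₁) (y v₂ e₂) = 0
  by_cases h1 : deg c v₁ e₁ = i
  · rw [hy v₂ e₂ (by omega), map_zero]
  · rw [hx v₁ e₁ h1, map_zero, LinearMap.zero_apply]

theorem entD₁_symRaw_mem (x : GC K c) (y : GC K d) :
    entD₁ K c d (symRaw K c d x y) - symRaw K c d (gcD K c x) y ∈ GC1 K c d := by
  intro v₁ e₁ v₂ e₂
  change entD₁ K c d (symRaw K c d x y) v₁ e₁ v₂ e₂ -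
    symComp K c d v₁ e₁ v₂ e₂ (gcD K c x v₁ e₁) (y v₂ e₂) ∈ _
  rcases v₁ with _ | v₁
  · change 0 - symComp K c d _ _ _ _ 0 _ ∈ _
    rw [map_zero, LinearMap.zero_apply, _root_.sub_zero]
    exact Submodule.zero_mem _
  rcases e₁ with _ | e₁
  · change 0 - symComp K c d _ _ _ _ 0 _ ∈ _
    rw [map_zero, LinearMap.zero_apply, _root_.sub_zero]
    exact Submodule.zero_mem _
  change entDComp₁ K c d _ _ _ _ (symComp K c d _ _ _ _ _ _) -
    symComp K c d _ _ _ _ (gcDComp K c _ _ _) _ ∈ _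
  refine mem_univalentSpan_of_evalFun fun a ha hu => ?_
  rw [map_sub, evalFun_entDComp₁ ha hu, evalFun_dst_symComp ha hu, _root_.sub_self]

variable (K c) in
/-- Multiplication by `(-1)^n` in degree `n`. -/
def gcSign : GC K c →ₗ[K] GC K c where
  toFun x := fun v e => (((deg c v e).negOnePow : ℤˣ) : ℤ) • x v e
  map_add' x y := by
    funext v e
    exact smul_add _ _ _
  map_smul' a x := by
    funext v e
    exact smul_comm _ a _

theorem gcSign_apply (x : GC K c) (v e : ℕ) :
    gcSign K c x v e = (((deg c v e).negOnePow : ℤˣ) : ℤ) • x v e := rfl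

theorem gcSign_of_mem {i : ℤ} {x : GC K c} (hx : x ∈ gcDeg K c i) :
    gcSign K c x = ((i.negOnePow : ℤˣ) : ℤ) • x := by
  funext v e
  change (((deg c v e).negOnePow : ℤˣ) : ℤ) • x v e = ((i.negOnePow : ℤˣ) : ℤ) • x v e
  by_cases h : deg c v e = i
  · rw [h]
  · rw [hx v e h, smul_zero, smul_zero]

theorem entD₂_symRaw_mem (x : GC K c) (y : GC K d) :
    entD₂ K c d (symRaw K c d x y) - symRaw K c d (gcSign K c x) (gcD K d y) ∈ GC1 K c d := by
  intro v₁ e₁ v₂ e₂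
  change entD₂ K c d (symRaw K c d x y) v₁ e₁ v₂ e₂ -
    symComp K c d v₁ e₁ v₂ e₂ ((((deg c v₁ e₁).negOnePow : ℤˣ) : ℤ) • x v₁ e₁)
      (gcD K d y v₂ e₂) ∈ _
  rcases v₂ with _ | v₂
  · change 0 - symComp K c d _ _ _ _ _ 0 ∈ _
    rw [map_zero, _root_.sub_zero]
    exact Submodule.zero_mem _
  rcases e₂ with _ | e₂
  · change 0 - symComp K c d _ _ _ _ _ 0 ∈ _
    rw [map_zero, _root_.sub_zero]
    exact Submodule.zero_mem _
  rw [entD₂_succ, map_zsmul, LinearMap.smul_apply]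
  change (((deg c v₁ e₁).negOnePow : ℤˣ) : ℤ) • entDComp₂ K c d _ _ _ _
      (symComp K c d _ _ _ _ (x v₁ e₁) _) -
    (((deg c v₁ e₁).negOnePow : ℤˣ) : ℤ) • symComp K c d _ _ _ _ _ (gcDComp K d _ _ _) ∈ _
  rw [← smul_sub]
  refine zsmul_mem ?_ _
  refine mem_univalentSpan_of_evalFun fun a ha hu => ?_
  rw [map_sub, evalFun_entDComp₂ ha hu, evalFun_dst₂_symComp ha hu, _root_.sub_self]

theorem gcge2D_Sym (x : GC K c) (y : GC K d) :
    gcge2D K c d (Sym K c d x y) =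
      Sym K c d (gcD K c x) y + Sym K c d (gcSign K c x) (gcD K d y) := by
  rw [Sym_apply, Sym_apply, Sym_apply, gcge2D, Submodule.mapQ_apply,
    ← Submodule.Quotient.mk_add, Submodule.Quotient.eq]
  have h := add_mem (entD₁_symRaw_mem x y) (entD₂_symRaw_mem x y)
  rwa [← add_sub_add_comm] at h

theorem gcge2D_Sym_of_mem {i : ℤ} {x : GC K c} (hx : x ∈ gcDeg K c i) (y : GC K d) :
    gcge2D K c d (Sym K c d x y) =
      Sym K c d (gcD K c x) y + ((i.negOnePow : ℤˣ) : ℤ) • Sym K c d x (gcD K d y) := by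
  rw [gcge2D_Sym, gcSign_of_mem hx, map_zsmul, LinearMap.smul_apply]

end SymMap

end GraphCplx

end

noncomputable section

namespace GraphCplx

/-! ### Functionals on `GC^{≥2}_{c,d}` from functionals on `GC_c` and `GC_d` -/

section Extension

variable {K : Type*} [Field K] {c d : ℤ} {v e v₁ e₁ v₂ e₂ : ℕ}

variable (K c) in
/-- The inclusion of the part with `v` vertices and `e` edges. -/
def gcIncl (v e : ℕ) : GCComp K c v e →ₗ[K] GC K c where
  toFun x := (Pi.single v (Pi.single e x) : (v e : ℕ) → GCComp K c v e)
  map_add' x y :=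
    (congrArg (fun z => (Pi.single v z : (v e : ℕ) → GCComp K c v e)) (Pi.single_add e x y)).trans
      (Pi.single_add (f := fun v => (e : ℕ) → GCComp K c v e) v (Pi.single e x) (Pi.single e y))
  map_smul' a x :=
    (congrArg (fun z => (Pi.single v z : (v e : ℕ) → GCComp K c v e)) (Pi.single_smul e a x)).trans
      (Pi.single_smul (f := fun v => (e : ℕ) → GCComp K c v e) v a (Pi.single e x))

theorem gcIncl_apply (x : GCComp K c v e) (v' e' : ℕ) : gcIncl K c v e x v' e' =
    (Pi.single v (Pi.single e x) : (v e : ℕ) → GCComp K c v e) v' e' := rfl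

theorem gcIncl_self (x : GCComp K c v e) : gcIncl K c v e x v e = x := by
  rw [gcIncl_apply, Pi.single_eq_same, Pi.single_eq_same]

theorem gcIncl_of_ne (x : GCComp K c v e) {v' e' : ℕ} (h : ¬ (v' = v ∧ e' = e)) :
    gcIncl K c v e x v' e' = 0 := by
  rw [gcIncl_apply]
  by_cases hv : v' = v
  · subst hv
    have he : e' ≠ e := fun he => h ⟨rfl, he⟩
    rw [Pi.single_eq_same, Pi.single_eq_of_ne he]
  · rw [Pi.single_eq_of_ne hv]
    rfl

theorem gcD_succ (x : GC K c) (v e : ℕ) :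
    gcD K c x (v + 1) (e + 1) = gcDComp K c v e (x v e) := rfl

theorem gcD_zero_vert (x : GC K c) (e : ℕ) : gcD K c x 0 e = 0 := rfl

theorem gcD_zero_edge (x : GC K c) (v : ℕ) : gcD K c x v 0 = 0 := by
  cases v <;> rfl

theorem gcD_gcIncl (x : GCComp K c v e) :
    gcD K c (gcIncl K c v e x) = gcIncl K c (v + 1) (e + 1) (gcDComp K c v e x) := by
  funext v' e'
  rcases v' with _ | v'
  · rw [gcIncl_of_ne _ (by omega), gcD_zero_vert]
  rcases e' with _ | e'
  · rw [gcIncl_of_ne _ (by omega), gcD_zero_edge]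
  rw [gcD_succ]
  by_cases h : v' = v ∧ e' = e
  · obtain ⟨rfl, rfl⟩ := h
    rw [gcIncl_self, gcIncl_self]
  · rw [gcIncl_of_ne _ h, gcIncl_of_ne _ (by omega), map_zero]

/-- The functional depends only on the part with `v` vertices and `e` edges. -/
def LocalAt (v e : ℕ) (f : GC K c →ₗ[K] K) : Prop := ∀ x, x v e = 0 → f x = 0

theorem LocalAt.apply {f : GC K c →ₗ[K] K} (hf : LocalAt v e f) (x : GC K c) :
    f x = f (gcIncl K c v e (x v e)) := by
  rw [← sub_eq_zero, ← map_sub]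
  refine hf _ ?_
  change x v e - gcIncl K c v e (x v e) v e = 0
  rw [gcIncl_self, _root_.sub_self]

theorem LocalAt.comp_gcIncl {f : GC K c →ₗ[K] K} (hf : LocalAt v e f) {v' e' : ℕ}
    (h : ¬ (v' = v ∧ e' = e)) : f ∘ₗ gcIncl K c v' e' = 0 := by
  refine LinearMap.ext fun x => hf _ (gcIncl_of_ne x ?_)
  omega

theorem LocalAt.eq_zero {f : GC K c →ₗ[K] K} (hf : LocalAt 0 e f) : f = 0 := by
  have h : f ∘ₗ gcIncl K c 0 e = 0 := GCComp.hom_ext fun Γ =>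
    absurd (show IsGC Γ.1 from Γ.2).pos_vert (lt_irrefl 0)
  refine LinearMap.ext fun x => ?_
  rw [hf.apply]
  exact LinearMap.congr_fun h _

theorem extFun_zero (Γ : Graph v e) : extFun (0 : GCComp K c v e →ₗ[K] K) Γ = 0 := by
  by_cases h : IsGC Γ
  · exact extFun_gen 0 h.gen
  · exact extFun_of_not 0 h

/-- A functional that vanishes on coboundaries, as a function on labelled graphs. -/
def closedFun (f : GC K c →ₗ[K] K) (hf : ∀ x, f (gcD K c x) = 0) : ClosedFun K c where
  toFun v e := extFun (f ∘ₗ gcIncl K c v e)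
  isGC h := by
    by_contra h'
    exact h (extFun_of_not _ h')
  relabel := extFun_relabel _
  closed {v e} Γ := by
    have h : (f ∘ₗ gcIncl K c (v + 1) (e + 1)) ∘ₗ gcDComp K c v e = 0 :=
      LinearMap.ext fun x => by
        have := hf (gcIncl K c v e x)
        rwa [gcD_gcIncl] at this
    rw [← extFun_comp_gcDComp, h, extFun_zero]

theorem gcComp_ext {U : Type*} [AddCommGroup U] [Module K U]
    {f g : GCComp K c v₁ e₁ →ₗ[K] GCComp K d v₂ e₂ →ₗ[K] U}
    (h : ∀ Γ₁ Γ₂, f (gcl K c Γ₁) (gcl K d Γ₂) = g (gcl K c Γ₁) (gcl K d Γ₂)) : f = g :=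
  GCComp.hom_ext fun Γ₁ => GCComp.hom_ext fun Γ₂ => h Γ₁ Γ₂

variable (K c d) in
/-- The part of an entangled graph with given numbers of vertices and edges. -/
def fcProj (v₁ e₁ v₂ e₂ : ℕ) : FcGC K c d →ₗ[K] FcGCComp K c d v₁ e₁ v₂ e₂ where
  toFun x := x v₁ e₁ v₂ e₂
  map_add' _ _ := rfl
  map_smul' _ _ := rfl

theorem noUnivalent_orb {x : Chain K c d v₁ e₁ v₂ e₂} (hx : x ∈ gcChains K c d _ _ _ _) :
    NoUnivalent (orb K c d x) := by
  intro P hP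
  suffices h : gcChains K c d v₁ e₁ v₂ e₂ ≤ LinearMap.ker (LinearMap.proj P ∘ₗ orb K c d) from
    h hx
  refine Submodule.span_le.2 ?_
  rintro _ ⟨X, ⟨h₁, h₂⟩, rfl⟩
  change orb K c d (cl K c d X) P = 0
  rw [orb_cl]
  refine Finset.sum_eq_zero fun r _ => ?_
  split_ifs with h
  · exfalso
    subst h
    rcases hP with ⟨x, hx⟩ | ⟨x, hx⟩
    · have := ((isGC_relabel r.1 X.1.1).2 h₁).2 x
      change 2 ≤ valence (relabelEnt r X).1.1 x at this
      omega
    · have := ((isGC_relabel r.2 X.2.1).2 h₂).2 x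
      change 2 ≤ valence (relabelEnt r X).2.1 x at this
      omega
  · rfl

theorem evalFun_smul {a : Ent v₁ e₁ v₂ e₂ → K} (ha : AntiInv c d a) (t : K)
    {b : Ent v₁ e₁ v₂ e₂ → K} (hb : AntiInv c d b) (h : a = t • b)
    (x : FcGCComp K c d v₁ e₁ v₂ e₂) : evalFun ha x = t * evalFun hb x := by
  suffices h : evalFun ha = t • evalFun hb from LinearMap.congr_fun h x
  refine FcGCComp.hom_ext fun P => ?_
  rw [evalFun_ecl, LinearMap.smul_apply, evalFun_ecl, h]
  rfl

theorem evalFun_entDComp_of_bd [CharZero K] {X : Chain K c d (v₁ + 1) (e₁ + 1) v₂ e₂}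
    {Y : Chain K c d v₁ e₁ (v₂ + 1) (e₂ + 1)} (hX : X ∈ gcChains K c d _ _ _ _)
    (hY : Y ∈ gcChains K c d _ _ _ _) {t : K} (h : bd K c d X = t • bd₂ K c d Y)
    (x : FcGCComp K c d v₁ e₁ v₂ e₂) :
    evalFun (orb_antiInv K c d X) (entDComp₁ K c d _ _ _ _ x) =
      t * evalFun (orb_antiInv K c d Y) (entDComp₂ K c d _ _ _ _ x) := by
  rw [evalFun_entDComp₁ _ (noUnivalent_orb hX), evalFun_entDComp₂ _ (noUnivalent_orb hY)]
  refine evalFun_smul _ t _ ?_ x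
  rw [dst_orb, dst₂_orb, h, map_smul, smul_comm]

/-! ### Extension of product functionals along `Sym` -/

theorem exists_functional_mk (L : FcGC K c d →ₗ[K] K) (hL : ∀ x ∈ GC1 K c d, L x = 0) :
    ∃ Λ : GCge2 K c d →ₗ[K] K, ∀ x, Λ (Submodule.Quotient.mk x) = L x :=
  ⟨Submodule.liftQ _ L hL, fun _ => rfl⟩

/-- The product function on labelled pairs, divided by the number of hair attachments. It serves for
the injectivity of `Sym`, where closedness plays no role. -/
theorem exists_functional_of_single (f : GC K c →ₗ[K] K) (g : GC K d →ₗ[K] K)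
    (hf : LocalAt v₁ e₁ f) (hg : LocalAt v₂ e₂ g) [CharZero K] :
    ∃ Λ : GCge2 K c d →ₗ[K] K, ∀ x y, Λ (Sym K c d x y) = f x * g y := by
  by_cases h0 : v₁ = 0 ∨ v₂ = 0
  · refine ⟨0, fun x y => ?_⟩
    rcases h0 with rfl | rfl
    · rw [hf.eq_zero, LinearMap.zero_apply, LinearMap.zero_apply, zero_mul]
    · rw [hg.eq_zero, LinearMap.zero_apply, LinearMap.zero_apply, mul_zero]
  push Not at h0
  let a : Ent v₁ e₁ v₂ e₂ → K := fun P =>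
    extFun (f ∘ₗ gcIncl K c v₁ e₁) P.1.1 * extFun (g ∘ₗ gcIncl K d v₂ e₂) P.2.1
  have ha : AntiInv c d a := by
    intro r P
    change extFun _ (relabel r.1 P.1.1) * extFun _ (relabel r.2 P.2.1) = sgE K c d r * _
    rw [extFun_relabel, extFun_relabel, sgE_eq]
    ring
  have hu : NoUnivalent a := by
    rintro P (⟨x, hx⟩ | ⟨x, hx⟩)
    · refine mul_eq_zero_of_left (extFun_of_not _ fun h => ?_) _
      have := h.2 x
      omega
    · refine mul_eq_zero_of_right _ (extFun_of_not _ fun h => ?_)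
      have := h.2 x
      omega
  have hC : ((v₁ : K) ^ e₂ * (v₂ : K) ^ e₁) ≠ 0 :=
    mul_ne_zero (pow_ne_zero _ (Nat.cast_ne_zero.2 h0.1)) (pow_ne_zero _ (Nat.cast_ne_zero.2 h0.2))
  obtain ⟨Λ, hΛ⟩ := exists_functional_mk (evalFun ha ∘ₗ fcProj K c d v₁ e₁ v₂ e₂)
    fun x hx => evalFun_univalentSpan ha hu (hx v₁ e₁ v₂ e₂)
  refine ⟨((v₁ : K) ^ e₂ * (v₂ : K) ^ e₁)⁻¹ • Λ, fun x y => ?_⟩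
  rw [LinearMap.smul_apply, Sym_apply, hΛ, smul_eq_mul, inv_mul_eq_iff_eq_mul₀ hC,
    hf.apply, hg.apply]
  have : (symComp K c d v₁ e₁ v₂ e₂).compr₂ (evalFun ha) = ((v₁ : K) ^ e₂ * (v₂ : K) ^ e₁) •
      (LinearMap.mul K K).compl₁₂ (f ∘ₗ gcIncl K c v₁ e₁) (g ∘ₗ gcIncl K d v₂ e₂) := by
    refine gcComp_ext fun Γ₁ Γ₂ => ?_
    rw [LinearMap.compr₂_apply, evalFun_symComp_gcl, fiberSum_mul, extFun_gen, extFun_gen]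
    rfl
  exact LinearMap.congr_fun (LinearMap.congr_fun this (x v₁ e₁)) (y v₂ e₂)

/-- Functionals on the parts of `fcGC_{c,d}` along a diagonal that fit together. -/
theorem sum_antidiagonal_fcGCD {a b a' b' : ℕ} (h : a = 0 ∨ b = 0) (h' : a' = 0 ∨ b' = 0)
    (F : ∀ k l, FcGCComp K c d (a + k) (b + k) (a' + l) (b' + l) →ₗ[K] K)
    (hF : ∀ k l (x : FcGCComp K c d (a + k) (b + k) (a' + l) (b' + l)),
      F (k + 1) l (entDComp₁ K c d _ _ _ _ x) +
        (((deg c (a + k) (b + k)).negOnePow : ℤˣ) : ℤ) •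
          F k (l + 1) (entDComp₂ K c d _ _ _ _ x) = 0) (N : ℕ) (y : FcGC K c d) :
    ∑ p ∈ Finset.HasAntidiagonal.antidiagonal N,
      F p.1 p.2 (fcGCD K c d y (a + p.1) (b + p.1) (a' + p.2) (b' + p.2)) = 0 := by
  have h1 : ∀ l, entD₁ K c d y (a + 0) (b + 0) (a' + l) (b' + l) = 0 := by
    intro l
    rcases h with rfl | rfl
    · exact entD₁_zero_vert _ _ _ _
    · exact entD₁_zero_edge _ _ _ _
  have h2 : ∀ k, entD₂ K c d y (a + k) (b + k) (a' + 0) (b' + 0) = 0 := by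
    intro l
    rcases h' with rfl | rfl
    · exact entD₂_zero_vert _ _ _ _
    · exact entD₂_zero_edge _ _ _ _
  have h3 : ∀ k l, F k l (fcGCD K c d y (a + k) (b + k) (a' + l) (b' + l)) =
      F k l (entD₁ K c d y (a + k) (b + k) (a' + l) (b' + l)) +
      F k l (entD₂ K c d y (a + k) (b + k) (a' + l) (b' + l)) := fun k l => map_add _ _ _
  simp only [h3]
  rw [Finset.sum_add_distrib]
  rcases N with _ | N
  · rw [Finset.Nat.antidiagonal_zero, Finset.sum_singleton, Finset.sum_singleton]
    dsimp only
    rw [h1, h2, map_zero, add_zero]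
  -- The `δ'` term at `(k + 1, l)` and the `δ''` term at `(k, l + 1)` come from the same component
  -- of `y` and cancel by `hF`; the terms at the two ends vanish.
  · rw [Finset.Nat.sum_antidiagonal_succ, Finset.Nat.sum_antidiagonal_succ']
    dsimp only
    rw [h1, h2, map_zero, map_zero, zero_add, zero_add, ← Finset.sum_add_distrib]
    refine Finset.sum_eq_zero fun p _ => ?_
    refine Eq.trans ?_ (hF p.1 p.2 (y (a + p.1) (b + p.1) (a' + p.2) (b' + p.2)))
    rw [← map_zsmul]
    rfl

theorem evalFun_orb_symComp {f : GC K c →ₗ[K] K} {g : GC K d →ₗ[K] K}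
    (hfD : ∀ x, f (gcD K c x) = 0) (hgD : ∀ x, g (gcD K d x) = 0)
    {X : Chain K c d v₁ e₁ v₂ e₂}
    (hX : X - startChain (closedFun f hfD) (closedFun g hgD) v₁ e₁ v₂ e₂ ∈
      colorDiff K c d _ _ _ _ ⊔ hairDiff K c d _ _ _ _) (x : GCComp K c v₁ e₁)
    (y : GCComp K d v₂ e₂) :
    evalFun (orb_antiInv K c d X) (symComp K c d _ _ _ _ x y) =
      (Fintype.card (Relabel v₁ e₁ × Relabel v₂ e₂) : K) *
        ((v₁ : K) ^ e₂ * (v₂ : K) ^ e₁ * (f (gcIncl K c _ _ x) * g (gcIncl K d _ _ y))) := by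
  have : (symComp K c d v₁ e₁ v₂ e₂).compr₂ (evalFun (orb_antiInv K c d X)) =
    ((Fintype.card (Relabel v₁ e₁ × Relabel v₂ e₂) : K) * ((v₁ : K) ^ e₂ * (v₂ : K) ^ e₁)) •
    (LinearMap.mul K K).compl₁₂ (f ∘ₗ gcIncl K c v₁ e₁) (g ∘ₗ gcIncl K d v₂ e₂) := by
    refine gcComp_ext fun Γ₁ Γ₂ => ?_
    have h1 := sum_fiber_orb_eq_zero hX Γ₁.1 Γ₂.1
    have h2 : fiberSum (orb K c d X) Γ₁.1 Γ₂.1 = fiberSum (orb K c d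
        (startChain (closedFun f hfD) (closedFun g hgD) v₁ e₁ v₂ e₂)) Γ₁.1 Γ₂.1 := by
      rw [← sub_eq_zero, ← h1, map_sub]
      unfold fiberSum
      rw [← Finset.sum_sub_distrib]
      refine Finset.sum_congr rfl fun P _ => ?_
      rw [Pi.sub_apply]
      split_ifs
      · rfl
      · exact _root_.sub_zero _
    rw [LinearMap.compr₂_apply, evalFun_symComp_gcl, h2, fiberSum_orb_startChain]
    have hA : (closedFun f hfD).toFun _ _ Γ₁.1 = f (gcIncl K c _ _ (gcl K c Γ₁)) := extFun_gen _ Γ₁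
    have hB : (closedFun g hgD).toFun _ _ Γ₂.1 = g (gcIncl K d _ _ (gcl K d Γ₂)) := extFun_gen _ Γ₂
    rw [hA, hB, ← mul_assoc]
    rfl
  refine (LinearMap.congr_fun (LinearMap.congr_fun this x) y).trans ?_
  exact mul_assoc _ _ _

/-- The product of `f` and `g` gives chains that are closed up to changes of attachments. Their
correction by `exists_closed` does not affect values on the image of `Sym`, and the corrected chains
along one antidiagonal add up to the required functional. -/
theorem exists_closed_functional [CharZero K] (f : GC K c →ₗ[K] K) (g : GC K d →ₗ[K] K)
    (hf : LocalAt v₁ e₁ f) (hg : LocalAt v₂ e₂ g) (hfD : ∀ x, f (gcD K c x) = 0)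
    (hgD : ∀ x, g (gcD K d x) = 0) :
    ∃ Λ : GCge2 K c d →ₗ[K] K, (∀ y, Λ (gcge2D K c d y) = 0) ∧
      ∀ x y, Λ (Sym K c d x y) = f x * g y := by
  by_cases h0 : v₁ = 0 ∨ v₂ = 0
  · refine ⟨0, fun y => rfl, fun x y => ?_⟩
    rcases h0 with rfl | rfl
    · rw [hf.eq_zero, LinearMap.zero_apply, LinearMap.zero_apply, zero_mul]
    · rw [hg.eq_zero, LinearMap.zero_apply, LinearMap.zero_apply, mul_zero]
  push Not at h0
  -- Splitting raises the numbers of vertices and of edges by one each; `(a, b)` is the first point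
  -- on this diagonal.
  obtain ⟨a, b, k₀, hab, rfl, rfl⟩ : ∃ a b k₀, (a = 0 ∨ b = 0) ∧ v₁ = a + k₀ ∧ e₁ = b + k₀ :=
    ⟨v₁ - min v₁ e₁, e₁ - min v₁ e₁, min v₁ e₁, by omega, by omega, by omega⟩
  obtain ⟨a', b', l₀, hab', rfl, rfl⟩ :
      ∃ a' b' l₀, (a' = 0 ∨ b' = 0) ∧ v₂ = a' + l₀ ∧ e₂ = b' + l₀ :=
    ⟨v₂ - min v₂ e₂, e₂ - min v₂ e₂, min v₂ e₂, by omega, by omega, by omega⟩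
  let A := closedFun f hfD
  let B := closedFun g hgD
  let s : ℕ → K := fun k => ((((deg c (a + k) (b + k)).negOnePow : ℤˣ) : ℤ) : K)
  have hs : ∀ k, s k ≠ 0 := fun k => Int.cast_ne_zero.2 (Units.ne_zero _)
  -- Since `s k` is the sign in front of `δ''`, the factor `-s k` makes the contributions of `δ'`
  -- and `δ''` cancel.
  obtain ⟨X, hX1, hX2, hX3⟩ := exists_closed (K := K) (c := c) (d := d) hab hab'
    (fun k _ => -s k) (fun k _ => neg_ne_zero.2 (hs k))
    (fun k l => startChain A B (a + k) (b + k) (a' + l) (b' + l))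
    (fun _ _ => startChain_mem A B) (fun _ _ => bd_startChain_mem A B)
    (fun _ _ => bd₂_startChain_mem A B)
  let F : ∀ k l, FcGCComp K c d (a + k) (b + k) (a' + l) (b' + l) →ₗ[K] K := fun k l =>
    evalFun (orb_antiInv K c d (X k l))
  have hF : ∀ k l (x : FcGCComp K c d (a + k) (b + k) (a' + l) (b' + l)),
      F (k + 1) l (entDComp₁ K c d _ _ _ _ x) +
        (((deg c (a + k) (b + k)).negOnePow : ℤˣ) : ℤ) •
          F k (l + 1) (entDComp₂ K c d _ _ _ _ x) = 0 := by
    intro k l x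
    have h4 : F (k + 1) l (entDComp₁ K c d _ _ _ _ x) =
        -s k * F k (l + 1) (entDComp₂ K c d _ _ _ _ x) :=
      evalFun_entDComp_of_bd (v₁ := a + k) (e₁ := b + k) (v₂ := a' + l) (e₂ := b' + l)
        (hX1 (k + 1) l) (hX1 k (l + 1)) (hX3 k l) x
    rw [h4, zsmul_eq_mul]
    change -s k * _ + s k * _ = 0
    ring
  let L : FcGC K c d →ₗ[K] K := ∑ p ∈ Finset.HasAntidiagonal.antidiagonal (k₀ + l₀),
    F p.1 p.2 ∘ₗ fcProj K c d (a + p.1) (b + p.1) (a' + p.2) (b' + p.2)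
  have hL : ∀ y, L y = ∑ p ∈ Finset.HasAntidiagonal.antidiagonal (k₀ + l₀),
      F p.1 p.2 (y (a + p.1) (b + p.1) (a' + p.2) (b' + p.2)) := by
    intro y
    rw [LinearMap.sum_apply]
    rfl
  have hSym : ∀ k l (x : GC K c) (y : GC K d),
      F k l (symRaw K c d x y (a + k) (b + k) (a' + l) (b' + l)) =
        (Fintype.card (Relabel (a + k) (b + k) × Relabel (a' + l) (b' + l)) : K) *
          (((a + k : ℕ) : K) ^ (b' + l) * ((a' + l : ℕ) : K) ^ (b + k) *
            (f (gcIncl K c _ _ (x (a + k) (b + k))) *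
              g (gcIncl K d _ _ (y (a' + l) (b' + l))))) :=
    fun k l x y => evalFun_orb_symComp hfD hgD (hX2 k l) _ _
  -- The order of the relabelling group enters through `orb`, the powers count the hair attachments.
  let C : K := (Fintype.card (Relabel (a + k₀) (b + k₀) × Relabel (a' + l₀) (b' + l₀)) : K) *
    (((a + k₀ : ℕ) : K) ^ (b' + l₀) * ((a' + l₀ : ℕ) : K) ^ (b + k₀))
  have hC : C ≠ 0 := mul_ne_zero (card_relabel_ne_zero K)
    (mul_ne_zero (pow_ne_zero _ (Nat.cast_ne_zero.2 h0.1))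
      (pow_ne_zero _ (Nat.cast_ne_zero.2 h0.2)))
  obtain ⟨Λ, hΛ⟩ := exists_functional_mk L fun y hy => by
    rw [hL]
    exact Finset.sum_eq_zero fun p _ => evalFun_univalentSpan _ (noUnivalent_orb (hX1 _ _))
      (hy _ _ _ _)
  refine ⟨C⁻¹ • Λ, fun y => ?_, fun x y => ?_⟩
  · obtain ⟨y, rfl⟩ := Submodule.Quotient.mk_surjective _ y
    rw [gcge2D, Submodule.mapQ_apply, LinearMap.smul_apply, hΛ, hL,
      sum_antidiagonal_fcGCD hab hab' F hF, smul_zero]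
  · rw [LinearMap.smul_apply, Sym_apply, hΛ, smul_eq_mul,
      inv_mul_eq_iff_eq_mul₀ hC, hL, Finset.sum_eq_single (k₀, l₀)]
    · rw [hSym, ← hf.apply, ← hg.apply]
      exact (mul_assoc _ _ _).symm
    -- The other points of the antidiagonal contribute nothing, as `f` is supported at `k = k₀`.
    · rintro ⟨k, l⟩ hp hne
      rw [hSym]
      have hk : ¬ (a + k = a + k₀ ∧ b + k = b + k₀) := by
        rintro ⟨h1, -⟩
        rw [Finset.HasAntidiagonal.mem_antidiagonal] at hp
        dsimp only at hp
        exact hne (Prod.ext (by dsimp only; omega) (by dsimp only; omega))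
      have := LinearMap.congr_fun (hf.comp_gcIncl hk) (x (a + k) (b + k))
      rw [LinearMap.comp_apply] at this
      dsimp only
      rw [this, LinearMap.zero_apply, zero_mul, mul_zero, mul_zero]
    · intro h
      exact (h (Finset.HasAntidiagonal.mem_antidiagonal.2 rfl)).elim

end Extension

end GraphCplx

end

noncomputable section

namespace GraphCplx

/-! ### Linear algebra -/

section LinearAlgebra

variable {K : Type*} [Field K]

/-- A section of `T` over its range, extended to all of `W`. -/
theorem exists_generalized_inverse {V W : Type*} [AddCommGroup V] [Module K V] [AddCommGroup W]
    [Module K W] (T : V →ₗ[K] W) : ∃ h : W →ₗ[K] V, ∀ x, T (h (T x)) = T x := by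
  obtain ⟨s, hs⟩ := T.rangeRestrict.exists_rightInverse_of_surjective T.range_rangeRestrict
  obtain ⟨h, hh⟩ := LinearMap.exists_extend s
  refine ⟨h, fun x => ?_⟩
  have h1 : h (T x) = s (T.rangeRestrict x) := LinearMap.congr_fun hh (T.rangeRestrict x)
  rw [h1]
  exact congrArg Subtype.val (LinearMap.congr_fun hs (T.rangeRestrict x))

/-- In a basis of `W` the tensor has coefficients in `U`, which the functionals in `F` separate from
zero. -/
theorem tensor_eq_zero_of_left {U W : Type*} [AddCommGroup U] [Module K U] [AddCommGroup W]
    [Module K W] {F : Set (U →ₗ[K] K)} (hF : ∀ u, (∀ f ∈ F, f u = 0) → u = 0) (t : U ⊗[K] W)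
    (h : ∀ f ∈ F, TensorProduct.lid K W (LinearMap.rTensor W f t) = 0) : t = 0 := by
  classical
  let b := Module.Basis.ofVectorSpace K W
  let E := TensorProduct.equivFinsuppOfBasisRight (M := U) b
  rw [← E.map_eq_zero_iff]
  refine Finsupp.ext fun i => hF _ fun f hf => ?_
  have key : f ∘ₗ Finsupp.lapply i ∘ₗ E.toLinearMap =
      b.coord i ∘ₗ (TensorProduct.lid K W).toLinearMap ∘ₗ LinearMap.rTensor W f := by
    refine TensorProduct.ext' fun u w => ?_
    simp [E, mul_comm]
  have := LinearMap.congr_fun key t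
  simp only [LinearMap.comp_apply, LinearEquiv.coe_coe, h f hf, map_zero] at this
  exact this

/-- A tensor is zero if all products of functionals from two separating families vanish on it. -/
theorem tensor_eq_zero {U W : Type*} [AddCommGroup U] [Module K U] [AddCommGroup W]
    [Module K W] {F : Set (U →ₗ[K] K)} (hF : ∀ u, (∀ f ∈ F, f u = 0) → u = 0)
    {G : Set (W →ₗ[K] K)} (hG : ∀ w, (∀ g ∈ G, g w = 0) → w = 0) (t : U ⊗[K] W)
    (h : ∀ f ∈ F, ∀ g ∈ G, LinearMap.mul' K K (TensorProduct.map f g t) = 0) : t = 0 := by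
  refine tensor_eq_zero_of_left hF t fun f hf => hG _ fun g hg => ?_
  rw [← h f hf g hg]
  have key : g ∘ₗ (TensorProduct.lid K W).toLinearMap ∘ₗ LinearMap.rTensor W f =
      LinearMap.mul' K K ∘ₗ TensorProduct.map f g :=
    TensorProduct.ext' fun u w => by simp
  exact LinearMap.congr_fun key t

/-- A map out of a direct sum of tensor products is injective if it is detected by products of
functionals from separating families. -/
theorem directSum_tensor_injective {U W : ℤ → Type*} [∀ i, AddCommGroup (U i)]
    [∀ i, Module K (U i)] [∀ i, AddCommGroup (W i)] [∀ i, Module K (W i)] {X : Type*}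
    [AddCommGroup X] [Module K X] (Ψ : (⨁ i, (U i ⊗[K] W i)) →ₗ[K] X)
    (F : ∀ i, Set (U i →ₗ[K] K)) (hF : ∀ i u, (∀ f ∈ F i, f u = 0) → u = 0)
    (G : ∀ i, Set (W i →ₗ[K] K)) (hG : ∀ i w, (∀ g ∈ G i, g w = 0) → w = 0)
    (h : ∀ i, ∀ f ∈ F i, ∀ g ∈ G i, ∃ Λ : X →ₗ[K] K,
      (∀ u w, Λ (Ψ (DirectSum.lof K ℤ (fun i => U i ⊗[K] W i) i (u ⊗ₜ w))) = f u * g w) ∧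
      ∀ j, j ≠ i → ∀ u w, Λ (Ψ (DirectSum.lof K ℤ (fun i => U i ⊗[K] W i) j (u ⊗ₜ w))) = 0) :
    Function.Injective Ψ := by
  rw [injective_iff_map_eq_zero]
  intro t ht
  refine DFinsupp.ext fun i => tensor_eq_zero (hF i) (hG i) _ fun f hf g hg => ?_
  obtain ⟨Λ, h1, h2⟩ := h i f hf g hg
  have key : LinearMap.mul' K K ∘ₗ TensorProduct.map f g ∘ₗ
      DirectSum.component K ℤ (fun i => U i ⊗[K] W i) i = Λ ∘ₗ Ψ := by
    refine DirectSum.linearMap_ext K fun j => TensorProduct.ext' fun u w => ?_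
    simp only [LinearMap.comp_apply]
    by_cases hj : j = i
    · subst hj
      rw [h1, DirectSum.component.lof_self]
      simp
    · rw [h2 j hj, DirectSum.component.of, dif_neg hj, map_zero, map_zero]
  have := LinearMap.congr_fun key t
  rw [LinearMap.comp_apply Λ, ht, map_zero] at this
  exact this

theorem exists_bilinear_of_quotients {P Q R : Type*} [AddCommGroup P] [Module K P] [AddCommGroup Q]
    [Module K Q] [AddCommGroup R] [Module K R] (β : P →ₗ[K] Q →ₗ[K] R) (P' : Submodule K P)
    (Q' : Submodule K Q) (hP : ∀ x ∈ P', ∀ y, β x y = 0) (hQ : ∀ y ∈ Q', ∀ x, β x y = 0) :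
    ∃ B : (P ⧸ P') →ₗ[K] (Q ⧸ Q') →ₗ[K] R, ∀ x y, B (P'.mkQ x) (Q'.mkQ y) = β x y :=
  ⟨(Q'.liftQ ((P'.liftQ β fun x hx => LinearMap.ext (hP x hx)).flip) fun y hy => by
      refine Submodule.linearMap_qext _ (LinearMap.ext fun x => ?_)
      exact hQ y hy x).flip, fun _ _ => rfl⟩

/-- Take a complement of `B ⊔ Z`, intersect it with `D` and add `B`; the modular law gives the sum.
-/
theorem exists_between_compl {V : Type*} [AddCommGroup V] [Module K V] {B Z D : Submodule K V}
    (hB : B ≤ D) (hZ : Z ≤ D) (h : Disjoint B Z) :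
    ∃ C, B ≤ C ∧ C ≤ D ∧ Disjoint C Z ∧ C ⊔ Z = D := by
  obtain ⟨W, hW⟩ := (B ⊔ Z).exists_isCompl
  refine ⟨W ⊓ D ⊔ B, le_sup_right, sup_le inf_le_right hB,
    h.disjoint_sup_left_of_disjoint_sup_right ?_, ?_⟩
  · exact (hW.disjoint.mono_right inf_le_left).symm
  · rw [sup_assoc, sup_comm, ← sup_inf_assoc_of_le W (sup_le hB hZ), hW.sup_eq_top, top_inf_eq]

/-- A subcomplex has a complement if it meets the coboundaries only in its own coboundaries. -/
theorem exists_compl_subcomplex {V : Type*} [AddCommGroup V] [Module K V] (δ : V →ₗ[K] V)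
    (hδ : ∀ x, δ (δ x) = 0) (X A : ℤ → Submodule K V) (hAX : ∀ n, A n ≤ X n)
    (hX : ∀ n, ∀ x ∈ X n, δ x ∈ X (n + 1))
    (h : ∀ n, ∀ x ∈ X n, δ x ∈ A (n + 1) → ∃ a ∈ A n, δ a = δ x) :
    ∃ C : ℤ → Submodule K V, (∀ n, ∀ z ∈ C n, δ z ∈ C (n + 1)) ∧
      ∀ n, Disjoint (A n) (C n) ∧ A n ⊔ C n = X n := by
  -- `B n` complements the coboundaries of `A` among those of `X`; by `h` it meets `A` only in zero.
  have hB : ∀ n, ∃ B : Submodule K V, B ≤ (X n).map δ ∧ Disjoint B ((A n).map δ) ∧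
      B ⊔ (A n).map δ = (X n).map δ := by
    intro n
    obtain ⟨B, -, h1, h2, h3⟩ := exists_between_compl (B := ⊥) bot_le
      (Submodule.map_mono (f := δ) (hAX n)) disjoint_bot_left
    exact ⟨B, h1, h2, h3⟩
  choose B hB1 hB2 hB3 using hB
  have hBδ : ∀ n, ∀ x ∈ B n, δ x = 0 := by
    intro n x hx
    obtain ⟨y, -, rfl⟩ := hB1 n hx
    exact hδ y
  have hBA : ∀ n, ∀ x ∈ B n, x ∈ A (n + 1) → x = 0 := by
    intro n x hx hxA
    obtain ⟨y, hy, rfl⟩ := hB1 n hx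
    obtain ⟨a, ha, hay⟩ := h n y hy hxA
    exact Submodule.disjoint_def.1 (hB2 n) _ hx ⟨a, ha, hay⟩
  -- `C n` complements the cocycles of `A` in the preimage of `B n`. Then `δ` maps `C n` into `B n`,
  -- which lies in `C (n + 1)` by construction.
  have hC : ∀ n, ∃ C : Submodule K V, B (n - 1) ≤ C ∧ C ≤ X n ⊓ (B n).comap δ ∧
      Disjoint C (A n ⊓ LinearMap.ker δ) ∧
      C ⊔ (A n ⊓ LinearMap.ker δ) = X n ⊓ (B n).comap δ := by
    intro n
    refine exists_between_compl (le_inf ?_ ?_) (inf_le_inf (hAX n) ?_) ?_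
    · intro x hx
      obtain ⟨y, hy, rfl⟩ := hB1 _ hx
      have := hX _ y hy
      rwa [sub_add_cancel] at this
    · intro x hx
      rw [Submodule.mem_comap, hBδ _ x hx]
      exact Submodule.zero_mem _
    · intro x hx
      rw [Submodule.mem_comap, LinearMap.mem_ker.1 hx]
      exact Submodule.zero_mem _
    · rw [Submodule.disjoint_def]
      intro x hx hxA
      refine hBA (n - 1) x hx ?_
      rw [sub_add_cancel]
      exact hxA.1
  choose C hC1 hC2 hC3 hC4 using hC
  refine ⟨C, fun n z hz => ?_, fun n => ⟨?_, le_antisymm ?_ ?_⟩⟩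
  · have h1 := hC1 (n + 1)
    rw [add_sub_cancel_right] at h1
    exact h1 (hC2 n hz).2
  · rw [Submodule.disjoint_def]
    intro x hxA hxC
    refine Submodule.disjoint_def.1 (hC3 n) x hxC ⟨hxA, ?_⟩
    exact Submodule.disjoint_def.1 (hB2 n) _ (hC2 n hxC).2 ⟨x, hxA, rfl⟩
  · exact sup_le (hAX n) ((hC2 n).trans inf_le_left)
  · intro x hx
    have h1 : δ x ∈ B n ⊔ (A n).map δ := by
      rw [hB3 n]
      exact ⟨x, hx, rfl⟩
    obtain ⟨b, hb, _, ⟨a, ha, rfl⟩, hab⟩ := Submodule.mem_sup.1 h1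
    have h2 : x - a ∈ C n ⊔ (A n ⊓ LinearMap.ker δ) := by
      rw [hC4 n]
      refine ⟨Submodule.sub_mem _ hx (hAX n ha), ?_⟩
      rwa [SetLike.mem_coe, Submodule.mem_comap, map_sub, ← hab, add_sub_cancel_right]
    have h3 : x - a ∈ A n ⊔ C n := by
      rw [sup_comm]
      exact (sup_le le_sup_left (inf_le_left.trans le_sup_right) :
        C n ⊔ (A n ⊓ LinearMap.ker δ) ≤ C n ⊔ A n) h2
    rw [← sub_add_cancel x a]
    exact add_mem h3 (Submodule.mem_sup_left ha)

end LinearAlgebra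

/-! ### A homotopy on `GC_c` -/

section Homotopy

variable {K : Type*} [Field K] {c d : ℤ} {v e v₁ e₁ v₂ e₂ : ℕ}

variable (K c) in
/-- A generalized inverse of the differential. -/
def gcH : GC K c →ₗ[K] GC K c where
  toFun x := fun v e => (exists_generalized_inverse (gcDComp K c v e)).choose (x (v + 1) (e + 1))
  map_add' x y := by
    funext v e
    exact map_add _ _ _
  map_smul' a x := by
    funext v e
    exact map_smul (exists_generalized_inverse (gcDComp K c v e)).choose a _

theorem gcH_apply (x : GC K c) (v e : ℕ) : gcH K c x v e =
    (exists_generalized_inverse (gcDComp K c v e)).choose (x (v + 1) (e + 1)) := rfl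

theorem gcD_gcH_gcD (x : GC K c) : gcD K c (gcH K c (gcD K c x)) = gcD K c x := by
  funext v e
  rcases v with _ | v
  · rfl
  rcases e with _ | e
  · rfl
  exact (exists_generalized_inverse (gcDComp K c v e)).choose_spec _

theorem gcH_mem {n : ℤ} {x : GC K c} (hx : x ∈ gcDeg K c n) : gcH K c x ∈ gcDeg K c (n - 1) := by
  intro v e h
  rw [gcH_apply, hx, map_zero]
  rw [deg_succ_succ]
  omega

theorem gcSign_mem {n : ℤ} {x : GC K c} (hx : x ∈ gcDeg K c n) : gcSign K c x ∈ gcDeg K c n := by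
  rw [gcSign_of_mem hx]
  exact zsmul_mem hx _

theorem gcSign_gcSign (x : GC K c) : gcSign K c (gcSign K c x) = x := by
  funext v e
  rw [gcSign_apply, gcSign_apply, smul_smul, Int.units_coe_mul_self, one_smul]

theorem gcD_gcSign (x : GC K c) : gcD K c (gcSign K c x) = -gcSign K c (gcD K c x) := by
  funext v e
  change _ = -(gcSign K c (gcD K c x) v e)
  rcases v with _ | v
  · rw [gcSign_apply, gcD_zero_vert, gcD_zero_vert, smul_zero, neg_zero]
  rcases e with _ | e
  · rw [gcSign_apply, gcD_zero_edge, gcD_zero_edge, smul_zero, neg_zero]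
  rw [gcSign_apply, gcD_succ, gcD_succ, gcSign_apply, map_zsmul, negOnePow_deg_succ_succ, neg_smul,
    neg_neg]

theorem gcH_gcSign (x : GC K c) : gcH K c (gcSign K c x) = -gcSign K c (gcH K c x) := by
  funext v e
  change _ = -(gcSign K c (gcH K c x) v e)
  rw [gcSign_apply, gcH_apply, gcH_apply, gcSign_apply, map_zsmul, negOnePow_deg_succ_succ,
    neg_smul]

variable (K c) in
/-- A projection of `GC_c` onto representatives of the cohomology. -/
def gcP : GC K c →ₗ[K] GC K c :=
  LinearMap.id - gcD K c ∘ₗ gcH K c - gcH K c ∘ₗ gcD K c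

theorem gcP_apply (x : GC K c) :
    gcP K c x = x - gcD K c (gcH K c x) - gcH K c (gcD K c x) := rfl

/-- Composition with `gcP` thus turns every functional into one that vanishes on coboundaries. -/
theorem gcP_gcD [CharZero K] (x : GC K c) : gcP K c (gcD K c x) = 0 := by
  rw [gcP_apply, gcD_gcH_gcD, gcD_gcD, map_zero, _root_.sub_self, _root_.sub_zero]

theorem gcD_gcP [CharZero K] (x : GC K c) : gcD K c (gcP K c x) = 0 := by
  rw [gcP_apply, map_sub, map_sub, gcD_gcH_gcD, gcD_gcD, _root_.sub_zero, _root_.sub_self]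

theorem gcP_gcSign (x : GC K c) : gcP K c (gcSign K c x) = gcSign K c (gcP K c x) := by
  simp only [gcP_apply, gcD_gcSign, gcH_gcSign, map_neg, map_sub, neg_neg]

/-- `gcP` acts on each component separately, because `gcH` and the differential shift the numbers of
vertices and edges in opposite directions. So it preserves degrees and locality of functionals. -/
theorem gcP_eq_zero {x : GC K c} (h : x v e = 0) : gcP K c x v e = 0 := by
  change x v e - gcD K c (gcH K c x) v e - gcH K c (gcD K c x) v e = 0
  have h1 : gcH K c (gcD K c x) v e = 0 := by
    rw [gcH_apply, gcD_succ, h, map_zero, map_zero]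
  have h2 : gcD K c (gcH K c x) v e = 0 := by
    rcases v with _ | v
    · rfl
    rcases e with _ | e
    · rfl
    rw [gcD_succ, gcH_apply, h, map_zero, map_zero]
  rw [h, h1, h2, _root_.sub_zero, _root_.sub_zero]

theorem LocalAt.comp_gcP {f : GC K c →ₗ[K] K} (hf : LocalAt v e f) :
    LocalAt v e (f ∘ₗ gcP K c) := fun _ hx => hf _ (gcP_eq_zero hx)

theorem eq_zero_of_localAt {x : GC K c} (v e : ℕ) (h : ∀ f, LocalAt v e f → f x = 0) :
    x v e = 0 := by
  rw [← Module.forall_dual_apply_eq_zero_iff K]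
  intro φ
  let pr : GC K c →ₗ[K] GCComp K c v e :=
    { toFun := fun x => x v e, map_add' := fun _ _ => rfl, map_smul' := fun _ _ => rfl }
  refine h (φ ∘ₗ pr) fun y hy => ?_
  change φ (y v e) = 0
  rw [hy, map_zero]

theorem LocalAt.eq_zero_of_mem {f : GC K c →ₗ[K] K} (hf : LocalAt v e f) {i : ℤ} {x : GC K c}
    (hx : x ∈ gcDeg K c i) (h : deg c v e ≠ i) : f x = 0 := hf x (hx v e h)

end Homotopy

/-! ### The tensor product of the two complexes -/

section Tensor

variable {K : Type*} [Field K] {c d : ℤ}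

variable (K c d) in
/-- The map `Sym` on the tensor product. -/
def symT : GC K c ⊗[K] GC K d →ₗ[K] GCge2 K c d := TensorProduct.lift (Sym K c d)

variable (K c d) in
/-- The differential of the tensor product. -/
def dT : GC K c ⊗[K] GC K d →ₗ[K] GC K c ⊗[K] GC K d :=
  TensorProduct.map (gcD K c) LinearMap.id + TensorProduct.map (gcSign K c) (gcD K d)

variable (K c d) in
/-- A homotopy between the identity and a projection onto representatives of the cohomology. -/
def hT : GC K c ⊗[K] GC K d →ₗ[K] GC K c ⊗[K] GC K d :=
  TensorProduct.map (gcH K c) LinearMap.id +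
    TensorProduct.map (gcSign K c ∘ₗ gcP K c) (gcH K d)

theorem dT_tmul (x : GC K c) (y : GC K d) :
    dT K c d (x ⊗ₜ y) = gcD K c x ⊗ₜ y + gcSign K c x ⊗ₜ gcD K d y := rfl

theorem hT_tmul (x : GC K c) (y : GC K d) :
    hT K c d (x ⊗ₜ y) = gcH K c x ⊗ₜ y + gcSign K c (gcP K c x) ⊗ₜ gcH K d y := rfl

theorem gcge2D_symT (t : GC K c ⊗[K] GC K d) :
    gcge2D K c d (symT K c d t) = symT K c d (dT K c d t) := by
  suffices h : gcge2D K c d ∘ₗ symT K c d = symT K c d ∘ₗ dT K c d from LinearMap.congr_fun h t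
  refine TensorProduct.ext' fun x y => ?_
  rw [LinearMap.comp_apply, LinearMap.comp_apply, dT_tmul, map_add]
  exact gcge2D_Sym x y

/-- The usual homotopy on a tensor product: from `1 ⊗ 1` to `P ⊗ 1` by the left factor, from there
to `P ⊗ P` by the right one. The mixed terms cancel because `gcSign` anticommutes with `gcD` and
with `gcH`. -/
theorem dT_hT_add [CharZero K] (t : GC K c ⊗[K] GC K d) :
    dT K c d (hT K c d t) + hT K c d (dT K c d t) =
      t - TensorProduct.map (gcP K c) (gcP K d) t := by
  suffices h : dT K c d ∘ₗ hT K c d + hT K c d ∘ₗ dT K c d =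
      LinearMap.id - TensorProduct.map (gcP K c) (gcP K d) from LinearMap.congr_fun h t
  refine TensorProduct.ext' fun x y => ?_
  simp only [LinearMap.add_apply, LinearMap.sub_apply, LinearMap.comp_apply, LinearMap.id_apply,
    dT_tmul, hT_tmul, map_add, TensorProduct.map_tmul, gcD_gcSign, gcD_gcP, gcP_gcD, gcH_gcSign,
    gcP_gcSign, gcSign_gcSign, map_zero, neg_zero, TensorProduct.zero_tmul, TensorProduct.neg_tmul]
  have h1 : x ⊗ₜ[K] y = (gcP K c x + gcD K c (gcH K c x) + gcH K c (gcD K c x)) ⊗ₜ[K] y := by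
    rw [gcP_apply]
    congr 1
    abel
  have h2 : gcP K c x ⊗ₜ[K] y = gcP K c x ⊗ₜ[K]
      (gcP K d y + gcD K d (gcH K d y) + gcH K d (gcD K d y)) := by
    rw [gcP_apply y]
    congr 1
    abel
  rw [h1, TensorProduct.add_tmul, TensorProduct.add_tmul, h2, TensorProduct.tmul_add,
    TensorProduct.tmul_add]
  abel

theorem comp_symT {f : GC K c →ₗ[K] K} {g : GC K d →ₗ[K] K} {Λ : GCge2 K c d →ₗ[K] K}
    (h : ∀ x y, Λ (Sym K c d x y) = f x * g y) (t : GC K c ⊗[K] GC K d) :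
    LinearMap.mul' K K (TensorProduct.map f g t) = Λ (symT K c d t) := by
  suffices h : LinearMap.mul' K K ∘ₗ TensorProduct.map f g = Λ ∘ₗ symT K c d from
    LinearMap.congr_fun h t
  exact TensorProduct.ext' fun x y => (h x y).symm

theorem separating_localAt (x : GC K c)
    (h : ∀ f ∈ {f : GC K c →ₗ[K] K | ∃ v e, LocalAt v e f}, f x = 0) : x = 0 := by
  funext v e
  exact eq_zero_of_localAt v e fun f hf => h f ⟨v, e, hf⟩

theorem symT_injective [CharZero K] : Function.Injective (symT K c d) := by
  rw [injective_iff_map_eq_zero]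
  intro t ht
  refine tensor_eq_zero separating_localAt separating_localAt t ?_
  rintro f ⟨v₁, e₁, hf⟩ g ⟨v₂, e₂, hg⟩
  obtain ⟨Λ, hΛ⟩ := exists_functional_of_single f g hf hg
  rw [comp_symT hΛ, ht, map_zero]

/-- Tested on local functionals `f` and `g`: the composites with `gcP` are closed, so their product
extends to a closed functional, which kills the coboundary. -/
theorem map_gcP_eq_zero [CharZero K] {t : GC K c ⊗[K] GC K d} {x : GCge2 K c d}
    (h : symT K c d t = gcge2D K c d x) : TensorProduct.map (gcP K c) (gcP K d) t = 0 := by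
  refine tensor_eq_zero separating_localAt separating_localAt _ ?_
  rintro f ⟨v₁, e₁, hf⟩ g ⟨v₂, e₂, hg⟩
  obtain ⟨Λ, hΛ, hΛ'⟩ := exists_closed_functional (f ∘ₗ gcP K c) (g ∘ₗ gcP K d) hf.comp_gcP
    hg.comp_gcP (fun x => by rw [LinearMap.comp_apply, gcP_gcD, map_zero])
    (fun x => by rw [LinearMap.comp_apply, gcP_gcD, map_zero])
  rw [← LinearMap.comp_apply (TensorProduct.map f g), ← TensorProduct.map_comp, comp_symT hΛ', h, hΛ]

/-- The primitive `hT t` is explicit and has the correct degree by `hT_mem`; this gives the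
hypothesis of `exists_compl_subcomplex`. -/
theorem eq_dT_hT [CharZero K] {t : GC K c ⊗[K] GC K d} {x : GCge2 K c d}
    (h : symT K c d t = gcge2D K c d x) : t = dT K c d (hT K c d t) := by
  have h1 : dT K c d t = 0 := symT_injective (by
    rw [← gcge2D_symT, h, gcge2D_gcge2D, map_zero])
  have h2 := dT_hT_add t
  rw [h1, map_zero, add_zero, map_gcP_eq_zero h, _root_.sub_zero] at h2
  exact h2.symm

variable (K c d) in
/-- The inclusion of the part of degree `n` of the tensor product. -/
def inclT (n : ℤ) : TensorDeg K c d n →ₗ[K] GC K c ⊗[K] GC K d :=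
  DirectSum.toModule K ℤ _ fun i =>
    TensorProduct.map (gcDeg K c i).subtype (gcDeg K d (n - i)).subtype

theorem symDeg_lof (n i : ℤ) (x : gcDeg K c i) (y : gcDeg K d (n - i)) :
    symDeg K c d n (DirectSum.lof K ℤ (fun i => gcDeg K c i ⊗[K] gcDeg K d (n - i)) i (x ⊗ₜ y)) =
      Sym K c d x y := by
  rw [symDeg, DirectSum.toModule_lof]
  rfl

theorem inclT_lof (n i : ℤ) (x : gcDeg K c i) (y : gcDeg K d (n - i)) :
    inclT K c d n (DirectSum.lof K ℤ (fun i => gcDeg K c i ⊗[K] gcDeg K d (n - i)) i (x ⊗ₜ y)) =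
      (x : GC K c) ⊗ₜ (y : GC K d) := by
  rw [inclT, DirectSum.toModule_lof]
  rfl

theorem symT_inclT (n : ℤ) : symT K c d ∘ₗ inclT K c d n = symDeg K c d n := by
  refine DirectSum.linearMap_ext K fun i => TensorProduct.ext' fun x y => ?_
  rw [LinearMap.comp_apply, LinearMap.comp_apply, LinearMap.comp_apply, inclT_lof, symDeg_lof]
  rfl

theorem tmul_mem_range_inclT {n i j : ℤ} (h : i + j = n) {x : GC K c} (hx : x ∈ gcDeg K c i)
    {y : GC K d} (hy : y ∈ gcDeg K d j) : x ⊗ₜ[K] y ∈ LinearMap.range (inclT K c d n) := by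
  obtain rfl : j = n - i := by omega
  exact ⟨_, inclT_lof n i ⟨x, hx⟩ ⟨y, hy⟩⟩

theorem range_inclT_le {n : ℤ} {N : Submodule K (GC K c ⊗[K] GC K d)}
    (h : ∀ i, ∀ x ∈ gcDeg K c i, ∀ y ∈ gcDeg K d (n - i), x ⊗ₜ[K] y ∈ N) :
    LinearMap.range (inclT K c d n) ≤ N := by
  rw [LinearMap.range_eq_map, Submodule.map_le_iff_le_comap]
  intro t _
  have key : N.mkQ ∘ₗ inclT K c d n = 0 := by
    refine DirectSum.linearMap_ext K fun i => TensorProduct.ext' fun x y => ?_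
    rw [LinearMap.comp_apply, LinearMap.comp_apply, inclT_lof]
    exact (Submodule.Quotient.mk_eq_zero N).2 (h i x x.2 y y.2)
  exact (Submodule.Quotient.mk_eq_zero N).1 (LinearMap.congr_fun key t)

theorem gcP_mem {n : ℤ} {x : GC K c} (hx : x ∈ gcDeg K c n) : gcP K c x ∈ gcDeg K c n :=
  fun v e h => gcP_eq_zero (hx v e h)

theorem hT_mem {n : ℤ} {t : GC K c ⊗[K] GC K d} (ht : t ∈ LinearMap.range (inclT K c d n)) :
    hT K c d t ∈ LinearMap.range (inclT K c d (n - 1)) := by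
  refine range_inclT_le (N := (LinearMap.range (inclT K c d (n - 1))).comap (hT K c d))
    (fun i x hx y hy => ?_) ht
  rw [Submodule.mem_comap, hT_tmul]
  exact add_mem (tmul_mem_range_inclT (by omega) (gcH_mem hx) hy)
    (tmul_mem_range_inclT (by omega) (gcSign_mem (gcP_mem hx)) (gcH_mem hy))

theorem mem_range_symDeg {n : ℤ} {z : GCge2 K c d} : z ∈ LinearMap.range (symDeg K c d n) ↔
    ∃ t ∈ LinearMap.range (inclT K c d n), symT K c d t = z := by
  rw [← symT_inclT, LinearMap.range_comp]
  exact Submodule.mem_map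

theorem range_symDeg_le (n : ℤ) : LinearMap.range (symDeg K c d n) ≤ gcge2Deg K c d n := by
  intro z hz
  obtain ⟨t, ht, rfl⟩ := mem_range_symDeg.1 hz
  refine range_inclT_le (N := (gcge2Deg K c d n).comap (symT K c d))
    (fun i x hx y hy => ?_) ht
  have := Sym_mem hx hy
  rwa [add_sub_cancel] at this

theorem exists_compl_range_symDeg (K : Type*) [Field K] [CharZero K] (c d : ℤ) :
    ∃ C : ℤ → Submodule K (GCge2 K c d),
      (∀ n, ∀ z ∈ C n, gcge2D K c d z ∈ C (n + 1)) ∧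
      ∀ n, Disjoint (LinearMap.range (symDeg K c d n)) (C n) ∧
        LinearMap.range (symDeg K c d n) ⊔ C n = gcge2Deg K c d n := by
  refine exists_compl_subcomplex (gcge2D K c d) gcge2D_gcge2D (gcge2Deg K c d)
    (fun n => LinearMap.range (symDeg K c d n)) range_symDeg_le
    (isCochainComplex_gcge2D K c d).1 fun n x hx hDx => ?_
  obtain ⟨t, ht, h⟩ := mem_range_symDeg.1 hDx
  refine ⟨symT K c d (hT K c d t), mem_range_symDeg.2 ⟨_, ?_, rfl⟩, ?_⟩
  · have := hT_mem ht
    rwa [add_sub_cancel_right] at this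
  · rw [gcge2D_symT, ← eq_dT_hT h, h]

theorem symDeg_injective (K : Type*) [Field K] [CharZero K] (c d n : ℤ) :
    Function.Injective (symDeg K c d n) := by
  -- The functionals local at components of degree `i` separate elements of degree `i` and vanish in
  -- all other degrees.
  have hsep : ∀ (c i : ℤ) (u : gcDeg K c i), (∀ f ∈ {f : gcDeg K c i →ₗ[K] K |
      ∃ v e f', LocalAt v e f' ∧ deg c v e = i ∧ f = f' ∘ₗ (gcDeg K c i).subtype}, f u = 0) →
      u = 0 := by
    intro c i u hu
    refine Subtype.ext (funext fun v => funext fun e => ?_)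
    by_cases h : deg c v e = i
    · exact eq_zero_of_localAt v e fun f hf => hu _ ⟨v, e, f, hf, h, rfl⟩
    · exact u.2 v e h
  refine directSum_tensor_injective (symDeg K c d n) _ (fun i => hsep c i) _
    (fun i => hsep d (n - i)) ?_
  rintro i _ ⟨v₁, e₁, f, hf, hi, rfl⟩ _ ⟨v₂, e₂, g, hg, -, rfl⟩
  obtain ⟨Λ, hΛ⟩ := exists_functional_of_single f g hf hg
  refine ⟨Λ, fun u w => ?_, fun j hj u w => ?_⟩
  · rw [symDeg_lof, hΛ]
    rfl
  · rw [symDeg_lof, hΛ, hf.eq_zero_of_mem u.2 fun h => hj (h.symm.trans hi), zero_mul]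

end Tensor

/-! ### The induced map on cohomology -/

section CohomologyMap

variable {K : Type*} [Field K] {c d : ℤ}

theorem Sym_mem_cocycles {n i : ℤ} (x : cocycles (gcD K c) (gcDeg K c) i)
    (y : cocycles (gcD K d) (gcDeg K d) (n - i)) :
    Sym K c d (x : GC K c) (y : GC K d) ∈ cocycles (gcge2D K c d) (gcge2Deg K c d) n := by
  refine ⟨?_, ?_⟩
  · have := Sym_mem x.2.1 y.2.1
    rwa [add_sub_cancel] at this
  · rw [SetLike.mem_coe, LinearMap.mem_ker, gcge2D_Sym, LinearMap.mem_ker.1 x.2.2,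
      LinearMap.mem_ker.1 y.2.2, map_zero, map_zero, LinearMap.zero_apply, add_zero]

theorem Sym_left_mem_coboundaries {n i : ℤ} {x : GC K c}
    (hx : x ∈ coboundaries (gcD K c) (gcDeg K c) i) (y : cocycles (gcD K d) (gcDeg K d) (n - i)) :
    Sym K c d x (y : GC K d) ∈ coboundaries (gcge2D K c d) (gcge2Deg K c d) n := by
  obtain ⟨x, hx, rfl⟩ := hx
  refine ⟨Sym K c d x y, ?_, ?_⟩
  · have := Sym_mem hx y.2.1
    rwa [show i - 1 + (n - i) = n - 1 by ring] at this
  · rw [gcge2D_Sym, LinearMap.mem_ker.1 y.2.2, map_zero, add_zero]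

theorem Sym_right_mem_coboundaries {n i : ℤ} (x : cocycles (gcD K c) (gcDeg K c) i) {y : GC K d}
    (hy : y ∈ coboundaries (gcD K d) (gcDeg K d) (n - i)) :
    Sym K c d (x : GC K c) y ∈ coboundaries (gcge2D K c d) (gcge2Deg K c d) n := by
  obtain ⟨y, hy, rfl⟩ := hy
  -- The additional `gcSign` undoes the sign in the differential of the tensor product.
  refine ⟨Sym K c d (gcSign K c x) y, ?_, ?_⟩
  · have := Sym_mem (gcSign_mem x.2.1) hy
    rwa [show i + (n - i - 1) = n - 1 by ring] at this
  · rw [gcge2D_Sym, gcD_gcSign, LinearMap.mem_ker.1 x.2.2, map_zero, neg_zero, map_zero,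
      LinearMap.zero_apply, zero_add, gcSign_gcSign]

theorem cls_eq_zero_iff {M : Type*} [AddCommGroup M] [Module K M] {δ : M →ₗ[K] M}
    {A : ℤ → Submodule K M} {n : ℤ} (x : cocycles δ A n) :
    cls δ A n x = 0 ↔ (x : M) ∈ coboundaries δ A n :=
  Submodule.Quotient.mk_eq_zero _

theorem exists_cohomology_functional {M : Type*} [AddCommGroup M] [Module K M] {δ : M →ₗ[K] M}
    {A : ℤ → Submodule K M} (n : ℤ) {f : M →ₗ[K] K} (hf : ∀ x, f (δ x) = 0) :
    ∃ F : Cohomology δ A n →ₗ[K] K, ∀ x, F (cls δ A n x) = f x := by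
  refine ⟨Submodule.liftQ _ (f ∘ₗ (cocycles δ A n).subtype) ?_, fun x => rfl⟩
  rintro x ⟨y, -, hy⟩
  change f x = 0
  rw [← hf y, hy]
  rfl

theorem exists_cohomology_map (K : Type*) [Field K] [CharZero K] (c d n : ℤ) :
    ∃ Φ : (⨁ i : ℤ, (Cohomology (gcD K c) (gcDeg K c) i ⊗[K]
          Cohomology (gcD K d) (gcDeg K d) (n - i))) →ₗ[K]
          Cohomology (gcge2D K c d) (gcge2Deg K c d) n,
      ∀ (i : ℤ) (x : cocycles (gcD K c) (gcDeg K c) i)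
          (y : cocycles (gcD K d) (gcDeg K d) (n - i)),
          Φ (DirectSum.lof K ℤ (fun i : ℤ => Cohomology (gcD K c) (gcDeg K c) i ⊗[K]
              Cohomology (gcD K d) (gcDeg K d) (n - i)) i
              (cls (gcD K c) (gcDeg K c) i x ⊗ₜ[K] cls (gcD K d) (gcDeg K d) (n - i) y)) =
            cls (gcge2D K c d) (gcge2Deg K c d) n ⟨Sym K c d x y, Sym_mem_cocycles x y⟩ := by
  let β : ∀ i : ℤ, cocycles (gcD K c) (gcDeg K c) i →ₗ[K]
      cocycles (gcD K d) (gcDeg K d) (n - i) →ₗ[K]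
        Cohomology (gcge2D K c d) (gcge2Deg K c d) n := fun i =>
    LinearMap.mk₂ K (fun x y => cls (gcge2D K c d) (gcge2Deg K c d) n
        ⟨Sym K c d x y, Sym_mem_cocycles x y⟩)
      (fun x x' y => by
        rw [← map_add]
        exact congrArg _ (Subtype.ext (LinearMap.map_add₂ _ _ _ _)))
      (fun a x y => by
        rw [← map_smul]
        exact congrArg _ (Subtype.ext (LinearMap.map_smul₂ _ _ _ _)))
      (fun x y y' => by
        rw [← map_add]
        exact congrArg _ (Subtype.ext (map_add _ _ _)))
      (fun a x y => by
        rw [← map_smul]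
        exact congrArg _ (Subtype.ext (map_smul (Sym K c d (x : GC K c)) _ _)))
  have hβ : ∀ i, ∃ B : Cohomology (gcD K c) (gcDeg K c) i →ₗ[K]
      Cohomology (gcD K d) (gcDeg K d) (n - i) →ₗ[K]
        Cohomology (gcge2D K c d) (gcge2Deg K c d) n,
      ∀ x y, B (cls _ _ i x) (cls _ _ (n - i) y) = β i x y := fun i =>
    exists_bilinear_of_quotients (β i) _ _
      (fun x hx y => (cls_eq_zero_iff _).2 (Sym_left_mem_coboundaries hx y))
      (fun y hy x => (cls_eq_zero_iff _).2 (Sym_right_mem_coboundaries x hy))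
  choose B hB using hβ
  refine ⟨DirectSum.toModule K ℤ _ fun i => TensorProduct.lift (B i), fun i x y => ?_⟩
  rw [DirectSum.toModule_lof, TensorProduct.lift.tmul, hB]
  rfl

theorem cohomology_map_injective (K : Type*) [Field K] [CharZero K] (c d n : ℤ)
    (Φ : (⨁ i : ℤ, (Cohomology (gcD K c) (gcDeg K c) i ⊗[K]
          Cohomology (gcD K d) (gcDeg K d) (n - i))) →ₗ[K]
          Cohomology (gcge2D K c d) (gcge2Deg K c d) n)
    (hΦ : ∀ (i : ℤ) (x : cocycles (gcD K c) (gcDeg K c) i)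
          (y : cocycles (gcD K d) (gcDeg K d) (n - i)),
          Φ (DirectSum.lof K ℤ (fun i : ℤ => Cohomology (gcD K c) (gcDeg K c) i ⊗[K]
              Cohomology (gcD K d) (gcDeg K d) (n - i)) i
              (cls (gcD K c) (gcDeg K c) i x ⊗ₜ[K] cls (gcD K d) (gcDeg K d) (n - i) y)) =
            cls (gcge2D K c d) (gcge2Deg K c d) n ⟨Sym K c d x y, Sym_mem_cocycles x y⟩) :
    Function.Injective Φ := by
  -- If all closed local functionals vanish on the class of a cocycle `x`, then `gcP x = 0`, and `x
  -- = gcD (gcH x)` is a coboundary.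
  have hsep : ∀ (c i : ℤ) (u : Cohomology (gcD K c) (gcDeg K c) i),
      (∀ f ∈ {f : Cohomology (gcD K c) (gcDeg K c) i →ₗ[K] K |
        ∃ v e f', LocalAt v e f' ∧ deg c v e = i ∧ (∀ x, f' (gcD K c x) = 0) ∧
          ∀ x, f (cls _ _ i x) = f' x}, f u = 0) → u = 0 := by
    intro c i u hu
    obtain ⟨x, rfl⟩ := Submodule.mkQ_surjective _ u
    refine (cls_eq_zero_iff x).2 ⟨gcH K c x, gcH_mem x.2.1, ?_⟩
    have h1 : gcP K c (x : GC K c) = 0 := by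
      refine funext fun v => funext fun e => ?_
      by_cases h : deg c v e = i
      · refine eq_zero_of_localAt v e fun f hf => ?_
        have hc : ∀ y, (f ∘ₗ gcP K c) (gcD K c y) = 0 := fun y => by
          rw [LinearMap.comp_apply, gcP_gcD, map_zero]
        obtain ⟨F, hF⟩ := exists_cohomology_functional (A := gcDeg K c) i hc
        rw [← LinearMap.comp_apply, ← hF]
        exact hu F ⟨v, e, _, hf.comp_gcP, h, hc, hF⟩
      · exact gcP_eq_zero (x.2.1 v e h)
    rw [gcP_apply, LinearMap.mem_ker.1 x.2.2, map_zero, _root_.sub_zero, sub_eq_zero] at h1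
    exact h1.symm
  refine directSum_tensor_injective Φ _ (fun i => hsep c i) _ (fun i => hsep d (n - i)) ?_
  rintro i f' ⟨v₁, e₁, f, hf, hi, hfD, hff⟩ g' ⟨v₂, e₂, g, hg, -, hgD, hgg⟩
  obtain ⟨Λ, hΛ, hΛ'⟩ := exists_closed_functional f g hf hg hfD hgD
  obtain ⟨L, hL⟩ := exists_cohomology_functional (A := gcge2Deg K c d) n hΛ
  refine ⟨L, fun u w => ?_, fun j hj u w => ?_⟩
  · obtain ⟨x, rfl⟩ := Submodule.mkQ_surjective _ u
    obtain ⟨y, rfl⟩ := Submodule.mkQ_surjective _ w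
    refine (congrArg L (hΦ i x y)).trans ((hL _).trans ((hΛ' _ _).trans ?_))
    rw [← hff, ← hgg]
    rfl
  · obtain ⟨x, rfl⟩ := Submodule.mkQ_surjective _ u
    obtain ⟨y, rfl⟩ := Submodule.mkQ_surjective _ w
    refine (congrArg L (hΦ j x y)).trans ((hL _).trans ((hΛ' _ _).trans ?_))
    rw [hf.eq_zero_of_mem x.2.1 fun h => hj (h.symm.trans hi), zero_mul]

end CohomologyMap

end GraphCplx

end

/-- Summing over all hair attachments gives an injective chain map
`Sym : GC_c ⊗ GC_d → GC^{≥2}_{c,d}` of cochain complexes whose image is a direct summand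
subcomplex; it induces an injection `H(GC_c) ⊗ H(GC_d) → H(GC^{≥2}_{c,d})`. -/
theorem mainTheorem3 (K : Type*) [Field K] [CharZero K] (c d : ℤ) :
    -- the three objects are cochain complexes
    IsCochainComplex (gcD K c) (gcDeg K c) ∧
    IsCochainComplex (gcD K d) (gcDeg K d) ∧
    IsCochainComplex (gcge2D K c d) (gcge2Deg K c d) ∧
    -- `Sym` has degree zero and commutes with the differentials
    (∀ i j : ℤ, ∀ x ∈ gcDeg K c i, ∀ y ∈ gcDeg K d j,
      Sym K c d x y ∈ gcge2Deg K c d (i + j) ∧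
      gcge2D K c d (Sym K c d x y) =
        Sym K c d (gcD K c x) y + ((i.negOnePow : ℤˣ) : ℤ) • Sym K c d x (gcD K d y)) ∧
    -- `Sym` is injective on the graded tensor product
    (∀ n : ℤ, Function.Injective (symDeg K c d n)) ∧
    -- the image of `Sym` has a complement that is a subcomplex
    (∃ C : ℤ → Submodule K (GCge2 K c d),
      (∀ n, ∀ z ∈ C n, gcge2D K c d z ∈ C (n + 1)) ∧
      ∀ n, Disjoint (LinearMap.range (symDeg K c d n)) (C n) ∧
        LinearMap.range (symDeg K c d n) ⊔ C n = gcge2Deg K c d n) ∧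
    -- the induced map on cohomology is well defined and injective
    (∀ n : ℤ, ∃ Φ : (⨁ i : ℤ, (Cohomology (gcD K c) (gcDeg K c) i ⊗[K]
          Cohomology (gcD K d) (gcDeg K d) (n - i))) →ₗ[K]
          Cohomology (gcge2D K c d) (gcge2Deg K c d) n,
      (∀ (i : ℤ) (x : cocycles (gcD K c) (gcDeg K c) i)
          (y : cocycles (gcD K d) (gcDeg K d) (n - i)),
        ∃ h : Sym K c d (x : GC K c) (y : GC K d) ∈
            cocycles (gcge2D K c d) (gcge2Deg K c d) n,
          Φ (DirectSum.lof K ℤ (fun i : ℤ => Cohomology (gcD K c) (gcDeg K c) i ⊗[K]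
              Cohomology (gcD K d) (gcDeg K d) (n - i)) i
              (cls (gcD K c) (gcDeg K c) i x ⊗ₜ[K] cls (gcD K d) (gcDeg K d) (n - i) y)) =
            cls (gcge2D K c d) (gcge2Deg K c d) n ⟨Sym K c d x y, h⟩) ∧
      Function.Injective Φ) := by
  refine ⟨isCochainComplex_gcD K c, isCochainComplex_gcD K d, isCochainComplex_gcge2D K c d,
    fun i j x hx y hy => ⟨Sym_mem hx hy, gcge2D_Sym_of_mem hx y⟩, symDeg_injective K c d,
    exists_compl_range_symDeg K c d, fun n => ?_⟩
  obtain ⟨Φ, hΦ⟩ := exists_cohomology_map K c d n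
  exact ⟨Φ, fun i x y => ⟨Sym_mem_cocycles x y, hΦ i x y⟩,
    cohomology_map_injective K c d n Φ hΦ⟩
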